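/- Let $D_1, D_2\subset\mathbb{C}$ be bounded simply connected domains with $\overline{D_2}\subset D_1$, let $\Gamma_j=\partial D_j$, let $\alpha\in\mathbb{R}$ with $\alpha\neq 1$, and let $\omega_0=\chi_{D_1}+(\alpha-1)\chi_{D_2}$. Assume that $\Gamma_1$ is a Jordan curve of class $C^1$ and that $\Gamma_2$ is an ellipse which is not a circle. Let $\omega_t$ be the (Yudovich) weak solution of the planar Euler equation in vorticity form, $\partial_t\omega+v\cdot\nabla\omega=0$, $v=\nabla^\perp\Psi$, $\Psi(t,z)=\frac1{2\pi}\int\omega_t(\xi)\log|z-\xi|\,dA(\xi)$, with initial datum $\omega_0$. For $\Omega\in\mathbb{R}$ and $c\in\mathbb{C}$, say that the solution rotates around $c$ with angular velocity $\Omega$ if $\omega_t(z)=\omega_0\big(c+e^{-it\Omega}(z-c)\big)$ for all $t\ge 0$, and that it rotates uniformly with angular velocity $\Omega$ if $\int\omega_0\,dA\neq0$ and this holds with $c=\int z\,\omega_0\,dA\big/\int\omega_0\,dA$, the center of mass of $\omega_0$. For an ellipse with semi-axes $a\ge b>0$ put $Q=\frac{a-b}{a+b}$, and let $Q_2$ be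 this number for $\Gamma_2$. Then, for every $\Omega\in\mathbb{R}$, the solution rotates uniformly with angular velocity $\Omega$ if and only if (1) $\Gamma_1$ is an ellipse with the same foci as $\Gamma_2$, and (2) with $Q_1$ the number $Q$ of $\Gamma_1$, $$\Omega=\alpha\,\frac{Q_2^2-1}{4Q_2^2},\qquad Q_1=Q_2\Big(\frac{\alpha}{Q_2^2}+1-\alpha\Big),\qquad \frac{Q_2^2}{Q_2^2-1}<\alpha<0 .$$ Moreover, if the solution rotates with angular velocity $\Omega$ around some point $c\in\mathbb{C}$, then it rotates uniformly with angular velocity $\Omega$ in the above sense. In particular, a doubly connected patch ($\alpha=0$) whose inner boundary is a non-circular ellipse does not rotate around any point with any constant angular velocity. -/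

import Mathlib

open MeasureTheory Set

noncomputable section

/-- Velocity field with vorticity `w`, by the Biot-Savart law in the plane (identified with `ℂ`):
`v = ∇^⊥ Ψ` where `Ψ(z) = (1 / 2π) ∫ w(ξ) log |z - ξ| dA(ξ)`, that is
`v(z) = (i / 2π) ∫ w(ξ) (z - ξ) / |z - ξ|² dA(ξ)`. -/
def biotSavart (w : ℂ → ℝ) (z : ℂ) : ℂ :=
  Complex.I / (2 * Real.pi) * ∫ ξ : ℂ, (w ξ : ℂ) / (starRingEnd ℂ) (z - ξ)

/-- `ω` is a (Yudovich) weak solution on `t ≥ 0` of the planar Euler equation in vorticity form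
`∂ₜ ω + v · ∇ω = 0`, with `v(t, ·)` the Biot-Savart velocity of `ω(t, ·)`, and with initial
datum `ω₀`: it is bounded in `L¹ ∩ L^∞` and satisfies the equation against all smooth compactly
supported test functions `φ(t, z)`. In `weak`, the derivative of `φ` at `(t, z)` in the direction
`(1, v)` is `∂ₜ φ + v · ∇φ`. -/
structure IsEulerSolution (ω₀ : ℂ → ℝ) (ω : ℝ → ℂ → ℝ) : Prop where
  measurable : AEStronglyMeasurable (fun p : ℝ × ℂ => ω p.1 p.2)
    (volume.restrict (Ici (0 : ℝ) ×ˢ (univ : Set ℂ)))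
  integrable : ∀ t : ℝ, 0 ≤ t → Integrable (ω t)
  bounded : ∃ M : ℝ, ∀ t : ℝ, 0 ≤ t → (∀ᵐ z : ℂ, |ω t z| ≤ M) ∧ ∫ z : ℂ, |ω t z| ≤ M
  weak : ∀ φ : ℝ × ℂ → ℝ, ContDiff ℝ ((⊤ : ℕ∞) : WithTop ℕ∞) φ → HasCompactSupport φ →
    (∫ t in Ioi (0 : ℝ), ∫ z : ℂ,
        ω t z * fderiv ℝ φ (t, z) ((1 : ℝ), biotSavart (ω t) z))
      + ∫ z : ℂ, ω₀ z * φ (0, z) = 0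

/-- The vorticity `w` turned by the angle `t Ω` around the point `c`, at time `t`. -/
def rotated (w : ℂ → ℝ) (c : ℂ) (Ω : ℝ) (t : ℝ) (z : ℂ) : ℝ :=
  w (c + Complex.exp (-(Complex.I * (t * Ω : ℝ))) * (z - c))

/-- The solution with initial vorticity `w` is the uniform rotation of `w` around `c` with angular
velocity `Ω`. -/
def RotatesAbout (w : ℂ → ℝ) (c : ℂ) (Ω : ℝ) : Prop :=
  IsEulerSolution w (rotated w c Ω)

/-- Total mass of a vorticity. -/
def totalMass (w : ℂ → ℝ) : ℝ := ∫ z : ℂ, w z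

/-- Center of mass of a vorticity of nonzero total mass. -/
def centerOfMass (w : ℂ → ℝ) : ℂ := (∫ z : ℂ, z * (w z : ℂ)) / (totalMass w : ℂ)

/-- The solution with initial vorticity `w` rotates uniformly around the center of mass of `w`
(which has to exist) with angular velocity `Ω`. -/
def RotatesUniformly (w : ℂ → ℝ) (Ω : ℝ) : Prop :=
  totalMass w ≠ 0 ∧ RotatesAbout w (centerOfMass w) Ω

/-- Bounded simply connected domain in the plane. -/
structure IsBddSimplyConnectedDomain (D : Set ℂ) : Prop where
  isOpen : IsOpen D
  isBounded : Bornology.IsBounded D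
  isSimplyConnected : IsSimplyConnected D

/-- Jordan curve of class `C¹`, with a regular parametrization. -/
def IsC1JordanCurve (Γ : Set ℂ) : Prop :=
  ∃ γ : ℝ → ℂ, ContDiff ℝ 1 γ ∧ Function.Periodic γ 1 ∧ InjOn γ (Ico 0 1) ∧
    (∀ s, deriv γ s ≠ 0) ∧ range γ = Γ

/-- The ellipse with center `p`, semi-axis `a` in the direction `e^{iθ}` and semi-axis `b` in the
orthogonal direction. -/
def ellipse (p : ℂ) (θ a b : ℝ) : Set ℂ :=
  {z | ((Complex.exp (-(Complex.I * θ)) * (z - p)).re / a) ^ 2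
      + ((Complex.exp (-(Complex.I * θ)) * (z - p)).im / b) ^ 2 = 1}

/-- The foci of `ellipse p θ a b`, for `0 < b ≤ a`. -/
def ellipseFoci (p : ℂ) (θ a b : ℝ) : Set ℂ :=
  {p + Real.sqrt (a ^ 2 - b ^ 2) * Complex.exp (Complex.I * θ),
    p - Real.sqrt (a ^ 2 - b ^ 2) * Complex.exp (Complex.I * θ)}

/-- `Q = (a - b) / (a + b)` for an ellipse with semi-axes `a ≥ b`. -/
def ellipseQ (a b : ℝ) : ℝ := (a - b) / (a + b)

/-- The initial vorticity `χ_{D₁} + (α - 1) χ_{D₂}`. -/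
def patchVorticity (D₁ D₂ : Set ℂ) (α : ℝ) (z : ℂ) : ℝ :=
  D₁.indicator (fun _ => (1 : ℝ)) z + (α - 1) * D₂.indicator (fun _ => (1 : ℝ)) z

end

/-!
# Uniformly rotating patches with an elliptical inner boundary

The plane is `ℂ`, and the Cauchy transform of a bounded set `D` is
`C_D(z) = (1 / π) ∫_D dA(ξ) / (z - ξ)`; the velocity of the vorticity `χ_{D₁} + (α - 1) χ_{D₂}` is
`(i / 2) conj (C_{D₁} + (α - 1) C_{D₂})`. A rotating solution is stationary in the rotating frame,
so that (`rotatesAbout_iff`) the weak Euler equation says that the relative velocity, whose conjugate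
is `H = C_{D₁} + (α - 1) C_{D₂} - 2 Ω conj (z - c)` up to a factor, is tangent to the level sets of
the vorticity. Since test functions can be localized near `D₂`, this splits into one weak tangency
condition for `D₁` and one for `D₂` (`rotatesAbout_patchVorticity_iff`).

Ellipses are described as images of discs under `w ↦ w + κ * conj w`, with `|κ| = Q`. The Cauchy
transform of such an ellipse is `conj (z - p) - conj κ * (z - p)` inside
(`cauchyTransform_solidEllipse`), and a multiple of the exterior conformal map outside
(`exteriorCauchy_solidEllipse`).

*Inner boundary.* On the ellipse `D₂` the function `H` is, up to a linear field tangent to the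
ellipses homothetic to `D₂`, a holomorphic function `h`; testing with the imaginary part of its
primitive gives `∫ |h|² = 0` (`eq_zero_of_weaklyTangent_conj`). Hence `h = 0` on `D₂`, and by the
identity theorem `C_{D₁} - conj z` is affine on all of `D₁`.

*The outer domain is an ellipse.* If `C_{D₁} = conj (z - p₁) - conj κ₁ * (z - p₁)` on `D₁`, compare
`D₁` with the smallest ellipse of shape `κ₁` around it. At a point where the boundaries touch the two
Cauchy transforms agree, whereas `C_{E \ D₁}` has there a positive component in the normal direction
unless `E \ D₁` is a null set (`exists_solidEllipse_of_cauchyTransform_affine`). As the boundary is a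
Jordan curve, `D₁ = E` (`eq_solidEllipse_of_volume_diff_eq_zero`).

*Outer boundary.* Near the boundary of `D₁` the function `H` is, up to a tangent linear field,
holomorphic, and tangency in the weak sense gives the vanishing of its normal component
(`im_eq_zero_of_weaklyTangent`). In the coordinate `η` of the exterior of `D₁` this makes
`(1 / η - κ₁ η) C_{D₂}` a quadratic polynomial. But `C_{D₂}` also satisfies the quadratic equation
`sub_mul_cauchyTransform_solidEllipse`, and comparison of coefficients (`confocal_of_coeff_eq`) shows
that the ellipses are confocal, and gives a second relation between `Ω`, `α` and the shapes.
Elementary algebra then yields the values of `Ω` and `Q₁` and the bounds for `α`, and `Ω ≠ 0` forces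
`c` to be the common center (`exists_of_rotatesAbout`).

*Converse.* Outside the larger of two confocal ellipses the Cauchy transforms are proportional
(`cauchyTransform_confocal`), so that on `D₁` the part of the velocity due to `D₂` may be replaced by
a linear field (`rotatesAbout_confocal`).
-/


noncomputable section

open Metric Filter Topology Complex
open scoped ComplexConjugate Pointwise

/-! ### Averages over circles -/

/-- Polar coordinates: a function whose average over every circle about the origin, with at most one
exception, vanishes has integral zero. No integrability is needed, since a divergent integral is
zero by convention. -/
lemma integral_eq_zero_of_circleAverage_eq_zero {E : Type*} [NormedAddCommGroup E] [NormedSpace ℝ E]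
    {f : ℂ → E} (r₀ : ℝ)
    (h : ∀ r : ℝ, 0 < r → r ≠ r₀ → Real.circleAverage f 0 r = 0) : ∫ z, f z = 0 := by
  rw [← Complex.integral_comp_polarCoord_symm]
  have hT : polarCoord.target = Ioi (0 : ℝ) ×ˢ Ioo (-Real.pi) Real.pi := rfl
  rw [hT]
  by_cases hi : IntegrableOn (fun p : ℝ × ℝ => p.1 • f (Complex.polarCoord.symm p))
      (Ioi (0 : ℝ) ×ˢ Ioo (-Real.pi) Real.pi)
  · rw [Measure.volume_eq_prod, setIntegral_prod _ hi]
    refine integral_eq_zero_of_ae ?_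
    filter_upwards [ae_restrict_mem measurableSet_Ioi,
      ae_restrict_of_ae (volume.ae_ne r₀)] with r hr hr₀
    have h1 := h r hr hr₀
    rw [Real.circleAverage_eq_integral_add (-Real.pi)] at h1
    have h2 : ∫ θ in (0 : ℝ)..2 * Real.pi, f (circleMap 0 r (θ + -Real.pi)) = 0 := by
      simpa using h1
    rw [intervalIntegral.integral_comp_add_right (fun θ => f (circleMap 0 r θ)),
      intervalIntegral.integral_of_le (by linarith [Real.pi_pos]),
      integral_Ioc_eq_integral_Ioo] at h2
    have e1 : (0 : ℝ) + -Real.pi = -Real.pi := by ring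
    have e2 : 2 * Real.pi + -Real.pi = Real.pi := by ring
    rw [e1, e2] at h2
    simp only [integral_smul]
    have : ∀ θ : ℝ, Complex.polarCoord.symm (r, θ) = circleMap 0 r θ := fun θ => by
      simp [circleMap, Complex.exp_mul_I]
    simp only [this, h2, smul_zero, Pi.zero_apply]
  · exact integral_undef hi

/-- Mean value property on the unit circle. -/
lemma circleAverage_of_differentiableOn_nhds {h : ℂ → ℂ}
    (hh : ∀ z ∈ closedBall (0 : ℂ) 1, DifferentiableAt ℂ h z) :
    Real.circleAverage h 0 1 = h 0 := by
  refine circleAverage_of_differentiable_on_off_countable countable_empty ?_ ?_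
  · rw [abs_one]
    exact fun z hz => (hh z hz).continuousAt.continuousWithinAt
  · intro z hz
    exact hh z (by simpa using (ball_subset_closedBall hz.1))

/-! ### The Cauchy transform of a bounded set -/

/-- The Cauchy transform `(1 / π) ∫_D dA(ξ) / (z - ξ)` of the characteristic function of `D`. With
this normalization it is the antiholomorphic coordinate `conj z` plus a holomorphic function
inside `D`. -/
def cauchyTransform (D : Set ℂ) (z : ℂ) : ℂ := (1 / Real.pi : ℂ) * ∫ ξ in D, (z - ξ)⁻¹

lemma locallyIntegrable_inv : LocallyIntegrable (fun w : ℂ => w⁻¹) := by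
  refine locallyIntegrable_of_norm_le_rpow (C := 1) (α := 1) (by simp) (by simp) ?_
    measurable_inv.aestronglyMeasurable
  exact Eventually.of_forall fun x => by simp [Real.rpow_neg_one]

lemma integrable_indicator_inv (r : ℝ) :
    Integrable ((closedBall (0 : ℂ) r).indicator fun w : ℂ => w⁻¹) := by
  rw [integrable_indicator_iff measurableSet_closedBall]
  exact locallyIntegrable_inv.integrableOn_isCompact (isCompact_closedBall _ _)

lemma integrableOn_inv_sub {D : Set ℂ} (hD : Bornology.IsBounded D) (z : ℂ) :
    IntegrableOn (fun ξ => (z - ξ)⁻¹) D := by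
  obtain ⟨r, hr⟩ := hD.subset_closedBall z
  refine IntegrableOn.mono_set ?_ hr
  rw [← integrable_indicator_iff measurableSet_closedBall]
  refine ((integrable_indicator_inv r).comp_sub_left z).congr (Eventually.of_forall fun ξ => ?_)
  beta_reduce
  by_cases h : ξ ∈ closedBall z r
  · rw [indicator_of_mem h, indicator_of_mem]
    simpa [dist_eq_norm, norm_sub_rev] using h
  · rw [indicator_of_notMem h, indicator_of_notMem]
    simpa [dist_eq_norm, norm_sub_rev] using h

lemma cauchyTransform_eq_integral_indicator {D : Set ℂ} (hm : MeasurableSet D) (z : ℂ) :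
    cauchyTransform D z = (1 / Real.pi : ℂ) * ∫ w, D.indicator (fun _ => (1 : ℂ)) (z - w) * w⁻¹ := by
  have := integral_sub_left_eq_self
    (fun w : ℂ => D.indicator (fun _ => (1 : ℂ)) (z - w) * w⁻¹) volume z
  rw [← this, cauchyTransform, ← integral_indicator hm]
  congr 1
  refine integral_congr_ae (Eventually.of_forall fun ξ => ?_)
  by_cases h : ξ ∈ D <;> simp [h]

lemma continuous_cauchyTransform {D : Set ℂ} (hm : MeasurableSet D) (hb : Bornology.IsBounded D)
    (hf : volume (frontier D) = 0) : Continuous (cauchyTransform D) := by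
  rw [continuous_iff_continuousAt]
  intro z₀
  obtain ⟨r, hr⟩ := hb.subset_closedBall (0 : ℂ)
  have key : ContinuousAt
      (fun z => ∫ w, D.indicator (fun _ => (1 : ℂ)) (z - w) * w⁻¹) z₀ := by
    refine continuousAt_of_dominated
      (bound := fun w => ‖(closedBall (0 : ℂ) (‖z₀‖ + 1 + r)).indicator (fun w : ℂ => w⁻¹) w‖)
      ?_ ?_ (integrable_indicator_inv _).norm ?_
    · refine Eventually.of_forall fun z => Measurable.aestronglyMeasurable ?_
      exact ((measurable_const.indicator hm).comp (measurable_const.sub measurable_id)).mul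
        measurable_inv
    · filter_upwards [ball_mem_nhds z₀ one_pos] with z hz
      refine Eventually.of_forall fun w => ?_
      by_cases h : z - w ∈ D
      · rw [indicator_of_mem h, indicator_of_mem]
        · simp
        · have h1 := hr h
          have h2 : ‖w‖ ≤ ‖z - w‖ + ‖z‖ := by
            have := norm_sub_le z (z - w)
            simp only [sub_sub_cancel] at this; linarith
          have h3 : ‖z‖ ≤ ‖z₀‖ + 1 := by
            have := norm_le_norm_add_norm_sub' z z₀
            rw [mem_ball, dist_eq_norm] at hz; linarith
          simp only [mem_closedBall, dist_zero_right] at h1 ⊢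
          linarith
      · rw [indicator_of_notMem h]; simp
    · have h0 : ∀ᵐ w : ℂ, z₀ - w ∉ frontier D := by
        have := (Measure.measurePreserving_sub_left (volume : Measure ℂ) z₀).quasiMeasurePreserving
        exact this.ae (measure_eq_zero_iff_ae_notMem.1 hf)
      filter_upwards [h0] with w hw
      refine ContinuousAt.mul ?_ continuousAt_const
      have : ContinuousAt (D.indicator fun _ => (1 : ℂ)) (z₀ - w) := by
        rw [frontier, Set.mem_sdiff, not_and_or, not_not] at hw
        rcases hw with hw | hw
        · have : (D.indicator fun _ => (1 : ℂ)) =ᶠ[𝓝 (z₀ - w)] fun _ => 0 := by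
            filter_upwards [isClosed_closure.isOpen_compl.mem_nhds hw] with x hx
            exact indicator_of_notMem (fun h => hx (subset_closure h)) _
          exact continuousAt_const.congr this.symm
        · have : (D.indicator fun _ => (1 : ℂ)) =ᶠ[𝓝 (z₀ - w)] fun _ => 1 := by
            filter_upwards [isOpen_interior.mem_nhds hw] with x hx
            exact indicator_of_mem (interior_subset hx) _
          exact continuousAt_const.congr this.symm
      exact ContinuousAt.comp (f := fun z => z - w) this
        (continuousAt_id.sub continuousAt_const)
  have h2 : cauchyTransform D = fun z => (1 / Real.pi : ℂ) *
      ∫ w, D.indicator (fun _ => (1 : ℂ)) (z - w) * w⁻¹ :=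
    funext fun z => cauchyTransform_eq_integral_indicator hm z
  rw [h2]
  exact continuousAt_const.mul key

lemma norm_integral_inv_sub_le {D : Set ℂ} (hfin : volume D < ⊤) {z : ℂ} {δ : ℝ} (hδ : 0 < δ)
    (h : ∀ ξ ∈ D, δ ≤ ‖z - ξ‖) : ‖∫ ξ in D, (z - ξ)⁻¹‖ ≤ δ⁻¹ * volume.real D := by
  refine norm_setIntegral_le_of_norm_le_const hfin fun ξ hξ => ?_
  rw [norm_inv]
  exact inv_anti₀ hδ (h ξ hξ)

lemma differentiableAt_integral_inv_sub {D : Set ℂ} (hm : MeasurableSet D)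
    (hb : Bornology.IsBounded D) {z₀ : ℂ} (hz : z₀ ∉ closure D) :
    DifferentiableAt ℂ (fun z => ∫ ξ in D, (z - ξ)⁻¹) z₀ := by
  obtain ⟨δ, hδ, hball⟩ := Metric.isOpen_iff.1 isClosed_closure.isOpen_compl z₀ hz
  have hfin : volume D < ⊤ := hb.measure_lt_top
  have : IsFiniteMeasure (volume.restrict D) := ⟨by simpa using hfin⟩
  have hd : ∀ z ∈ ball z₀ (δ / 2), ∀ ξ ∈ D, δ / 2 ≤ ‖z - ξ‖ := by
    intro z hz ξ hξ
    by_contra! hlt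
    refine hball (a := ξ) ?_ (subset_closure hξ)
    rw [mem_ball] at hz ⊢
    rw [← dist_eq_norm] at hlt
    calc dist ξ z₀ ≤ dist ξ z + dist z z₀ := dist_triangle _ _ _
      _ < δ := by rw [dist_comm ξ z]; linarith
  refine (hasDerivAt_integral_of_dominated_loc_of_deriv_le (μ := volume.restrict D)
    (F' := fun z ξ => -((z - ξ) ^ 2)⁻¹)
    (bound := fun _ => ((δ / 2) ^ 2)⁻¹) (ball_mem_nhds z₀ (half_pos hδ)) ?_ ?_ ?_ ?_ ?_ ?_).2.differentiableAt
  · exact Eventually.of_forall fun z =>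
      (measurable_inv.comp (measurable_const.sub measurable_id)).aestronglyMeasurable
  · exact integrableOn_inv_sub hb z₀
  · exact (measurable_inv.comp
      ((measurable_const.sub measurable_id).pow_const 2)).neg.aestronglyMeasurable
  · filter_upwards [ae_restrict_mem hm] with ξ hξ z hz
    rw [norm_neg, norm_inv, norm_pow]
    have := hd z hz ξ hξ
    exact inv_anti₀ (by positivity) (by gcongr)
  · exact integrable_const _
  · filter_upwards [ae_restrict_mem hm] with ξ hξ z hz
    have hne : z - ξ ≠ 0 := by
      have := hd z hz ξ hξ
      intro h0; rw [h0, norm_zero] at this; linarith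
    have h1 := ((hasDerivAt_id z).sub_const ξ).inv hne
    refine h1.congr_deriv ?_
    simp [div_eq_mul_inv]

lemma differentiableAt_cauchyTransform {D : Set ℂ} (hm : MeasurableSet D)
    (hb : Bornology.IsBounded D) {z₀ : ℂ} (hz : z₀ ∉ closure D) :
    DifferentiableAt ℂ (cauchyTransform D) z₀ :=
  (differentiableAt_integral_inv_sub hm hb hz).const_mul _

lemma tendsto_cauchyTransform_cobounded {D : Set ℂ} (hb : Bornology.IsBounded D) :
    Tendsto (cauchyTransform D) (Bornology.cobounded ℂ) (𝓝 0) := by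
  obtain ⟨r, hr⟩ := hb.subset_closedBall (0 : ℂ)
  have hfin : volume D < ⊤ := hb.measure_lt_top
  have h1 : Tendsto (fun z : ℂ => (‖z‖ - r)⁻¹ * volume.real D) (Bornology.cobounded ℂ) (𝓝 0) := by
    have : Tendsto (fun z : ℂ => ‖z‖ - r) (Bornology.cobounded ℂ) atTop :=
      tendsto_atTop_add_const_right _ _ tendsto_norm_cobounded_atTop
    simpa using this.inv_tendsto_atTop.mul_const (volume.real D)
  have h2 : Tendsto (fun z : ℂ => ∫ ξ in D, (z - ξ)⁻¹) (Bornology.cobounded ℂ) (𝓝 0) := by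
    refine squeeze_zero_norm' ?_ h1
    filter_upwards [tendsto_norm_cobounded_atTop.eventually_gt_atTop r] with z hz
    refine norm_integral_inv_sub_le hfin (sub_pos.2 hz) fun ξ hξ => ?_
    have h3 := hr hξ
    rw [mem_closedBall, dist_zero_right] at h3
    linarith [norm_sub_norm_le z ξ]
  have h3 := h2.const_mul (1 / Real.pi : ℂ)
  rwa [mul_zero] at h3

lemma cauchyTransform_union {A B : Set ℂ} (hA : Bornology.IsBounded A) (hB : Bornology.IsBounded B)
    (hmB : MeasurableSet B) (hd : Disjoint A B) (z : ℂ) :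
    cauchyTransform (A ∪ B) z = cauchyTransform A z + cauchyTransform B z := by
  simp only [cauchyTransform, ← mul_add]
  rw [setIntegral_union hd hmB (integrableOn_inv_sub hA z) (integrableOn_inv_sub hB z)]

lemma biotSavart_eq (w : ℂ → ℝ) (z : ℂ) : biotSavart w z =
    I / 2 * (starRingEnd ℂ) ((1 / Real.pi : ℂ) * ∫ ξ, (w ξ : ℂ) * (z - ξ)⁻¹) := by
  have : ∫ ξ : ℂ, (w ξ : ℂ) / (starRingEnd ℂ) (z - ξ)
      = (starRingEnd ℂ) (∫ ξ, (w ξ : ℂ) * (z - ξ)⁻¹) := by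
    rw [← integral_conj]
    congr 1 with ξ
    simp [div_eq_mul_inv]
  rw [biotSavart, this, map_mul]
  have : (starRingEnd ℂ) (1 / Real.pi : ℂ) = 1 / Real.pi := by simp
  rw [this]; ring

/-- The velocity of a vortex patch in terms of Cauchy transforms. -/
lemma biotSavart_patchVorticity {D₁ D₂ : Set ℂ} (hm₁ : MeasurableSet D₁) (hm₂ : MeasurableSet D₂)
    (hb₁ : Bornology.IsBounded D₁) (hb₂ : Bornology.IsBounded D₂) (α : ℝ) (z : ℂ) :
    biotSavart (patchVorticity D₁ D₂ α) z =
      I / 2 * (starRingEnd ℂ) (cauchyTransform D₁ z + (α - 1) * cauchyTransform D₂ z) := by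
  rw [biotSavart_eq]
  have h1 : ∀ ξ, ((patchVorticity D₁ D₂ α ξ : ℝ) : ℂ) * (z - ξ)⁻¹ =
      D₁.indicator (fun ξ => (z - ξ)⁻¹) ξ + (α - 1) * D₂.indicator (fun ξ => (z - ξ)⁻¹) ξ := by
    intro ξ
    by_cases h : ξ ∈ D₁ <;> by_cases h' : ξ ∈ D₂ <;> simp [patchVorticity, h, h']
    ring
  have i1 : Integrable (D₁.indicator (fun ξ => (z - ξ)⁻¹)) :=
    (integrable_indicator_iff hm₁).2 (integrableOn_inv_sub hb₁ z)
  have i2 : Integrable (D₂.indicator (fun ξ => (z - ξ)⁻¹)) :=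
    (integrable_indicator_iff hm₂).2 (integrableOn_inv_sub hb₂ z)
  simp only [h1]
  rw [integral_add i1 (i2.const_mul _), integral_const_mul, integral_indicator hm₁,
    integral_indicator hm₂]
  congr 2
  simp only [cauchyTransform]; ring

/-! ### Elliptic coordinates -/

/-- The real-linear map `w ↦ w + κ conj w`. For `|κ| < 1` it takes the circle of radius `R` to an
ellipse with semi-axes `R (1 ± |κ|)`, whose major axis has direction `e^{iθ}` if
`κ = |κ| e^{2iθ}`. -/
def ellipseMap (κ : ℂ) : ℂ →L[ℝ] ℂ :=
  ContinuousLinearMap.id ℝ ℂ +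
    (ContinuousLinearMap.mul ℝ ℂ κ).comp (conjCLE : ℂ →L[ℝ] ℂ)

@[simp] lemma ellipseMap_apply (κ w : ℂ) : ellipseMap κ w = w + κ * conj w := by
  simp [ellipseMap]

/-- The inverse of `ellipseMap κ`, for `|κ| ≠ 1`. -/
def ellipseInv (κ : ℂ) : ℂ →L[ℝ] ℂ := ((1 - ‖κ‖ ^ 2 : ℝ)⁻¹) • ellipseMap (-κ)

lemma ellipseInv_apply (κ z : ℂ) :
    ellipseInv κ z = ((1 - ‖κ‖ ^ 2 : ℝ)⁻¹ : ℝ) * (z - κ * conj z) := by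
  simp [ellipseInv, sub_eq_add_neg, mul_add]

lemma one_sub_norm_sq_pos {κ : ℂ} (hκ : ‖κ‖ < 1) : 0 < 1 - ‖κ‖ ^ 2 := by
  nlinarith [norm_nonneg κ]

lemma one_sub_norm_sq_ne_zero {κ : ℂ} (hκ : ‖κ‖ < 1) : (1 - (‖κ‖ : ℂ) ^ 2) ≠ 0 := by
  exact_mod_cast (one_sub_norm_sq_pos hκ).ne'

lemma ellipseInv_ellipseMap {κ : ℂ} (hκ : ‖κ‖ < 1) (w : ℂ) :
    ellipseInv κ (ellipseMap κ w) = w := by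
  have h := one_sub_norm_sq_ne_zero hκ
  have h2 : κ * conj κ = (‖κ‖ : ℂ) ^ 2 := Complex.mul_conj' κ
  rw [ellipseInv_apply, ellipseMap_apply]
  push_cast
  simp only [map_add, map_mul, conj_conj]
  field_simp
  linear_combination (-w) * h2

lemma ellipseMap_ellipseInv {κ : ℂ} (hκ : ‖κ‖ < 1) (z : ℂ) :
    ellipseMap κ (ellipseInv κ z) = z := by
  have h := one_sub_norm_sq_ne_zero hκ
  have h2 : κ * conj κ = (‖κ‖ : ℂ) ^ 2 := Complex.mul_conj' κ
  rw [ellipseInv_apply, ellipseMap_apply]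
  simp only [map_mul, map_sub, conj_conj, conj_ofReal]
  push_cast
  field_simp
  linear_combination (-z) * h2

lemma norm_ellipseInv_smul {κ z : ℂ} {t : ℝ} (ht : 0 ≤ t) :
    ‖ellipseInv κ ((t : ℂ) * z)‖ = t * ‖ellipseInv κ z‖ := by
  have : ((t : ℂ) * z) = t • z := by simp
  rw [this, map_smul, norm_smul, Real.norm_of_nonneg ht]

/-- The coordinates on the plane in which `solidEllipse p R κ` is a disc. -/
def ellipseHomeo (p : ℂ) {κ : ℂ} (hκ : ‖κ‖ < 1) : ℂ ≃ₜ ℂ where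
  toFun z := ellipseInv κ (z - p)
  invFun w := p + ellipseMap κ w
  left_inv z := by
    show p + ellipseMap κ (ellipseInv κ (z - p)) = z
    rw [ellipseMap_ellipseInv hκ]; ring
  right_inv w := by
    show ellipseInv κ (p + ellipseMap κ w - p) = w
    rw [add_sub_cancel_left, ellipseInv_ellipseMap hκ]
  continuous_toFun := (ellipseInv κ).continuous.comp (continuous_id.sub continuous_const)
  continuous_invFun := continuous_const.add (ellipseMap κ).continuous

/-- The open region bounded by the ellipse `{p + w + κ conj w : |w| = R}`. -/
def solidEllipse (p : ℂ) (R : ℝ) (κ : ℂ) : Set ℂ := {z | ‖ellipseInv κ (z - p)‖ < R}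

lemma mem_solidEllipse {p : ℂ} {R : ℝ} {κ z : ℂ} :
    z ∈ solidEllipse p R κ ↔ ‖ellipseInv κ (z - p)‖ < R := Iff.rfl

lemma solidEllipse_eq_preimage (p : ℂ) (R : ℝ) {κ : ℂ} (hκ : ‖κ‖ < 1) :
    solidEllipse p R κ = ellipseHomeo p hκ ⁻¹' ball 0 R := by
  ext z
  simp [solidEllipse, ellipseHomeo]

lemma isOpen_solidEllipse (p : ℂ) (R : ℝ) (κ : ℂ) : IsOpen (solidEllipse p R κ) :=
  isOpen_lt ((ellipseInv κ).continuous.comp (continuous_id.sub continuous_const)).norm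
    continuous_const

lemma convex_solidEllipse (p : ℂ) (R : ℝ) (κ : ℂ) : Convex ℝ (solidEllipse p R κ) := by
  have h : solidEllipse p R κ = (fun z => z + -p) ⁻¹' ((ellipseInv κ) ⁻¹' ball 0 R) := by
    ext z; simp [solidEllipse, sub_eq_add_neg]
  rw [h]
  exact ((convex_ball _ _).linear_preimage (ellipseInv κ).toLinearMap).translate_preimage_left _

lemma closure_solidEllipse (p : ℂ) {R : ℝ} (hR : 0 < R) {κ : ℂ} (hκ : ‖κ‖ < 1) :
    closure (solidEllipse p R κ) = {z | ‖ellipseInv κ (z - p)‖ ≤ R} := by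
  rw [solidEllipse_eq_preimage p R hκ, ← Homeomorph.preimage_closure, closure_ball _ hR.ne']
  ext z; simp [ellipseHomeo]

lemma frontier_solidEllipse (p : ℂ) {R : ℝ} (hR : 0 < R) {κ : ℂ} (hκ : ‖κ‖ < 1) :
    frontier (solidEllipse p R κ) = {z | ‖ellipseInv κ (z - p)‖ = R} := by
  rw [solidEllipse_eq_preimage p R hκ, ← Homeomorph.preimage_frontier, frontier_ball _ hR.ne']
  ext z; simp [ellipseHomeo]

lemma solidEllipse_eq_image (p : ℂ) (R : ℝ) {κ : ℂ} (hκ : ‖κ‖ < 1) :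
    solidEllipse p R κ = (fun w => p + ellipseMap κ w) '' ball 0 R := by
  rw [solidEllipse_eq_preimage p R hκ, ← Homeomorph.image_symm]; rfl

lemma isBounded_solidEllipse (p : ℂ) (R : ℝ) {κ : ℂ} (hκ : ‖κ‖ < 1) :
    Bornology.IsBounded (solidEllipse p R κ) := by
  rw [solidEllipse_eq_image p R hκ]
  refine ((isCompact_closedBall (0 : ℂ) R).image (f := fun w => p + ellipseMap κ w)
    (continuous_const.add (ellipseMap κ).continuous)).isBounded.subset ?_
  exact image_mono ball_subset_closedBall

lemma volume_frontier_solidEllipse (p : ℂ) (R : ℝ) (κ : ℂ) :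
    volume (frontier (solidEllipse p R κ)) = 0 :=
  (convex_solidEllipse p R κ).addHaar_frontier volume

lemma measurableSet_solidEllipse (p : ℂ) (R : ℝ) (κ : ℂ) : MeasurableSet (solidEllipse p R κ) :=
  (isOpen_solidEllipse p R κ).measurableSet

lemma continuous_cauchyTransform_solidEllipse (p : ℂ) (R : ℝ) {κ : ℂ} (hκ : ‖κ‖ < 1) :
    Continuous (cauchyTransform (solidEllipse p R κ)) :=
  continuous_cauchyTransform (measurableSet_solidEllipse p R κ) (isBounded_solidEllipse p R hκ)
    (volume_frontier_solidEllipse p R κ)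

lemma det_ellipseMap (κ : ℂ) : (ellipseMap κ).det = 1 - ‖κ‖ ^ 2 := by
  rw [ContinuousLinearMap.det, ← LinearMap.det_toMatrix Complex.basisOneI, Matrix.det_fin_two]
  simp only [LinearMap.toMatrix_apply, Complex.coe_basisOneI_repr]
  simp [← Complex.normSq_eq_norm_sq, Complex.normSq_apply]
  ring

lemma integral_image_ellipseMap {E : Type*} [NormedAddCommGroup E] [NormedSpace ℝ E] (p : ℂ) {κ : ℂ}
    (hκ : ‖κ‖ < 1) {S : Set ℂ} (hS : MeasurableSet S) (g : ℂ → E) :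
    ∫ z in (fun w => p + ellipseMap κ w) '' S, g z =
      (1 - ‖κ‖ ^ 2) • ∫ w in S, g (p + ellipseMap κ w) := by
  rw [integral_image_eq_integral_abs_det_fderiv_smul volume hS
    (f' := fun _ => ellipseMap κ)
    (fun x _ => ((ellipseMap κ).hasFDerivAt.const_add p).hasFDerivWithinAt)
    (fun x _ y _ h => (ellipseHomeo p hκ).symm.injective h) g]
  rw [det_ellipseMap, abs_of_pos (one_sub_norm_sq_pos hκ), integral_smul]

/-! ### The Cauchy transform of an ellipse -/

/-- The Joukowski map `η ↦ η⁻¹ + κ η` takes the punctured unit disc to the outside of the ellipse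
`{w + κ conj w : |w| = 1}`. -/
lemma le_norm_ellipseInv_joukowski {κ η : ℂ} (hκ : ‖κ‖ < 1) (h0 : η ≠ 0) (h1 : ‖η‖ ≤ 1) :
    1 + (1 - ‖η‖) * (1 - ‖κ‖) / 2 ≤ ‖ellipseInv κ (η⁻¹ + κ * η)‖ := by
  have hρ : 0 < ‖η‖ := norm_pos_iff.2 h0
  set ρ := ‖η‖
  set q := ‖κ‖ with hq
  have hq0 : 0 ≤ q := norm_nonneg κ
  have hinv : η⁻¹ = ((ρ ^ 2)⁻¹ : ℝ) * conj η := by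
    rw [Complex.inv_def, Complex.normSq_eq_norm_sq, mul_comm]
  have hci : conj (η⁻¹) = ((ρ ^ 2)⁻¹ : ℝ) * η := by rw [hinv]; simp
  have hkk : κ * conj κ = (q : ℂ) ^ 2 := Complex.mul_conj' κ
  have e1 : (η⁻¹ + κ * η) - κ * conj (η⁻¹ + κ * η) =
      ((ρ ^ 2)⁻¹ - q ^ 2 : ℝ) * conj η - ((ρ ^ 2)⁻¹ - 1 : ℝ) * (κ * η) := by
    rw [map_add, hci, hinv, map_mul]
    push_cast
    linear_combination (-conj η) * hkk
  have hρ2 : 1 ≤ (ρ ^ 2)⁻¹ := (one_le_inv₀ (by positivity)).2 (by nlinarith)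
  rw [ellipseInv_apply, norm_mul, e1, norm_real, Real.norm_of_nonneg
    (inv_nonneg.2 (one_sub_norm_sq_pos hκ).le), inv_mul_eq_div, le_div_iff₀ (one_sub_norm_sq_pos hκ)]
  refine le_trans ?_ (norm_sub_norm_le _ _)
  rw [norm_mul, norm_mul, norm_mul, norm_real, norm_real, RCLike.norm_conj,
    Real.norm_of_nonneg (by nlinarith), Real.norm_of_nonneg (by linarith)]
  have e2 : (ρ ^ 2)⁻¹ * ρ = ρ⁻¹ := by field_simp
  have e3 : ((ρ ^ 2)⁻¹ - q ^ 2) * ρ - ((ρ ^ 2)⁻¹ - 1) * (q * ρ) = (1 - q) * (ρ⁻¹ + q * ρ) := by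
    rw [← e2]; ring
  show _ ≤ ((ρ ^ 2)⁻¹ - q ^ 2) * ρ - ((ρ ^ 2)⁻¹ - 1) * (q * ρ)
  rw [e3]
  have e4 : 2 - ρ ≤ ρ⁻¹ := by
    rw [← one_div, le_div_iff₀ hρ]; nlinarith [sq_nonneg (1 - ρ)]
  have e5 : (1 + (1 - ρ) * (1 - q) / 2) * (1 + q) ≤ ρ⁻¹ + q * ρ := by
    have : (1 - ρ) * (1 - q) * (1 + q) ≤ 2 * ((1 - ρ) * (1 - q)) := by
      nlinarith [mul_nonneg (sub_nonneg.2 h1) (sub_nonneg.2 hκ.le)]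
    nlinarith
  nlinarith [mul_le_mul_of_nonneg_left e5 (sub_nonneg.2 hκ.le)]

lemma circleAverage_inv_sub_ellipseMap {κ z : ℂ} (hκ : ‖κ‖ < 1) {r : ℝ}
    (hr : ‖ellipseInv κ z‖ < r) :
    Real.circleAverage (fun w => (z - ellipseMap κ w)⁻¹) 0 r = 0 := by
  have hr0 : 0 < r := (norm_nonneg _).trans_lt hr
  rw [Real.circleAverage_eq_circleAverage_zero_one, ← Real.circleAverage_zero_one_congr_inv]
  have h1 : EqOn (fun η : ℂ => (z - ellipseMap κ ((r : ℂ) * η⁻¹ + 0))⁻¹)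
      (fun η => η / (z * η - r * (1 + κ * η ^ 2))) (sphere 0 |1|) := by
    intro η hη
    have hη1 : ‖η‖ = 1 := by simpa using hη
    have h0 : η ≠ 0 := norm_ne_zero_iff.1 (by rw [hη1]; exact one_ne_zero)
    have hc : conj η⁻¹ = η := by
      rw [Complex.inv_def, Complex.normSq_eq_norm_sq, hη1]; simp
    simp only [ellipseMap_apply, add_zero, map_mul, conj_ofReal, hc]
    have : z * η - r * (1 + κ * η ^ 2) = η * (z - (r * η⁻¹ + κ * (r * η))) := by
      field_simp
    rw [this, div_mul_eq_div_div, div_self h0, one_div]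
  rw [Real.circleAverage_congr_sphere h1, circleAverage_of_differentiableOn_nhds]
  · simp
  · intro η hη
    rw [mem_closedBall, dist_zero_right] at hη
    have : z * η - r * (1 + κ * η ^ 2) ≠ 0 := by
      intro h
      by_cases h0 : η = 0
      · simp [h0, hr0.ne'] at h
      · have hz : z = (r : ℂ) * (η⁻¹ + κ * η) := by
          field_simp; linear_combination h
        have := le_norm_ellipseInv_joukowski hκ h0 hη
        rw [hz, norm_ellipseInv_smul hr0.le] at hr
        have h2 : 0 ≤ (1 - ‖η‖) * (1 - ‖κ‖) / 2 := by
          have := sub_nonneg.2 hη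
          have := sub_nonneg.2 hκ.le
          positivity
        nlinarith
    fun_prop (disch := assumption)

lemma cauchyTransform_image_ellipseMap (p : ℂ) {κ : ℂ} (hκ : ‖κ‖ < 1) {S : Set ℂ}
    (hS : MeasurableSet S) (z : ℂ) :
    cauchyTransform ((fun w => p + ellipseMap κ w) '' S) (p + z) =
      (1 / Real.pi : ℂ) * ((1 - ‖κ‖ ^ 2 : ℝ) * ∫ w in S, (z - ellipseMap κ w)⁻¹) := by
  rw [cauchyTransform, integral_image_ellipseMap p hκ hS]
  simp only [real_smul]
  congr 4 with w
  congr 1; ring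

/-- Newton's theorem: the shell between two homothetic ellipses exerts no force inside. -/
lemma cauchyTransform_solidEllipse_eq_of_le {p κ z : ℂ} (hκ : ‖κ‖ < 1) {s R : ℝ} (hsR : s ≤ R)
    (hz : ‖ellipseInv κ z‖ < s) :
    cauchyTransform (solidEllipse p R κ) (p + z) = cauchyTransform (solidEllipse p s κ) (p + z) := by
  have hsub : solidEllipse p s κ ⊆ solidEllipse p R κ := fun x hx => lt_of_lt_of_le hx hsR
  have hu : solidEllipse p R κ = (solidEllipse p R κ \ solidEllipse p s κ) ∪ solidEllipse p s κ :=
    (sdiff_union_of_subset hsub).symm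
  rw [hu, cauchyTransform_union ((isBounded_solidEllipse p R hκ).subset sdiff_subset)
    (isBounded_solidEllipse p s hκ) (measurableSet_solidEllipse p s κ) disjoint_sdiff_left]
  convert zero_add _
  have h1 : solidEllipse p R κ \ solidEllipse p s κ =
      (fun w => p + ellipseMap κ w) '' (ball 0 R \ ball 0 s) := by
    rw [solidEllipse_eq_image p R hκ, solidEllipse_eq_image p s hκ, image_sdiff]
    exact (ellipseHomeo p hκ).symm.injective
  have hmS : MeasurableSet (ball (0 : ℂ) R \ ball 0 s) := measurableSet_ball.diff measurableSet_ball
  rw [h1, cauchyTransform_image_ellipseMap p hκ hmS, ← integral_indicator hmS,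
    integral_eq_zero_of_circleAverage_eq_zero 0, mul_zero, mul_zero]
  intro r hr _
  by_cases hrs : s ≤ r ∧ r < R
  · refine Eq.trans ?_ (circleAverage_inv_sub_ellipseMap hκ (hz.trans_le hrs.1))
    refine Real.circleAverage_congr_sphere fun w hw => ?_
    have hw1 : ‖w‖ = r := by simpa [abs_of_pos hr] using hw
    exact indicator_of_mem (by simp [hw1, hrs.1, hrs.2]) _
  · have : EqOn ((ball (0 : ℂ) R \ ball 0 s).indicator fun w => (z - ellipseMap κ w)⁻¹)
        (fun _ => (0 : ℂ)) (sphere 0 |r|) := fun w hw => by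
      have hw1 : ‖w‖ = r := by simpa [abs_of_pos hr] using hw
      refine indicator_of_notMem ?_ _
      simp only [Set.mem_sdiff, mem_ball, dist_zero_right, hw1, not_lt]
      tauto
    rw [Real.circleAverage_congr_sphere this, Real.circleAverage_const]

lemma cauchyTransform_solidEllipse_smul {p κ : ℂ} (hκ : ‖κ‖ < 1) {t : ℝ} (ht : 0 < t) (R : ℝ)
    (z : ℂ) :
    cauchyTransform (solidEllipse p (t * R) κ) (p + t * z) =
      t * cauchyTransform (solidEllipse p R κ) (p + z) := by
  rw [solidEllipse_eq_image p _ hκ, solidEllipse_eq_image p _ hκ,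
    cauchyTransform_image_ellipseMap p hκ measurableSet_ball,
    cauchyTransform_image_ellipseMap p hκ measurableSet_ball]
  have h := Measure.setIntegral_comp_smul_of_pos (volume : Measure ℂ)
    (fun w => ((t : ℂ) * z - ellipseMap κ w)⁻¹) (ball 0 R) ht
  have hball : t • ball (0 : ℂ) R = ball 0 (t * R) := by
    rw [_root_.smul_ball ht.ne', smul_zero, Real.norm_of_nonneg ht.le]
  rw [hball, Complex.finrank_real_complex] at h
  have h2 : ∀ w : ℂ, ((t : ℂ) * z - ellipseMap κ (t • w))⁻¹ = (t : ℂ)⁻¹ * (z - ellipseMap κ w)⁻¹ := by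
    intro w
    rw [map_smul, real_smul, ← mul_sub, mul_inv]
  simp only [h2] at h
  rw [integral_const_mul, real_smul] at h
  have ht' : (t : ℂ) ≠ 0 := by exact_mod_cast ht.ne'
  have h3 : ∫ w in ball (0 : ℂ) (t * R), ((t : ℂ) * z - ellipseMap κ w)⁻¹ =
      t * ∫ w in ball (0 : ℂ) R, (z - ellipseMap κ w)⁻¹ := by
    push_cast at h
    rw [eq_inv_mul_iff_mul_eq₀ (pow_ne_zero 2 ht')] at h
    rw [← h]
    field_simp
  rw [h3]; ring

lemma cauchyTransform_ball {p z : ℂ} {r : ℝ} (hz : z ∈ ball p r) :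
    cauchyTransform (ball p r) z = conj (z - p) := by
  obtain ⟨ζ, rfl⟩ : ∃ ζ, z = p + ζ := ⟨z - p, by ring⟩
  have hζ : ‖ζ‖ < r := by simpa using hz
  have h0 : ‖(0 : ℂ)‖ < 1 := by simp
  have hball : ∀ s, ball p s = (fun w => p + ellipseMap 0 w) '' ball 0 s := fun s => by
    rw [← solidEllipse_eq_image p s h0]; ext z; simp [solidEllipse, ellipseInv, dist_eq_norm]
  rw [hball, cauchyTransform_image_ellipseMap p h0 measurableSet_ball]
  have i1 : Integrable ((ball (0 : ℂ) r).indicator fun w => (ζ - w)⁻¹) :=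
    (integrable_indicator_iff measurableSet_ball).2 (integrableOn_inv_sub isBounded_ball ζ)
  have i2 : Integrable ((ball (0 : ℂ) ‖ζ‖).indicator fun _ => ζ⁻¹) :=
    (integrable_indicator_iff measurableSet_ball).2
      (integrableOn_const (measure_ball_lt_top).ne)
  have key : ∫ w, ((ball (0 : ℂ) r).indicator (fun w => (ζ - w)⁻¹) w -
      (ball (0 : ℂ) ‖ζ‖).indicator (fun _ => ζ⁻¹) w) = 0 := by
    refine integral_eq_zero_of_circleAverage_eq_zero ‖ζ‖ fun s hs hne => ?_
    rcases hne.lt_or_gt with hlt | hgt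
    · rw [Real.circleAverage_eq_circleAverage_zero_one]
      have h1 : EqOn (fun w : ℂ => (ball (0 : ℂ) r).indicator (fun w => (ζ - w)⁻¹) (s * w + 0) -
          (ball (0 : ℂ) ‖ζ‖).indicator (fun _ => ζ⁻¹) (s * w + 0))
          (fun w => (ζ - s * w)⁻¹ - ζ⁻¹) (sphere 0 |1|) := by
        intro w hw
        have hw1 : ‖w‖ = 1 := by simpa using hw
        have hn : ‖(s : ℂ) * w + 0‖ = s := by simp [hw1, abs_of_pos hs]
        beta_reduce
        rw [indicator_of_mem (by simpa [hw1, abs_of_pos hs] using hlt.trans hζ),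
          indicator_of_mem (by simpa [hw1, abs_of_pos hs] using hlt), add_zero]
      rw [Real.circleAverage_congr_sphere h1, circleAverage_of_differentiableOn_nhds]
      · simp
      · intro w hw
        have : ζ - s * w ≠ 0 := by
          intro h
          have h2 : ‖ζ‖ = s * ‖w‖ := by
            rw [sub_eq_zero.1 h, norm_mul, norm_real, Real.norm_of_nonneg hs.le]
          rw [mem_closedBall, dist_zero_right] at hw
          nlinarith
        fun_prop (disch := assumption)
    · have h1 : EqOn (fun w : ℂ => (ball (0 : ℂ) r).indicator (fun w => (ζ - w)⁻¹) w -
          (ball (0 : ℂ) ‖ζ‖).indicator (fun _ => ζ⁻¹) w)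
          (fun w => (ball (0 : ℂ) r).indicator (fun w => (ζ - w)⁻¹) w) (sphere 0 |s|) := by
        intro w hw
        have hw1 : ‖w‖ = s := by simpa [abs_of_pos hs] using hw
        beta_reduce
        rw [indicator_of_notMem (s := ball (0 : ℂ) ‖ζ‖) (by simpa [hw1] using hgt.le), sub_zero]
      rw [Real.circleAverage_congr_sphere h1]
      by_cases hsr : s < r
      · have := circleAverage_inv_sub_ellipseMap (z := ζ) h0 (r := s)
          (by simpa [ellipseInv] using hgt)
        refine Eq.trans ?_ this
        refine Real.circleAverage_congr_sphere fun w hw => ?_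
        have hw1 : ‖w‖ = s := by simpa [abs_of_pos hs] using hw
        rw [indicator_of_mem (by simpa [hw1] using hsr)]; simp
      · have : EqOn ((ball (0 : ℂ) r).indicator fun w => (ζ - w)⁻¹)
            (fun _ => (0 : ℂ)) (sphere 0 |s|) := fun w hw => by
          have hw1 : ‖w‖ = s := by simpa [abs_of_pos hs] using hw
          exact indicator_of_notMem (by simpa [hw1] using hsr) _
        rw [Real.circleAverage_congr_sphere this, Real.circleAverage_const]
  rw [integral_sub i1 i2, integral_indicator measurableSet_ball,
    integral_indicator measurableSet_ball, setIntegral_const, sub_eq_zero] at key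
  have e : ∀ w : ℂ, (ζ - ellipseMap 0 w)⁻¹ = (ζ - w)⁻¹ := fun w => by simp
  simp only [e, key]
  have hv : volume.real (ball (0 : ℂ) ‖ζ‖) = ‖ζ‖ ^ 2 * Real.pi := by
    simp [Measure.real, Complex.volume_ball]
  rw [hv, add_sub_cancel_left]
  have hpi : (Real.pi : ℂ) ≠ 0 := by exact_mod_cast Real.pi_ne_zero
  by_cases hz0 : ζ = 0
  · simp [hz0]
  · rw [real_smul]
    push_cast
    rw [norm_zero, ← Complex.mul_conj' ζ]
    field_simp
    simp

/-- Inside `D` the Cauchy transform of `D` differs from `conj z` by a holomorphic function. -/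
lemma differentiableAt_cauchyTransform_sub_conj {D : Set ℂ} (hD : IsOpen D)
    (hb : Bornology.IsBounded D) {z₀ : ℂ} (hz : z₀ ∈ D) :
    DifferentiableAt ℂ (fun z => cauchyTransform D z - conj z) z₀ := by
  obtain ⟨r, hr, hball⟩ := Metric.isOpen_iff.1 hD z₀ hz
  have hm : MeasurableSet (D \ ball z₀ r) := hD.measurableSet.diff measurableSet_ball
  have hb' : Bornology.IsBounded (D \ ball z₀ r) := hb.subset sdiff_subset
  have hcl : z₀ ∉ closure (D \ ball z₀ r) := by
    intro h
    obtain ⟨x, hx1, hx2⟩ := mem_closure_iff.1 h _ isOpen_ball (mem_ball_self hr)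
    exact hx2.2 hx1
  refine ((differentiableAt_cauchyTransform hm hb' hcl).sub_const (conj z₀)).congr_of_eventuallyEq ?_
  filter_upwards [ball_mem_nhds z₀ hr] with z hzb
  have hu : D = (D \ ball z₀ r) ∪ ball z₀ r := (sdiff_union_of_subset hball).symm
  conv_lhs => rw [hu]
  rw [cauchyTransform_union hb' isBounded_ball measurableSet_ball disjoint_sdiff_left,
    cauchyTransform_ball hzb, map_sub]
  ring

/-- The Cauchy transform of an ellipse centred at the origin is real-homogeneous of degree one
inside, and it is `conj z` plus a holomorphic function; so that function is linear. -/
lemma exists_cauchyTransform_solidEllipse_eq_linear (p : ℂ) {R : ℝ} (hR : 0 < R) {κ : ℂ}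
    (hκ : ‖κ‖ < 1) : ∃ A : ℂ, ∀ z, ‖ellipseInv κ z‖ < R →
      cauchyTransform (solidEllipse p R κ) (p + z) = conj z + A * z := by
  set g : ℂ → ℂ := fun z => cauchyTransform (solidEllipse p R κ) (p + z) - conj z with hg
  have hom : ∀ z, ‖ellipseInv κ z‖ < R → ∀ t : ℝ, 0 < t → t ≤ 1 → g (t * z) = t * g z := by
    intro z hz t ht ht1
    have h1 : ‖ellipseInv κ ((t : ℂ) * z)‖ < t * R := by
      rw [norm_ellipseInv_smul ht.le]; gcongr
    have h2 : t * R ≤ R := by nlinarith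
    simp only [hg]
    rw [cauchyTransform_solidEllipse_eq_of_le hκ h2 h1, cauchyTransform_solidEllipse_smul hκ ht]
    simp only [map_mul, conj_ofReal]
    ring
  have hp : p ∈ solidEllipse p R κ := by simp [solidEllipse, hR]
  have hd : DifferentiableAt ℂ g 0 := by
    have h1 := differentiableAt_cauchyTransform_sub_conj (isOpen_solidEllipse p R κ)
      (isBounded_solidEllipse p R hκ) hp
    have h2 : g = fun z => (cauchyTransform (solidEllipse p R κ) (p + z) - conj (p + z)) + conj p := by
      funext z; simp only [hg, map_add]; ring
    rw [h2]
    refine DifferentiableAt.add_const _ ?_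
    refine DifferentiableAt.comp (f := fun z => p + z)
      (g := fun z => cauchyTransform (solidEllipse p R κ) z - conj z) 0 ?_ ?_
    · simpa using h1
    · exact (differentiableAt_id).const_add p
  have h0 : g 0 = 0 := by
    have := hom 0 (by simpa using hR) (1 / 2) (by norm_num) (by norm_num)
    rw [mul_zero] at this
    push_cast at this
    linear_combination 2 * this
  refine ⟨deriv g 0, fun z hz => ?_⟩
  have hline : HasDerivAt (fun t : ℝ => g (t * z)) (deriv g 0 * z) 0 := by
    have h1 : HasDerivAt g (deriv g 0) ((0 : ℝ) * z) := by simpa using hd.hasDerivAt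
    have h2 : HasDerivAt (fun t : ℝ => (t : ℂ) * z) (1 * z) 0 :=
      (Complex.ofRealCLM.hasDerivAt (x := (0 : ℝ))).mul_const z
    rw [one_mul] at h2
    exact h1.comp (0 : ℝ) h2
  have h3 := hline.tendsto_slope_zero_right
  have h4 : Tendsto (fun t : ℝ => t⁻¹ • (g (((0 + t : ℝ) : ℂ) * z) - g (((0 : ℝ) : ℂ) * z)))
      (𝓝[>] 0) (𝓝 (g z)) := by
    refine tendsto_const_nhds.congr' ?_
    filter_upwards [Ioc_mem_nhdsGT one_pos] with t ht
    have ht' : (t : ℂ) ≠ 0 := by exact_mod_cast ht.1.ne'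
    rw [zero_add, hom z hz t ht.1 ht.2, ofReal_zero, zero_mul, h0, sub_zero, real_smul, ofReal_inv,
      inv_mul_cancel_left₀ ht']
  have h5 := tendsto_nhds_unique h4 h3
  simp only [hg] at h5
  linear_combination h5

/-- The Cauchy transform of `D` outside the ellipse `{p + R (w + κ conj w) : |w| = 1}`, in the
conformal coordinate `η` with `z = p + R (η⁻¹ + κ η)`, extended by zero to `η = 0`, which is the
point at infinity. -/
def exteriorCauchy (D : Set ℂ) (p : ℂ) (R : ℝ) (κ η : ℂ) : ℂ :=
  if η = 0 then 0 else cauchyTransform D (p + R * (η⁻¹ + κ * η))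

@[simp] lemma exteriorCauchy_zero (D : Set ℂ) (p : ℂ) (R : ℝ) (κ : ℂ) :
    exteriorCauchy D p R κ 0 = 0 := if_pos rfl

lemma exteriorCauchy_of_ne {D : Set ℂ} {p : ℂ} {R : ℝ} {κ η : ℂ} (h : η ≠ 0) :
    exteriorCauchy D p R κ η = cauchyTransform D (p + R * (η⁻¹ + κ * η)) := if_neg h

lemma tendsto_joukowski_cobounded (p : ℂ) {R : ℝ} (hR : 0 < R) (κ : ℂ) :
    Tendsto (fun η : ℂ => p + R * (η⁻¹ + κ * η)) (𝓝[≠] 0) (Bornology.cobounded ℂ) := by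
  rw [← tendsto_norm_atTop_iff_cobounded]
  have h1 : Tendsto (fun η : ℂ => R * ‖η⁻¹‖ - (‖p‖ + R * ‖κ‖)) (𝓝[≠] 0) atTop :=
    tendsto_atTop_add_const_right _ _
      ((tendsto_norm_cobounded_atTop.comp tendsto_inv₀_nhdsNE_zero).const_mul_atTop hR)
  refine tendsto_atTop_mono' _ ?_ h1
  filter_upwards [nhdsWithin_le_nhds (closedBall_mem_nhds (0 : ℂ) one_pos)] with η hη
  rw [mem_closedBall, dist_zero_right] at hη
  have e : (R : ℂ) * η⁻¹ = (p + R * (η⁻¹ + κ * η)) - (p + R * (κ * η)) := by ring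
  have h2 : R * ‖η⁻¹‖ = ‖(R : ℂ) * η⁻¹‖ := by
    rw [norm_mul, norm_real, Real.norm_of_nonneg hR.le]
  have h3 : ‖p + R * (κ * η)‖ ≤ ‖p‖ + R * ‖κ‖ := by
    refine (norm_add_le _ _).trans ?_
    rw [norm_mul, norm_mul, norm_real, Real.norm_of_nonneg hR.le]
    have : ‖κ‖ * ‖η‖ ≤ ‖κ‖ := by nlinarith [norm_nonneg κ]
    gcongr
  rw [h2, e]
  linarith [norm_sub_le (p + R * (η⁻¹ + κ * η)) (p + R * (κ * η))]

lemma joukowski_notMem_closure {p : ℂ} {R : ℝ} (hR : 0 < R) {κ η : ℂ} (hκ : ‖κ‖ < 1) (h0 : η ≠ 0)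
    (h1 : ‖η‖ < 1) : p + R * (η⁻¹ + κ * η) ∉ closure (solidEllipse p R κ) := by
  rw [closure_solidEllipse p hR hκ, mem_ofPred_eq, add_sub_cancel_left, norm_ellipseInv_smul hR.le]
  have h2 := le_norm_ellipseInv_joukowski hκ h0 h1.le
  have h3 : 0 < (1 - ‖η‖) * (1 - ‖κ‖) / 2 := by
    have := sub_pos.2 h1
    have := sub_pos.2 hκ
    positivity
  nlinarith

lemma diffContOnCl_exteriorCauchy {D : Set ℂ} (hm : MeasurableSet D) (hb : Bornology.IsBounded D)
    (hf : volume (frontier D) = 0) {p : ℂ} {R : ℝ} (hR : 0 < R) {κ : ℂ} (hκ : ‖κ‖ < 1)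
    (hsub : D ⊆ solidEllipse p R κ) : DiffContOnCl ℂ (exteriorCauchy D p R κ) (ball 0 1) := by
  have hcont : Continuous (exteriorCauchy D p R κ) := by
    rw [continuous_iff_continuousAt]
    intro η
    by_cases h0 : η = 0
    · subst h0
      rw [continuousAt_iff_punctured_nhds, exteriorCauchy_zero]
      refine ((tendsto_cauchyTransform_cobounded hb).comp
        (tendsto_joukowski_cobounded p hR κ)).congr' ?_
      filter_upwards [self_mem_nhdsWithin] with η hη
      exact (exteriorCauchy_of_ne hη).symm
    · have h1 : ContinuousAt (fun η : ℂ => cauchyTransform D (p + R * (η⁻¹ + κ * η))) η :=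
        (continuous_cauchyTransform hm hb hf).continuousAt.comp (by fun_prop (disch := assumption))
      refine h1.congr ?_
      filter_upwards [isOpen_ne.mem_nhds h0] with x hx
      exact (exteriorCauchy_of_ne hx).symm
  refine ⟨?_, hcont.continuousOn⟩
  rw [← differentiableOn_compl_singleton_and_continuousAt_iff (ball_mem_nhds (0 : ℂ) one_pos)]
  refine ⟨fun η hη => ?_, hcont.continuousAt⟩
  have h0 : η ≠ 0 := hη.2
  have hη1 : ‖η‖ < 1 := by simpa using hη.1
  have h1 : DifferentiableAt ℂ (fun η : ℂ => cauchyTransform D (p + R * (η⁻¹ + κ * η))) η :=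
    DifferentiableAt.comp (g := cauchyTransform D) (f := fun η : ℂ => p + R * (η⁻¹ + κ * η)) η
      (differentiableAt_cauchyTransform hm hb fun h =>
        joukowski_notMem_closure hR hκ h0 hη1 (closure_mono hsub h))
      (by fun_prop (disch := assumption))
  refine (h1.congr_of_eventuallyEq ?_).differentiableWithinAt
  filter_upwards [isOpen_ne.mem_nhds h0] with x hx
  exact exteriorCauchy_of_ne hx

lemma exteriorCauchy_solidEllipse_aux (p : ℂ) {R : ℝ} (hR : 0 < R) {κ : ℂ} (hκ : ‖κ‖ < 1) :
    (∀ z, ‖ellipseInv κ z‖ ≤ R →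
      cauchyTransform (solidEllipse p R κ) (p + z) = conj z - conj κ * z) ∧
    ∀ η, ‖η‖ ≤ 1 → exteriorCauchy (solidEllipse p R κ) p R κ η = R * (1 - ‖κ‖ ^ 2) * η := by
  obtain ⟨A, hA⟩ := exists_cauchyTransform_solidEllipse_eq_linear p hR hκ
  have hcont := continuous_cauchyTransform_solidEllipse p R hκ
  -- by continuity the interior formula holds up to the boundary
  have hA' : ∀ z, ‖ellipseInv κ z‖ ≤ R →
      cauchyTransform (solidEllipse p R κ) (p + z) = conj z + A * z := by
    have h1 : EqOn (cauchyTransform (solidEllipse p R κ)) (fun z => conj (z - p) + A * (z - p))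
        (closure (solidEllipse p R κ)) := by
      refine EqOn.closure (fun z hz => ?_) hcont (by fun_prop)
      have := hA (z - p) hz
      simpa using this
    intro z hz
    have := h1 (x := p + z) (by rw [closure_solidEllipse p hR hκ]; simpa using hz)
    simpa using this
  have hΦ := diffContOnCl_exteriorCauchy (measurableSet_solidEllipse p R κ)
    (isBounded_solidEllipse p R hκ) (volume_frontier_solidEllipse p R κ) (p := p) hR hκ subset_rfl
  set Φ := exteriorCauchy (solidEllipse p R κ) p R κ with hΦdef
  have hsphere : ∀ η : ℂ, ‖η‖ = 1 → Φ η = R * (conj κ + A) * η⁻¹ + R * (1 + A * κ) * η := by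
    intro η hη
    have h0 : η ≠ 0 := norm_ne_zero_iff.1 (by rw [hη]; exact one_ne_zero)
    have hc : conj η = η⁻¹ := by
      rw [Complex.inv_def, Complex.normSq_eq_norm_sq, hη]; simp
    have hmap : η⁻¹ + κ * η = ellipseMap κ η⁻¹ := by
      rw [ellipseMap_apply, map_inv₀, hc, inv_inv]
    rw [hΦdef, exteriorCauchy_of_ne h0, hA']
    · simp only [map_mul, map_add, conj_ofReal, map_inv₀, hc, inv_inv]
      ring
    · rw [norm_ellipseInv_smul hR.le, hmap, ellipseInv_ellipseMap hκ, norm_inv, hη]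
      simp
  have hEq : EqOn (fun η => η * Φ η - R * (1 + A * κ) * η ^ 2) (fun _ => R * (conj κ + A))
      (closure (ball (0 : ℂ) 1)) := by
    refine eqOn_closure_of_eqOn_frontier isBounded_ball ?_ diffContOnCl_const ?_
    · refine DiffContOnCl.sub ?_ ?_
      · exact (differentiable_id.diffContOnCl).smul hΦ
      · exact (Differentiable.diffContOnCl (by fun_prop))
    · intro η hη
      rw [frontier_ball _ one_ne_zero, mem_sphere, dist_zero_right] at hη
      have h0 : η ≠ 0 := norm_ne_zero_iff.1 (by rw [hη]; exact one_ne_zero)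
      beta_reduce
      rw [hsphere η hη]
      field_simp
      ring
  rw [closure_ball _ one_ne_zero] at hEq
  have hAκ : A = -conj κ := by
    have := hEq (x := 0) (by simp)
    simp only [zero_mul, ne_eq, OfNat.ofNat_ne_zero, not_false_eq_true, zero_pow, mul_zero,
      sub_zero] at this
    have hR' : (R : ℂ) ≠ 0 := by exact_mod_cast hR.ne'
    rcases mul_eq_zero.1 this.symm with h | h
    · exact absurd h hR'
    · linear_combination h
  refine ⟨fun z hz => by rw [hA' z hz, hAκ]; ring, fun η hη => ?_⟩
  by_cases h0 : η = 0
  · rw [h0]; simp [hΦdef]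
  · have := hEq (x := η) (by simpa using hη)
    simp only [hAκ] at this
    have hk : κ * conj κ = (‖κ‖ : ℂ) ^ 2 := Complex.mul_conj' κ
    refine mul_left_cancel₀ h0 ?_
    linear_combination this - R * η ^ 2 * hk

lemma cauchyTransform_solidEllipse {p z : ℂ} {R : ℝ} (hR : 0 < R) {κ : ℂ} (hκ : ‖κ‖ < 1)
    (hz : ‖ellipseInv κ (z - p)‖ ≤ R) :
    cauchyTransform (solidEllipse p R κ) z = conj (z - p) - conj κ * (z - p) := by
  simpa using (exteriorCauchy_solidEllipse_aux p hR hκ).1 (z - p) hz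

lemma exteriorCauchy_solidEllipse (p : ℂ) {R : ℝ} (hR : 0 < R) {κ η : ℂ} (hκ : ‖κ‖ < 1)
    (hη : ‖η‖ ≤ 1) : exteriorCauchy (solidEllipse p R κ) p R κ η = R * (1 - ‖κ‖ ^ 2) * η :=
  (exteriorCauchy_solidEllipse_aux p hR hκ).2 η hη

/-! ### Domains with an affine Cauchy transform are ellipses -/

lemma re_div_pos {m ζ : ℂ} (h : 0 < (conj m * ζ).re) : 0 < (m * ζ⁻¹).re := by
  have h0 : ζ ≠ 0 := by rintro rfl; simp at h
  have : m * ζ⁻¹ = ((normSq ζ)⁻¹ : ℝ) * (m * conj ζ) := by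
    rw [Complex.inv_def]; ring
  rw [this, re_ofReal_mul]
  have h2 : (m * conj ζ).re = (conj m * ζ).re := by simp
  rw [h2]
  have := Complex.normSq_pos.2 h0
  positivity

/-- A body lying strictly on one side of a line through `z₀` attracts `z₀` to that side. -/
lemma re_mul_cauchyTransform_pos {S : Set ℂ} (hm : MeasurableSet S) (hb : Bornology.IsBounded S)
    (hv : volume S ≠ 0) {m z₀ : ℂ} (h : ∀ ξ ∈ S, 0 < (conj m * (z₀ - ξ)).re) :
    0 < (m * cauchyTransform S z₀).re := by
  have hi : IntegrableOn (fun ξ => m * (z₀ - ξ)⁻¹) S := (integrableOn_inv_sub hb z₀).const_mul m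
  have h1 : (m * cauchyTransform S z₀).re = Real.pi⁻¹ * ∫ ξ in S, (m * (z₀ - ξ)⁻¹).re := by
    have h2 : ∫ ξ in S, (m * (z₀ - ξ)⁻¹).re = (∫ ξ in S, m * (z₀ - ξ)⁻¹).re := integral_re hi
    rw [h2, integral_const_mul, cauchyTransform, ← re_ofReal_mul]
    congr 1
    push_cast
    ring
  rw [h1]
  refine mul_pos (inv_pos.2 Real.pi_pos) ?_
  rw [setIntegral_pos_iff_support_of_nonneg_ae]
  · refine lt_of_lt_of_le (pos_iff_ne_zero.2 hv) (measure_mono fun ξ hξ => ⟨?_, hξ⟩)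
    exact (re_div_pos (h ξ hξ)).ne'
  · filter_upwards [ae_restrict_mem hm] with ξ hξ
    exact (re_div_pos (h ξ hξ)).le
  · exact hi.re

/-- If the Cauchy transform of `D` is affine in `z` and `conj z` on `D`, the coefficient of `z` is
less than one in modulus: otherwise, in some direction, the extreme points of `D` would not be
attracted towards `D`. -/
lemma norm_lt_one_of_cauchyTransform_affine {D : Set ℂ} (hD : IsOpen D) (hne : D.Nonempty)
    (hb : Bornology.IsBounded D) (hf : volume (frontier D) = 0) {A B : ℂ}
    (h : ∀ z ∈ D, cauchyTransform D z = conj z + A * z + B) : ‖A‖ < 1 := by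
  by_cases hA : A = 0
  · simp [hA]
  have hA' : (‖A‖ : ℂ) ≠ 0 := by simpa using hA
  have hcont := continuous_cauchyTransform hD.measurableSet hb hf
  have hcl : EqOn (cauchyTransform D) (fun z => conj z + A * z + B) (closure D) :=
    EqOn.closure (fun z hz => h z hz) hcont (by fun_prop)
  obtain ⟨e, he⟩ := IsAlgClosed.exists_pow_nat_eq (-(conj A / ‖A‖)) (n := 2) (by norm_num)
  have hAA : A * conj A = (‖A‖ : ℂ) ^ 2 := Complex.mul_conj' A
  have hen : ‖e‖ = 1 := by
    have : ‖e‖ ^ 2 = 1 := by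
      rw [← norm_pow, he, norm_neg, norm_div, RCLike.norm_conj, norm_real, norm_norm,
        div_self (norm_ne_zero_iff.2 hA)]
    nlinarith [norm_nonneg e]
  have hee : e * conj e = 1 := by rw [Complex.mul_conj', hen]; simp
  have hAe : A * e = -(‖A‖ : ℂ) * conj e := by
    have h1 : A * e ^ 2 = -‖A‖ := by
      rw [he]; field_simp; linear_combination -hAA
    linear_combination conj e * h1 - A * e * hee
  set f : ℂ → ℝ := fun z => (conj e * z).re with hfdef
  have hfc : Continuous f := by fun_prop
  have hre : ∀ z, (e * (conj z + A * z + B)).re = (1 - ‖A‖) * f z + (e * B).re := by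
    intro z
    have h1 : e * (conj z + A * z + B) = conj (conj e * z) - (‖A‖ : ℝ) * (conj e * z) + e * B := by
      rw [map_mul, conj_conj]; linear_combination z * hAe
    rw [h1, add_re, sub_re, conj_re, re_ofReal_mul]
    ring
  have hK : IsCompact (closure D) := hb.isCompact_closure
  obtain ⟨z₀, hz₀, hmax⟩ := hK.exists_isMaxOn hne.closure hfc.continuousOn
  obtain ⟨z₁, hz₁, hmin⟩ := hK.exists_isMinOn hne.closure hfc.continuousOn
  have hv : volume D ≠ 0 := (hD.measure_pos _ hne).ne'
  -- the extrema are not attained in the open set `D`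
  have hshift : ∀ ξ ∈ D, ∃ ε > 0, ξ + (ε : ℝ) * e ∈ D ∧ ξ - (ε : ℝ) * e ∈ D := by
    intro ξ hξ
    obtain ⟨r, hr, hball⟩ := Metric.isOpen_iff.1 hD ξ hξ
    refine ⟨r / 2, half_pos hr, hball ?_, hball ?_⟩ <;>
    · simp [hen, abs_of_pos hr, hr]
  have hfadd : ∀ ξ (ε : ℝ), f (ξ + ε * e) = f ξ + ε ∧ f (ξ - ε * e) = f ξ - ε := by
    intro ξ ε
    have h1 : conj e * (ξ + ε * e) = conj e * ξ + ε := by linear_combination (ε : ℂ) * hee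
    have h2 : conj e * (ξ - ε * e) = conj e * ξ - ε := by linear_combination -(ε : ℂ) * hee
    simp only [hfdef, h1, h2]
    simp
  have p0 : 0 < (e * cauchyTransform D z₀).re := by
    refine re_mul_cauchyTransform_pos hD.measurableSet hb hv fun ξ hξ => ?_
    obtain ⟨ε, hε, h1, -⟩ := hshift ξ hξ
    have h2 : f (ξ + ε * e) ≤ f z₀ := hmax (subset_closure h1)
    rw [(hfadd ξ ε).1] at h2
    rw [mul_sub, sub_re]
    simp only [hfdef] at h2
    linarith
  have p1 : 0 < (-e * cauchyTransform D z₁).re := by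
    refine re_mul_cauchyTransform_pos hD.measurableSet hb hv fun ξ hξ => ?_
    obtain ⟨ε, hε, -, h1⟩ := hshift ξ hξ
    have h2 : f z₁ ≤ f (ξ - ε * e) := hmin (subset_closure h1)
    rw [(hfadd ξ ε).2] at h2
    rw [map_neg, neg_mul, mul_sub, neg_re, sub_re]
    simp only [hfdef] at h2
    linarith
  have hle : f z₁ ≤ f z₀ := hmax hz₁
  rw [hcl hz₀] at p0
  rw [hcl hz₁, neg_mul, neg_re] at p1
  beta_reduce at p0 p1
  rw [hre] at p0 p1
  nlinarith

/-- A domain whose Cauchy transform agrees on it with the interior one of an ellipse is, up to a null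
set, an ellipse: the smallest homothetic ellipse containing the domain touches it at a point where
the part of the ellipse outside the domain exerts no force. -/
lemma exists_solidEllipse_of_cauchyTransform_affine {D : Set ℂ} (hD : IsOpen D) (hne : D.Nonempty)
    (hb : Bornology.IsBounded D) (hf : volume (frontier D) = 0) {p κ : ℂ} (hκ : ‖κ‖ < 1)
    (h : ∀ z ∈ D, cauchyTransform D z = conj (z - p) - conj κ * (z - p)) :
    ∃ R : ℝ, 0 < R ∧ D ⊆ solidEllipse p R κ ∧ volume (solidEllipse p R κ \ D) = 0 := by
  have hcont := continuous_cauchyTransform hD.measurableSet hb hf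
  have hcl : EqOn (cauchyTransform D) (fun z => conj (z - p) - conj κ * (z - p)) (closure D) :=
    EqOn.closure (fun z hz => h z hz) hcont (by fun_prop)
  set N : ℂ → ℝ := fun z => ‖ellipseInv κ (z - p)‖ with hN
  have hNc : Continuous N :=
    ((ellipseInv κ).continuous.comp (continuous_id.sub continuous_const)).norm
  obtain ⟨z₀, hz₀, hmax⟩ := hb.isCompact_closure.exists_isMaxOn hne.closure hNc.continuousOn
  have hmem : ∀ z ∈ D, N z < N z₀ ∨ N z = 0 := by
    intro z hz
    obtain ⟨r, hr, hball⟩ := Metric.isOpen_iff.1 hD z hz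
    have hlim : Tendsto (fun t : ℝ => p + ((t : ℝ) : ℂ) * (z - p)) (𝓝[>] 1) (𝓝 z) := by
      have : Continuous fun t : ℝ => p + ((t : ℝ) : ℂ) * (z - p) := by fun_prop
      have h1 := this.tendsto 1
      simp only [ofReal_one, one_mul, add_sub_cancel] at h1
      exact h1.mono_left nhdsWithin_le_nhds
    obtain ⟨t, ht, htD⟩ := ((hlim.eventually (hD.mem_nhds hz)).and self_mem_nhdsWithin).exists.imp
      fun t ht => And.intro ht.2 ht.1
    have h1 : N (p + t * (z - p)) ≤ N z₀ := hmax (subset_closure htD)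
    have ht1 : (1 : ℝ) < t := ht
    have h2 : N (p + t * (z - p)) = t * N z := by
      simp only [hN, add_sub_cancel_left]
      exact norm_ellipseInv_smul (by linarith)
    rw [h2] at h1
    have h3 : 0 ≤ N z := norm_nonneg _
    rcases h3.eq_or_lt with h4 | h4
    · exact Or.inr h4.symm
    · left; nlinarith
  have hR : 0 < N z₀ := by
    by_contra hle
    have hsub : D ⊆ {p} := by
      intro z hz
      have h1 : N z ≤ N z₀ := hmax (subset_closure hz)
      have h2 : N z = 0 := le_antisymm (h1.trans (not_lt.1 hle)) (norm_nonneg _)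
      have h3 := ellipseMap_ellipseInv hκ (z - p)
      rw [norm_eq_zero.1 h2, map_zero] at h3
      exact (sub_eq_zero.1 h3.symm)
    exact (hD.measure_pos volume hne).ne' (measure_mono_null hsub (measure_singleton p))
  set R := N z₀ with hRdef
  have hsub : D ⊆ solidEllipse p R κ := fun z hz => by
    rcases hmem z hz with h1 | h1
    · exact h1
    · rw [mem_solidEllipse]; exact h1.trans_lt hR
  refine ⟨R, hR, hsub, ?_⟩
  by_contra hv
  have hmS : MeasurableSet (solidEllipse p R κ \ D) :=
    (measurableSet_solidEllipse p R κ).diff hD.measurableSet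
  have hbS := (isBounded_solidEllipse p R hκ).subset (sdiff_subset : solidEllipse p R κ \ D ⊆ _)
  have hzero : cauchyTransform (solidEllipse p R κ \ D) z₀ = 0 := by
    have h1 := cauchyTransform_union hbS hb hD.measurableSet disjoint_sdiff_left z₀
    rw [sdiff_union_of_subset hsub, hcl hz₀, cauchyTransform_solidEllipse hR hκ le_rfl] at h1
    simpa using h1
  set w₀ := ellipseInv κ (z₀ - p) with hw₀
  have hpos := re_mul_cauchyTransform_pos hmS hbS hv (m := w₀ - κ * conj w₀) (z₀ := z₀) (by
    intro ξ hξ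
    -- the outer normal at `z₀`: in elliptic coordinates the functional is `Re (conj w₀ · w)`
    set w := ellipseInv κ (ξ - p) with hw
    have hwR : ‖w‖ < ‖w₀‖ := hξ.1
    have h1 : z₀ - ξ = ellipseMap κ (w₀ - w) := by
      rw [hw₀, hw, ← map_sub, sub_sub_sub_cancel_right, ellipseMap_ellipseInv hκ]
    have h2 : (conj (w₀ - κ * conj w₀) * (z₀ - ξ)).re =
        (1 - ‖κ‖ ^ 2) * (conj w₀ * (w₀ - w)).re := by
      rw [h1, ellipseMap_apply, ← Complex.normSq_eq_norm_sq, Complex.normSq_apply]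
      simp only [map_sub, map_mul, conj_conj, mul_re, add_re, sub_re, conj_re, conj_im, mul_im,
        sub_im, add_im]
      ring
    rw [h2]
    refine mul_pos (one_sub_norm_sq_pos hκ) ?_
    have h3 : (conj w₀ * w₀).re = ‖w₀‖ ^ 2 := by
      rw [mul_comm, Complex.mul_conj', ← ofReal_pow, ofReal_re]
    have h4 : (conj w₀ * w).re ≤ ‖w₀‖ * ‖w‖ := by
      refine (re_le_norm _).trans ?_
      rw [norm_mul, RCLike.norm_conj]
    rw [mul_sub, sub_re, h3]
    nlinarith [norm_nonneg w])
  rw [hzero, mul_zero, zero_re] at hpos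
  exact lt_irrefl _ hpos

/-! ### Jordan curves -/

/-- A `C¹` curve in the plane has Hausdorff dimension at most one. -/
lemma volume_eq_zero_of_isC1JordanCurve {Γ : Set ℂ} (h : IsC1JordanCurve Γ) : volume Γ = 0 := by
  obtain ⟨γ, hγ, -, -, -, rfl⟩ := h
  have h1 : dimH (range γ) < ((2 : NNReal) : ENNReal) := by
    refine (hγ.dimH_range_le).trans_lt ?_
    simp
  refine measure_zero_of_dimH_lt (d := 2) ?_ h1
  have h2 := isAddHaarMeasure_hausdorffMeasure (E := ℂ)
  rw [Complex.finrank_real_complex] at h2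
  rw [show ((2 : NNReal) : ℝ) = ((2 : ℕ) : ℝ) by simp]
  exact Measure.absolutelyContinuous_isAddHaarMeasure _ _

/-- A continuous map from the circle to the line identifies two antipodal points. -/
lemma not_injective_of_continuous_circle {g : Circle → ℝ} (hg : Continuous g) :
    ¬ Function.Injective g := by
  intro hinj
  have hc : Continuous fun τ : ℝ => g (Circle.exp τ) - g (Circle.exp (τ + Real.pi)) := by fun_prop
  have h2 : Circle.exp (Real.pi + Real.pi) = Circle.exp 0 := by
    rw [← two_mul, Circle.exp_two_pi, Circle.exp_zero]
  obtain ⟨τ, hτ⟩ : ∃ τ : ℝ, g (Circle.exp τ) - g (Circle.exp (τ + Real.pi)) = 0 := by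
    have e0 : g (Circle.exp Real.pi) - g (Circle.exp (Real.pi + Real.pi)) =
        -(g (Circle.exp 0) - g (Circle.exp (0 + Real.pi))) := by
      rw [h2, zero_add]; ring
    rcases le_total 0 (g (Circle.exp 0) - g (Circle.exp (0 + Real.pi))) with h | h
    · exact mem_range_of_exists_le_of_exists_ge hc ⟨Real.pi, by rw [e0]; linarith⟩ ⟨0, h⟩
    · exact mem_range_of_exists_le_of_exists_ge hc ⟨0, h⟩ ⟨Real.pi, by rw [e0]; linarith⟩
  have h3 := hinj (sub_eq_zero.1 hτ)
  rw [Circle.exp_add] at h3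
  have h4 : ((Circle.exp τ : Circle) : ℂ) = -(Circle.exp τ : ℂ) := by
    conv_lhs => rw [h3]
    rw [Circle.coe_mul, Circle.coe_exp Real.pi, Complex.exp_pi_mul_I, mul_neg_one]
  exact (Circle.exp τ).coe_ne_zero (self_eq_neg.1 h4)

/-- A Jordan curve contains no other Jordan curve: a closed curve cannot be embedded in an arc. -/
lemma range_subset_range_of_jordan {γ : ℝ → ℂ} (hγ : Continuous γ) (hper : Function.Periodic γ 1)
    (hinj : InjOn γ (Ico 0 1)) {σ : Circle → ℂ} (hσ : Continuous σ) (hσi : Function.Injective σ)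
    (hsub : range σ ⊆ range γ) : range γ ⊆ range σ := by
  rintro _ ⟨s₀, rfl⟩
  by_contra hx
  -- cut the curve at the point outside the range of `σ`
  have hinj' : ∀ s ∈ Ioo (0 : ℝ) 1, ∀ t ∈ Ioo (0 : ℝ) 1, γ (s + s₀) = γ (t + s₀) → s = t := by
    intro s hs t ht hst
    have hfr : ∀ x, γ (Int.fract x) = γ x := fun x => by
      have := hper.sub_int_mul_eq (x := x) ⌊x⌋
      rwa [mul_one] at this
    have h1 : Int.fract (s + s₀) = Int.fract (t + s₀) :=
      hinj ⟨Int.fract_nonneg _, Int.fract_lt_one _⟩ ⟨Int.fract_nonneg _, Int.fract_lt_one _⟩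
        (by rw [hfr, hfr, hst])
    obtain ⟨n, hn⟩ := Int.fract_eq_fract.1 h1
    have h2 : s - t = n := by linarith
    have h3 : (n : ℝ) < 1 := by rw [← h2]; linarith [hs.2, ht.1]
    have h4 : (-1 : ℝ) < n := by rw [← h2]; linarith [hs.1, ht.2]
    have h5 : n = 0 := by
      have : n < 1 := by exact_mod_cast h3
      have : -1 < n := by exact_mod_cast h4
      omega
    rw [h5, Int.cast_zero] at h2
    linarith
  set S : Set ℝ := Icc 0 1 ∩ (fun s => γ (s + s₀)) ⁻¹' range σ with hS
  have hγ' : Continuous fun s => γ (s + s₀) := by fun_prop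
  have hSI : S ⊆ Ioo 0 1 := by
    rintro s ⟨hs, hs'⟩
    refine ⟨lt_of_le_of_ne hs.1 ?_, lt_of_le_of_ne hs.2 ?_⟩
    · rintro rfl
      exact hx (by simpa using hs')
    · rintro rfl
      refine hx ?_
      have : γ (1 + s₀) = γ s₀ := by rw [add_comm]; exact hper s₀
      rw [← this]; exact hs'
  have hScpt : IsCompact S :=
    isCompact_Icc.inter_right ((isCompact_range hσ).isClosed.preimage hγ')
  have : CompactSpace S := isCompact_iff_compactSpace.1 hScpt
  have hemb : Topology.IsClosedEmbedding fun s : S => γ (s + s₀) :=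
    Continuous.isClosedEmbedding (by fun_prop) fun s t hst =>
      Subtype.ext (hinj' s (hSI s.2) t (hSI t.2) hst)
  have hex : ∀ u : Circle, ∃ s : S, γ (s + s₀) = σ u := by
    intro u
    obtain ⟨t, ht⟩ := hsub (mem_range_self u)
    have h1 : γ (Int.fract (t - s₀) + s₀) = σ u := by
      rw [← ht]
      have := hper.sub_int_mul_eq (x := t) ⌊t - s₀⌋
      rw [mul_one] at this
      rw [← this]
      congr 1
      rw [Int.fract]; ring
    exact ⟨⟨Int.fract (t - s₀), ⟨⟨Int.fract_nonneg _, (Int.fract_lt_one _).le⟩,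
      ⟨u, h1.symm⟩⟩⟩, h1⟩
  choose g hg using hex
  have hgc : Continuous g := by
    rw [hemb.isInducing.continuous_iff]
    exact hσ.congr fun u => (hg u).symm
  refine not_injective_of_continuous_circle (g := fun u => (g u : ℝ)) (by fun_prop) fun u v huv => ?_
  have : g u = g v := Subtype.ext huv
  exact hσi (by rw [← hg u, ← hg v, this])

lemma ellipse_curve_mem_frontier (p : ℂ) {R : ℝ} (hR : 0 < R) {κ : ℂ} (hκ : ‖κ‖ < 1) (u : Circle) :
    p + ellipseMap κ (R * u) ∈ frontier (solidEllipse p R κ) := by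
  rw [frontier_solidEllipse p hR hκ, mem_ofPred_eq, add_sub_cancel_left, ellipseInv_ellipseMap hκ]
  rw [norm_mul, Circle.norm_coe, norm_real, Real.norm_of_nonneg hR.le, mul_one]

/-- A domain that fills an ellipse up to a null set and is bounded by a Jordan curve is the
ellipse. -/
lemma eq_solidEllipse_of_volume_diff_eq_zero {D : Set ℂ} (hD : IsOpen D)
    (hΓ : IsC1JordanCurve (frontier D)) {p : ℂ} {R : ℝ} (hR : 0 < R) {κ : ℂ} (hκ : ‖κ‖ < 1)
    (hsub : D ⊆ solidEllipse p R κ) (hv : volume (solidEllipse p R κ \ D) = 0) :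
    D = solidEllipse p R κ := by
  refine subset_antisymm hsub fun x hx => ?_
  by_contra hxD
  have hcl : solidEllipse p R κ ⊆ closure D := by
    intro y hy
    by_contra hyD
    have hopen : IsOpen (solidEllipse p R κ ∩ (closure D)ᶜ) :=
      (isOpen_solidEllipse p R κ).inter isClosed_closure.isOpen_compl
    refine (hopen.measure_pos volume ⟨y, hy, hyD⟩).ne' (measure_mono_null ?_ hv)
    exact fun z hz => ⟨hz.1, fun h => hz.2 (subset_closure h)⟩
  have hfr : frontier (solidEllipse p R κ) ⊆ frontier D := by
    intro z hz
    rw [(isOpen_solidEllipse p R κ).frontier_eq] at hz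
    rw [hD.frontier_eq]
    exact ⟨closure_minimal hcl isClosed_closure hz.1, fun h => hz.2 (hsub h)⟩
  obtain ⟨γ, hγ, hper, hinj, -, hrange⟩ := hΓ
  have hR' : (R : ℂ) ≠ 0 := by exact_mod_cast hR.ne'
  have hσ : range (fun u : Circle => p + ellipseMap κ (R * u)) ⊆
      frontier (solidEllipse p R κ) := by
    rintro _ ⟨u, rfl⟩
    exact ellipse_curve_mem_frontier p hR hκ u
  have h1 := range_subset_range_of_jordan hγ.continuous hper hinj
    (σ := fun u : Circle => p + ellipseMap κ (R * u)) (by fun_prop)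
    (fun u v huv => by
      have h2 := (ellipseHomeo p hκ).symm.injective huv
      exact Circle.ext (mul_left_cancel₀ hR' h2))
    (by rw [hrange]; exact hσ.trans hfr)
  have h2 : x ∈ frontier D := by
    rw [hD.frontier_eq]; exact ⟨hcl hx, hxD⟩
  rw [← hrange] at h2
  have h3 := hσ (h1 h2)
  rw [(isOpen_solidEllipse p R κ).frontier_eq] at h3
  exact h3.2 hx

lemma inter_frontier_nonempty_of_isPreconnected {D T : Set ℂ} (hD : IsOpen D) (hT : IsPreconnected T)
    (h1 : (T ∩ D).Nonempty) (h2 : ∃ y ∈ T, y ∉ D) : (T ∩ frontier D).Nonempty := by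
  by_contra hcon
  obtain ⟨y, hyT, hyD⟩ := h2
  have hcl : ∀ z ∈ T, z ∉ D → z ∉ closure D := fun z hz hzD h =>
    hcon ⟨z, hz, by rw [hD.frontier_eq]; exact ⟨h, hzD⟩⟩
  obtain ⟨z, -, hz1, hz2⟩ := hT D (closure D)ᶜ hD isClosed_closure.isOpen_compl
    (fun z hz => or_iff_not_imp_left.2 fun h => hcl z hz h) h1 ⟨y, hyT, hcl y hyT hyD⟩
  exact hz2 (subset_closure hz1)

/-- The only bounded domain whose boundary is a given ellipse is the region inside. -/
lemma eq_solidEllipse_of_frontier_eq {D : Set ℂ} (hD : IsOpen D) (hne : D.Nonempty)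
    (hb : Bornology.IsBounded D) {p : ℂ} {R : ℝ} (hR : 0 < R) {κ : ℂ}
    (hf : frontier D = {z | ‖ellipseInv κ (z - p)‖ = R}) : D = solidEllipse p R κ := by
  have hdisj : ∀ z ∈ D, ‖ellipseInv κ (z - p)‖ ≠ R := by
    intro z hz h
    have h1 : z ∈ frontier D := by rw [hf]; exact h
    rw [hD.frontier_eq] at h1
    exact h1.2 hz
  have hsub : D ⊆ solidEllipse p R κ := by
    intro z hz
    by_contra hout
    have hgt : R < ‖ellipseInv κ (z - p)‖ := lt_of_le_of_ne (not_lt.1 hout) (hdisj z hz).symm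
    have hzp : z - p ≠ 0 := by rintro h; rw [h] at hgt; simp at hgt; linarith
    -- the ray from `z` to infinity does not meet the boundary
    set T : Set ℂ := (fun t : ℝ => p + (t : ℂ) * (z - p)) '' Ici 1 with hT
    have hTc : IsPreconnected T :=
      isPreconnected_Ici.image _ (Continuous.continuousOn (by fun_prop))
    have hTf : ¬ (T ∩ frontier D).Nonempty := by
      rintro ⟨_, ⟨t, ht, rfl⟩, h2⟩
      have ht1 : (1 : ℝ) ≤ t := ht
      rw [hf, mem_ofPred_eq, add_sub_cancel_left, norm_ellipseInv_smul (by linarith)] at h2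
      nlinarith
    have hTD : T ⊆ D := by
      by_contra hTD
      obtain ⟨y, hyT, hyD⟩ := not_subset.1 hTD
      exact hTf (inter_frontier_nonempty_of_isPreconnected hD hTc ⟨z, ⟨1, self_mem_Ici, by simp⟩, hz⟩ ⟨y, hyT, hyD⟩)
    obtain ⟨M, hM⟩ := hb.subset_closedBall p
    have h3 := hM (hTD ⟨max 1 ((M + 1) / ‖z - p‖), mem_Ici.2 (le_max_left _ _), rfl⟩)
    have hn := norm_pos_iff.2 hzp
    rw [mem_closedBall, dist_eq_norm, add_sub_cancel_left, norm_mul, norm_real,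
      Real.norm_of_nonneg (le_trans zero_le_one (le_max_left _ _))] at h3
    have h4 : (M + 1) / ‖z - p‖ * ‖z - p‖ ≤ max 1 ((M + 1) / ‖z - p‖) * ‖z - p‖ :=
      mul_le_mul_of_nonneg_right (le_max_right _ _) hn.le
    rw [div_mul_cancel₀ _ hn.ne'] at h4
    linarith
  refine subset_antisymm hsub fun x hx => ?_
  by_contra hxD
  obtain ⟨y, hy⟩ := hne
  obtain ⟨z, hz1, hz2⟩ := inter_frontier_nonempty_of_isPreconnected hD
    (convex_solidEllipse p R κ).isPreconnected ⟨y, hsub hy, hy⟩ ⟨x, hx, hxD⟩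
  rw [hf] at hz2
  exact (ne_of_lt hz1) hz2

/-! ### Divergence-free fields and Gauss's theorem -/

/-- The fields `w ↦ i k(|w|) w`, which rotate every circle about the origin into itself, are
divergence free in the sense of distributions. -/
lemma integral_radial_mul_fderiv_rotation {X : ℂ → ℝ} (hX : ContDiff ℝ 1 X) (k : ℝ → ℝ) :
    ∫ w, k ‖w‖ * fderiv ℝ X w (I * w) = 0 := by
  refine integral_eq_zero_of_circleAverage_eq_zero 0 fun r hr _ => ?_
  have h1 : EqOn (fun w => k ‖w‖ * fderiv ℝ X w (I * w)) (k r • fun w => fderiv ℝ X w (I * w))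
      (sphere 0 |r|) := by
    intro w hw
    have hw1 : ‖w‖ = r := by simpa [abs_of_pos hr] using hw
    simp [hw1]
  rw [Real.circleAverage_congr_sphere h1, Real.circleAverage_smul, Real.circleAverage_def]
  have hd : ∀ θ ∈ uIcc 0 (2 * Real.pi), HasDerivAt (fun θ => X (circleMap 0 r θ))
      (fderiv ℝ X (circleMap 0 r θ) (I * circleMap 0 r θ)) θ := by
    intro θ _
    have h2 := (hX.differentiable one_ne_zero (circleMap 0 r θ)).hasFDerivAt.comp_hasDerivAt θ
      (hasDerivAt_circleMap 0 r θ)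
    rwa [mul_comm] at h2
  have hc : Continuous fun θ => fderiv ℝ X (circleMap 0 r θ) (I * circleMap 0 r θ) :=
    ((hX.continuous_fderiv one_ne_zero).comp (continuous_circleMap 0 r)).clm_apply
      (continuous_const.mul (continuous_circleMap 0 r))
  rw [intervalIntegral.integral_eq_sub_of_hasDerivAt hd (hc.intervalIntegrable _ _)]
  have hper : circleMap 0 r (2 * Real.pi) = circleMap 0 r 0 := by
    simpa using periodic_circleMap 0 r 0
  rw [hper, sub_self, smul_zero, smul_zero]

lemma fderiv_comp_const_add {χ : ℂ → ℝ} (c w : ℂ) :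
    fderiv ℝ (fun w => χ (w + c)) w = fderiv ℝ χ (w + c) :=
  fderiv_comp_add_right c

lemma integral_fderiv_rotation {χ : ℂ → ℝ} (hχ : ContDiff ℝ 1 χ) (c : ℂ) :
    ∫ z, fderiv ℝ χ z (I * (z - c)) = 0 := by
  have h1 := integral_radial_mul_fderiv_rotation (X := fun w => χ (w + c))
    (hχ.comp (contDiff_id.add contDiff_const)) (fun _ => 1)
  simp only [fderiv_comp_const_add, one_mul] at h1
  rw [← integral_sub_right_eq_self _ c] at h1
  simpa using h1

lemma integral_fderiv_pointVortex {χ : ℂ → ℝ} (hχ : ContDiff ℝ 1 χ) (ξ : ℂ) :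
    ∫ z, fderiv ℝ χ z (I / (2 * Real.pi) * conj ((z - ξ)⁻¹)) = 0 := by
  have h1 := integral_radial_mul_fderiv_rotation (X := fun w => χ (w + ξ))
    (hχ.comp (contDiff_id.add contDiff_const)) (fun r => (2 * Real.pi * r ^ 2)⁻¹)
  simp only [fderiv_comp_const_add] at h1
  rw [← integral_sub_right_eq_self _ ξ] at h1
  rw [← h1]
  congr 1 with z
  rw [sub_add_cancel, ← smul_eq_mul (a := (2 * Real.pi * ‖z - ξ‖ ^ 2)⁻¹), ← map_smul]
  congr 1
  rw [Complex.inv_def, Complex.normSq_eq_norm_sq, real_smul]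
  simp only [map_mul, conj_conj, conj_ofReal]
  push_cast
  rw [mul_inv]
  ring

/-- The Biot-Savart velocity of a bounded set is divergence free in the sense of distributions. -/
lemma integral_fderiv_velocity {D : Set ℂ} (hm : MeasurableSet D) (hb : Bornology.IsBounded D)
    {χ : ℂ → ℝ} (hχ : ContDiff ℝ 1 χ) (hs : HasCompactSupport χ) :
    ∫ z, fderiv ℝ χ z (I / 2 * conj (cauchyTransform D z)) = 0 := by
  have hfin : volume D < ⊤ := hb.measure_lt_top
  have : IsFiniteMeasure (volume.restrict D) := ⟨by simpa using hfin⟩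
  have h1 : ∀ z, fderiv ℝ χ z (I / 2 * conj (cauchyTransform D z)) =
      ∫ ξ in D, fderiv ℝ χ z (I / (2 * Real.pi) * conj ((z - ξ)⁻¹)) := by
    intro z
    have hi : Integrable (fun ξ => I / (2 * Real.pi) * conj ((z - ξ)⁻¹)) (volume.restrict D) :=
      ((conjCLE : ℂ →L[ℝ] ℂ).integrable_comp (integrableOn_inv_sub hb z)).const_mul _
    rw [ContinuousLinearMap.integral_comp_comm _ hi, integral_const_mul, integral_conj,
      cauchyTransform]
    congr 1
    rw [map_mul]
    have : conj (1 / Real.pi : ℂ) = 1 / Real.pi := by simp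
    rw [this]
    have hpi : (Real.pi : ℂ) ≠ 0 := by exact_mod_cast Real.pi_ne_zero
    field_simp
  simp only [h1]
  have hc' : Continuous (fderiv ℝ χ) := hχ.continuous_fderiv one_ne_zero
  obtain ⟨C, hC⟩ := hc'.bounded_above_of_compact_support (hs.fderiv ℝ)
  obtain ⟨r₁, hr₁⟩ := hs.isCompact.isBounded.subset_closedBall (0 : ℂ)
  obtain ⟨r₂, hr₂⟩ := hb.subset_closedBall (0 : ℂ)
  rw [integral_integral_swap]
  · simp only [integral_fderiv_pointVortex hχ, integral_zero]
  · have hK := Integrable.convolution_integrand (ContinuousLinearMap.mul ℝ ℂ)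
      (integrable_const (1 : ℂ) : Integrable (fun _ : ℂ => (1 : ℂ)) (volume.restrict D))
      (integrable_indicator_inv (r₁ + r₂))
    refine (hK.norm.const_mul (C * (2 * Real.pi)⁻¹)).mono' ?_ ?_
    · refine isBoundedBilinearMap_apply.continuous.comp_aestronglyMeasurable
        (AEStronglyMeasurable.prodMk ?_ ?_)
      · exact (hc'.comp continuous_fst).aestronglyMeasurable
      · refine Measurable.aestronglyMeasurable ?_
        exact measurable_const.mul
          (continuous_conj.measurable.comp ((measurable_fst.sub measurable_snd).inv))
    · have hD : ∀ᵐ p ∂((volume : Measure ℂ).prod (volume.restrict D)), p.2 ∈ D :=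
        Measure.quasiMeasurePreserving_snd.ae (ae_restrict_mem hm)
      filter_upwards [hD] with p hp
      show ‖fderiv ℝ χ p.1 (I / (2 * Real.pi) * conj ((p.1 - p.2)⁻¹))‖ ≤ _
      by_cases h : p.1 ∈ tsupport χ
      · have hball : p.1 - p.2 ∈ closedBall (0 : ℂ) (r₁ + r₂) := by
          have e1 := hr₁ h
          have e2 := hr₂ hp
          rw [mem_closedBall, dist_zero_right] at e1 e2 ⊢
          exact (norm_sub_le _ _).trans (add_le_add e1 e2)
        refine (ContinuousLinearMap.le_opNorm _ _).trans ?_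
        rw [indicator_of_mem hball]
        have e3 : ‖I / (2 * (Real.pi : ℂ)) * conj ((p.1 - p.2)⁻¹)‖ =
            (2 * Real.pi)⁻¹ * ‖(p.1 - p.2)⁻¹‖ := by
          rw [norm_mul, RCLike.norm_conj]
          simp [abs_of_pos Real.pi_pos]
        rw [e3, ← mul_assoc]
        simp only [ContinuousLinearMap.mul_apply', one_mul]
        have := hC p.1
        have := Real.pi_pos
        gcongr
      · have h0 : fderiv ℝ χ p.1 = 0 := by
          by_contra hne
          exact h (support_fderiv_subset ℝ hne)
        have hC0 : 0 ≤ C := (norm_nonneg _).trans (hC 0)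
        rw [h0]
        simp only [zero_apply, norm_zero]
        have := Real.pi_pos
        positivity

/-- The linear field whose flow rotates an ellipse into itself. -/
lemma setIntegral_fderiv_ellipse_rotation {χ : ℂ → ℝ} (hχ : ContDiff ℝ 1 χ) (p : ℂ) (R : ℝ) {κ : ℂ}
    (hκ : ‖κ‖ < 1) :
    ∫ z in solidEllipse p R κ, fderiv ℝ χ z (ellipseMap κ (I * ellipseInv κ (z - p))) = 0 := by
  rw [solidEllipse_eq_image p R hκ, integral_image_ellipseMap p hκ measurableSet_ball]
  have h1 := integral_radial_mul_fderiv_rotation (X := fun w => χ (p + ellipseMap κ w))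
    (hχ.comp (contDiff_const.add (ellipseMap κ).contDiff)) (fun r => (Iio R).indicator 1 r)
  have h2 : ∀ w, fderiv ℝ (fun w => χ (p + ellipseMap κ w)) w =
      (fderiv ℝ χ (p + ellipseMap κ w)).comp (ellipseMap κ) := fun w =>
    ((hχ.differentiable one_ne_zero _).hasFDerivAt.comp w
      ((ellipseMap κ).hasFDerivAt.const_add p)).fderiv
  simp only [add_sub_cancel_left, ellipseInv_ellipseMap hκ]
  rw [← integral_indicator measurableSet_ball]
  convert smul_zero _
  rw [← h1]
  congr 1 with w
  by_cases hw : ‖w‖ < R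
  · rw [indicator_of_mem (by simpa using hw), h2, indicator_of_mem (by simpa using hw)]
    simp
  · rw [indicator_of_notMem (by simpa using hw), indicator_of_notMem (by simpa using hw)]
    simp

lemma setIntegral_ball_eq_polar {F : ℂ → ℂ} (hF : Continuous F) {R : ℝ} (hR : 0 < R) :
    ∫ w in ball (0 : ℂ) R, F w =
      ∫ r in (0 : ℝ)..R, ∫ θ in -Real.pi..Real.pi, r * F (circleMap 0 r θ) := by
  have hpi := Real.pi_pos
  rw [← integral_indicator measurableSet_ball, ← Complex.integral_comp_polarCoord_symm]
  have hT : polarCoord.target = Ioi (0 : ℝ) ×ˢ Ioo (-Real.pi) Real.pi := rfl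
  have hS : Ioo (0 : ℝ) R ×ˢ Ioo (-Real.pi) Real.pi ⊆ Ioi (0 : ℝ) ×ˢ Ioo (-Real.pi) Real.pi :=
    prod_mono Ioo_subset_Ioi_self subset_rfl
  have hpol : ∀ p : ℝ × ℝ, Complex.polarCoord.symm p = circleMap 0 p.1 p.2 := fun p => by
    simp [circleMap, Complex.exp_mul_I]
  have hmS : MeasurableSet (Ioo (0 : ℝ) R ×ˢ Ioo (-Real.pi) Real.pi) :=
    measurableSet_Ioo.prod measurableSet_Ioo
  have h1 : ∫ p in polarCoord.target, p.1 • (ball (0 : ℂ) R).indicator F (Complex.polarCoord.symm p)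
      = ∫ p in Ioo (0 : ℝ) R ×ˢ Ioo (-Real.pi) Real.pi, p.1 * F (circleMap 0 p.1 p.2) := by
    rw [hT]
    refine (setIntegral_eq_of_subset_of_forall_sdiff_eq_zero
      (measurableSet_Ioi.prod measurableSet_Ioo) hS ?_).trans ?_
    rotate_left
    · refine setIntegral_congr_fun hmS fun p hp => ?_
      have hn : ‖circleMap 0 p.1 p.2‖ < R := by simpa [abs_of_pos hp.1.1] using hp.1.2
      rw [hpol, indicator_of_mem (by simpa using hn), real_smul]
    · intro p hp
      have h2 : ¬ p.1 < R := fun h => hp.2 ⟨⟨hp.1.1, h⟩, hp.1.2⟩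
      have hn : ¬ ‖circleMap 0 p.1 p.2‖ < R := by
        have : 0 < p.1 := hp.1.1
        simpa [abs_of_pos this] using h2
      rw [hpol, indicator_of_notMem (by simpa using hn), smul_zero]
  have hcont : Continuous fun p : ℝ × ℝ => (p.1 : ℂ) * F (circleMap 0 p.1 p.2) := by
    have : Continuous fun p : ℝ × ℝ => circleMap 0 p.1 p.2 := by unfold circleMap; fun_prop
    fun_prop
  rw [h1, Measure.volume_eq_prod, setIntegral_prod]
  · rw [intervalIntegral.integral_of_le hR.le, integral_Ioc_eq_integral_Ioo]
    refine setIntegral_congr_fun measurableSet_Ioo fun r _ => ?_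
    rw [intervalIntegral.integral_of_le (by linarith), integral_Ioc_eq_integral_Ioo]
  · refine IntegrableOn.mono_set (t := Icc (0 : ℝ) R ×ˢ Icc (-Real.pi) Real.pi) ?_
      (prod_mono Ioo_subset_Icc_self Ioo_subset_Icc_self)
    exact hcont.continuousOn.integrableOn_compact (isCompact_Icc.prod isCompact_Icc)

/-- Gauss's theorem on a disc: the integral of a directional derivative is the flux through the
boundary. -/
lemma setIntegral_ball_fderiv {y : ℂ → ℂ} (hy : ContDiff ℝ 1 y) {R : ℝ} (hR : 0 < R) (e : ℂ) :
    ∫ w in ball (0 : ℂ) R, fderiv ℝ y w e =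
      ∫ θ in -Real.pi..Real.pi, R * (conj e * circleMap 0 1 θ).re * y (circleMap 0 R θ) := by
  have hcm : Continuous fun p : ℝ × ℝ => circleMap 0 p.1 p.2 := by unfold circleMap; fun_prop
  have hfc : Continuous (fderiv ℝ y) := hy.continuous_fderiv one_ne_zero
  rw [setIntegral_ball_eq_polar (hfc.clm_apply continuous_const) hR]
  set c : ℝ → ℝ := fun θ => (conj e * circleMap 0 1 θ).re with hc
  set s : ℝ → ℝ := fun θ => (conj e * (I * circleMap 0 1 θ)).re with hs
  have hdm : ∀ θ, HasDerivAt (circleMap 0 1) (I * circleMap 0 1 θ) θ := fun θ => by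
    have := hasDerivAt_circleMap 0 1 θ
    rwa [mul_comm] at this
  have hcd : ∀ θ, HasDerivAt c (s θ) θ := fun θ =>
    (Complex.reCLM.hasFDerivAt.comp_hasDerivAt θ ((hdm θ).const_mul (conj e)))
  have hsd : ∀ θ, HasDerivAt s (-c θ) θ := fun θ => by
    have := (Complex.reCLM.hasFDerivAt.comp_hasDerivAt θ
      (((hdm θ).const_mul I).const_mul (conj e)))
    have e1 : conj e * (I * (I * circleMap 0 1 θ)) = -(conj e * circleMap 0 1 θ) := by
      rw [← mul_assoc I, I_mul_I]; ring
    rw [e1] at this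
    exact (show HasDerivAt s _ θ from this).congr_deriv (by simp [hc])
  have hcC : Continuous c := by fun_prop
  have hsC : Continuous s := by fun_prop
  -- polar derivatives of `y`
  have hpol : ∀ p : ℝ × ℝ, HasFDerivAt (fun p : ℝ × ℝ => circleMap 0 p.1 p.2)
      ((ContinuousLinearMap.fst ℝ ℝ ℝ).smulRight (circleMap 0 1 p.2) +
        (ContinuousLinearMap.snd ℝ ℝ ℝ).smulRight (p.1 * (I * circleMap 0 1 p.2))) p := by
    intro p
    have h1 : HasFDerivAt (fun p : ℝ × ℝ => (p.1 : ℂ))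
        (ofRealCLM.comp (ContinuousLinearMap.fst ℝ ℝ ℝ)) p :=
      (ofRealCLM.comp (ContinuousLinearMap.fst ℝ ℝ ℝ)).hasFDerivAt
    have h2 : HasFDerivAt (fun p : ℝ × ℝ => circleMap 0 1 p.2)
        ((ContinuousLinearMap.snd ℝ ℝ ℝ).smulRight (I * circleMap 0 1 p.2)) p := by
      have := (hdm p.2).hasFDerivAt.comp p (ContinuousLinearMap.snd ℝ ℝ ℝ).hasFDerivAt
      refine this.congr_fderiv ?_
      ext <;> simp
    have h3 := h1.mul h2
    have e1 : (fun p : ℝ × ℝ => circleMap 0 p.1 p.2) =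
        fun p : ℝ × ℝ => (p.1 : ℂ) * circleMap 0 1 p.2 := by
      funext p; simp [circleMap]
    rw [e1]
    refine h3.congr_fderiv ?_
    ext <;> simp [mul_comm]
  have hY : ∀ p : ℝ × ℝ, HasFDerivAt (fun p : ℝ × ℝ => y (circleMap 0 p.1 p.2))
      ((fderiv ℝ y (circleMap 0 p.1 p.2)).comp
        ((ContinuousLinearMap.fst ℝ ℝ ℝ).smulRight (circleMap 0 1 p.2) +
        (ContinuousLinearMap.snd ℝ ℝ ℝ).smulRight (p.1 * (I * circleMap 0 1 p.2)))) p := fun p =>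
    (hy.differentiable one_ne_zero _).hasFDerivAt.comp p (hpol p)
  have hcf : ∀ p : ℝ × ℝ, HasFDerivAt (fun p : ℝ × ℝ => p.1 * c p.2)
      (p.1 • (ContinuousLinearMap.snd ℝ ℝ ℝ).smulRight (s p.2) +
        c p.2 • ContinuousLinearMap.fst ℝ ℝ ℝ) p := fun p =>
    ((ContinuousLinearMap.fst ℝ ℝ ℝ).hasFDerivAt.mul
      (((hcd p.2).hasFDerivAt.comp p (ContinuousLinearMap.snd ℝ ℝ ℝ).hasFDerivAt))).congr_fderiv
      (by ext <;> simp)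
  have hsf : ∀ p : ℝ × ℝ, HasFDerivAt (fun p : ℝ × ℝ => s p.2)
      ((ContinuousLinearMap.snd ℝ ℝ ℝ).smulRight (-c p.2)) p := fun p =>
    ((hsd p.2).hasFDerivAt.comp p (ContinuousLinearMap.snd ℝ ℝ ℝ).hasFDerivAt).congr_fderiv
      (by ext <;> simp)
  have hf := fun p => (hcf p).smul (hY p)
  have hg := fun p => (hsf p).smul (hY p)
  have hsum : ∀ (r θ : ℝ), (r : ℂ) * fderiv ℝ y (circleMap 0 r θ) e =
      r * ((c θ : ℝ) • fderiv ℝ y (circleMap 0 r θ) (circleMap 0 1 θ) +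
        (s θ : ℝ) • fderiv ℝ y (circleMap 0 r θ) (I * circleMap 0 1 θ)) := by
    intro r θ
    rw [← map_smul, ← map_smul, ← map_add]
    congr 2
    set u := circleMap 0 1 θ
    have hu : u * conj u = 1 := by
      rw [Complex.mul_conj']; simp [u]
    have hu' : u.re * u.re + u.im * u.im = 1 := by
      have := congrArg re hu; simpa using this
    apply Complex.ext
    · simp [hc, hs, u]; linear_combination (-e.re) * hu'
    · simp [hc, hs, u]; linear_combination (-e.im) * hu'
  have key := integral2_divergence_prod_of_hasFDerivAt _ _ _ _ 0 (-Real.pi) R Real.pi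
    (fun p _ => (hf p).continuousAt.continuousWithinAt)
    (fun p _ => (hg p).continuousAt.continuousWithinAt) (fun p _ => hf p) (fun p _ => hg p) (by
      refine ContinuousOn.integrableOn_compact (isCompact_uIcc.prod isCompact_uIcc)
        (Continuous.continuousOn ?_)
      have h1 : Continuous fun p : ℝ × ℝ => fderiv ℝ y (circleMap 0 p.1 p.2) (circleMap 0 1 p.2) :=
        (hfc.comp hcm).clm_apply (by fun_prop)
      have h2 : Continuous fun p : ℝ × ℝ =>
          fderiv ℝ y (circleMap 0 p.1 p.2) (p.1 * (I * circleMap 0 1 p.2)) :=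
        (hfc.comp hcm).clm_apply (by fun_prop)
      have h3 : Continuous fun p : ℝ × ℝ => y (circleMap 0 p.1 p.2) := hy.continuous.comp hcm
      simp
      fun_prop)
  have hper : ∀ r, circleMap 0 r (-Real.pi) = circleMap 0 r Real.pi := fun r => by
    have := periodic_circleMap 0 r (-Real.pi)
    rw [← this]; congr 1; ring
  have hsper : s (-Real.pi) = s Real.pi := by simp only [hs, hper]
  simp only [Pi.smul_apply', hper, hsper, sub_self, zero_add, zero_mul, zero_smul, intervalIntegral.integral_zero,
    sub_zero] at key
  rw [show (∫ θ in -Real.pi..Real.pi, (R : ℂ) * (conj e * circleMap 0 1 θ).re * y (circleMap 0 R θ))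
    = ∫ θ in -Real.pi..Real.pi, (R * c θ) • y (circleMap 0 R θ) by
      simp only [hc, real_smul, ofReal_mul], ← key]
  congr 1 with r
  congr 1 with θ
  rw [hsum]
  have e2 : fderiv ℝ y (circleMap 0 r θ) (r * (I * circleMap 0 1 θ)) =
      r • fderiv ℝ y (circleMap 0 r θ) (I * circleMap 0 1 θ) := by
    rw [← map_smul, real_smul]
  simp [e2]
  ring

/-- Gauss's theorem for the `∂̄` operator on an ellipse, whose outer normal, in the parametrization
`p + R (u + κ conj u)` with `|u| = 1`, is proportional to `u - κ conj u`. -/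
lemma setIntegral_solidEllipse_dbar {Y : ℂ → ℂ} (hY : ContDiff ℝ 1 Y) (p : ℂ) {R : ℝ} (hR : 0 < R)
    {κ : ℂ} (hκ : ‖κ‖ < 1) :
    ∫ z in solidEllipse p R κ, (fderiv ℝ Y z 1 + I * fderiv ℝ Y z I) =
      ∫ θ in -Real.pi..Real.pi, R * (circleMap 0 1 θ - κ * conj (circleMap 0 1 θ)) *
        Y (p + ellipseMap κ (circleMap 0 R θ)) := by
  set y : ℂ → ℂ := fun w => Y (p + ellipseMap κ w) with hy
  have hyC : ContDiff ℝ 1 y := hY.comp (contDiff_const.add (ellipseMap κ).contDiff)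
  have h2 : ∀ w, fderiv ℝ y w = (fderiv ℝ Y (p + ellipseMap κ w)).comp (ellipseMap κ) := fun w =>
    ((hY.differentiable one_ne_zero _).hasFDerivAt.comp w
      ((ellipseMap κ).hasFDerivAt.const_add p)).fderiv
  have h3 : ∀ w e, fderiv ℝ Y (p + ellipseMap κ w) e = fderiv ℝ y w (ellipseInv κ e) := by
    intro w e
    rw [h2, ContinuousLinearMap.comp_apply, ellipseMap_ellipseInv hκ]
  have hfc : Continuous (fderiv ℝ y) := hyC.continuous_fderiv one_ne_zero
  have hi : ∀ e, IntegrableOn (fun w => fderiv ℝ y w e) (ball 0 R) := fun e =>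
    ((hfc.clm_apply continuous_const).continuousOn.integrableOn_compact
      (isCompact_closedBall _ _)).mono_set ball_subset_closedBall
  have hcy : Continuous y := hyC.continuous
  rw [solidEllipse_eq_image p R hκ, integral_image_ellipseMap p hκ measurableSet_ball]
  simp only [h3]
  rw [integral_add (hi _) ((hi _).const_mul I), integral_const_mul, setIntegral_ball_fderiv hyC hR,
    setIntegral_ball_fderiv hyC hR, ← intervalIntegral.integral_const_mul,
    ← intervalIntegral.integral_add, ← intervalIntegral.integral_smul]
  · congr 1 with θ
    set u := circleMap 0 1 θ
    have hd := one_sub_norm_sq_ne_zero hκ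
    have e1 : ∀ ζ : ℂ, ((conj ζ * u).re : ℂ) = (conj ζ * u + ζ * conj u) / 2 := by
      intro ζ
      rw [Complex.re_eq_add_conj, map_mul, conj_conj]
    have e0 : y (circleMap 0 R θ) = Y (p + ellipseMap κ (circleMap 0 R θ)) := rfl
    rw [e1, e1, ellipseInv_apply, ellipseInv_apply, e0, real_smul]
    simp only [map_mul, map_sub, map_neg, conj_ofReal, map_one, conj_I]
    push_cast
    field_simp
    linear_combination (-(Y (p + ellipseMap κ (circleMap 0 R θ))) * R *
      (u + conj κ * u - conj u - κ * conj u)) * I_sq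
  · exact Continuous.intervalIntegrable (by fun_prop) _ _
  · exact Continuous.intervalIntegrable (by fun_prop) _ _

/-! ### Rotating solutions are stationary in the rotating frame -/

lemma integral_comp_rotation {E : Type*} [NormedAddCommGroup E] [NormedSpace ℝ E] (c : ℂ) {a : ℂ}
    (ha : ‖a‖ = 1) (f : ℂ → E) : ∫ z, f (c + a * (z - c)) = ∫ z, f z := by
  have h1 := integral_sub_right_eq_self (fun z => f (c + a * z)) (μ := volume) c
  rw [h1]
  set u : Circle := ⟨a, mem_sphere_zero_iff_norm.2 ha⟩
  have h3 := (LinearIsometryEquiv.measurePreserving (rotation u)).integral_comp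
    (rotation u).toHomeomorph.measurableEmbedding (fun z => f (c + z))
  simp only [rotation_apply] at h3
  rw [show (fun z => f (c + a * z)) = fun z => f (c + (u : ℂ) * z) from rfl, h3,
    integral_add_left_eq_self f c]

lemma integrable_comp_rotation (c : ℂ) {a : ℂ} (ha : ‖a‖ = 1) {f : ℂ → ℝ} (hf : Integrable f) :
    Integrable fun z => f (c + a * (z - c)) := by
  set u : Circle := ⟨a, mem_sphere_zero_iff_norm.2 ha⟩
  have h1 : Integrable fun z => f (c + z) := hf.comp_add_left c
  have h2 : Integrable fun z => f (c + (u : ℂ) * z) :=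
    (LinearIsometryEquiv.measurePreserving (rotation u)).integrable_comp_of_integrable h1
  exact h2.comp_sub_right c

lemma exp_neg_mul_exp_I (x : ℝ) : Complex.exp (-(I * x)) * Complex.exp (I * x) = 1 := by
  rw [← Complex.exp_add]; simp

lemma norm_exp_neg_I_mul_ofReal (x : ℝ) : ‖Complex.exp (-(I * x))‖ = 1 := by
  have := norm_exp_I_mul_ofReal (-x)
  simpa using this

/-- The Biot-Savart law is invariant under rotations. -/
lemma biotSavart_rotated (w : ℂ → ℝ) (c : ℂ) (Ω t : ℝ) (y : ℂ) :
    biotSavart (rotated w c Ω t) (c + Complex.exp (I * (t * Ω : ℝ)) * (y - c)) =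
      Complex.exp (I * (t * Ω : ℝ)) * biotSavart w y := by
  set e := Complex.exp (I * (t * Ω : ℝ)) with he
  have hen : ‖e‖ = 1 := norm_exp_I_mul_ofReal _
  have hinv := exp_neg_mul_exp_I (t * Ω)
  rw [← he] at hinv
  have hcc : e * conj e = 1 := by rw [Complex.mul_conj', hen]; simp
  have h0 : e ≠ 0 := Complex.exp_ne_zero _
  suffices key : ∫ ξ, (rotated w c Ω t ξ : ℂ) / conj (c + e * (y - c) - ξ) =
      e * ∫ ξ, (w ξ : ℂ) / conj (y - ξ) by
    rw [biotSavart, biotSavart, key]; ring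
  rw [← integral_const_mul, ← integral_comp_rotation c hen
    fun ξ => (rotated w c Ω t ξ : ℂ) / conj (c + e * (y - c) - ξ)]
  refine integral_congr_ae (Eventually.of_forall fun ξ => ?_)
  beta_reduce
  have h1 : rotated w c Ω t (c + e * (ξ - c)) = w ξ := by
    rw [rotated, add_sub_cancel_left, ← mul_assoc, hinv]; simp
  have h2 : c + e * (y - c) - (c + e * (ξ - c)) = e * (y - ξ) := by ring
  have h3 : conj e ≠ 0 := by simpa using h0
  rw [h1, h2, map_mul, div_mul_eq_div_div, mul_div_assoc']
  congr 1
  rw [div_eq_iff h3]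
  linear_combination -(w ξ : ℂ) * hcc

/-- The passage from the rotating frame to the frame at rest, on space-time. -/
def rotatingFrame (c : ℂ) (Ω : ℝ) : (ℝ × ℂ) ≃ₜ (ℝ × ℂ) where
  toFun p := (p.1, c + Complex.exp (I * (p.1 * Ω : ℝ)) * (p.2 - c))
  invFun p := (p.1, c + Complex.exp (-(I * (p.1 * Ω : ℝ))) * (p.2 - c))
  left_inv p := by
    refine Prod.ext rfl ?_
    show c + _ * (c + _ * (p.2 - c) - c) = p.2
    rw [add_sub_cancel_left, ← mul_assoc, exp_neg_mul_exp_I]; ring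
  right_inv p := by
    refine Prod.ext rfl ?_
    show c + _ * (c + _ * (p.2 - c) - c) = p.2
    rw [add_sub_cancel_left, ← mul_assoc, mul_comm (Complex.exp _), exp_neg_mul_exp_I]; ring
  continuous_toFun := by fun_prop
  continuous_invFun := by fun_prop

lemma rotatingFrame_apply (c : ℂ) (Ω : ℝ) (p : ℝ × ℂ) :
    rotatingFrame c Ω p = (p.1, c + Complex.exp (I * (p.1 * Ω : ℝ)) * (p.2 - c)) := rfl

lemma contDiff_rotatingFrame (c : ℂ) (Ω : ℝ) {n : WithTop ℕ∞} : ContDiff ℝ n (rotatingFrame c Ω) := by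
  have h : ContDiff ℝ n fun p : ℝ × ℂ => ((p.1 * Ω : ℝ) : ℂ) :=
    ofRealCLM.contDiff.comp (contDiff_fst.mul contDiff_const)
  exact contDiff_fst.prodMk
    (contDiff_const.add ((contDiff_const.mul h).cexp.mul (contDiff_snd.sub contDiff_const)))

lemma contDiff_rotatingFrame_symm (c : ℂ) (Ω : ℝ) {n : WithTop ℕ∞} :
    ContDiff ℝ n (rotatingFrame c Ω).symm := by
  have h : ContDiff ℝ n fun p : ℝ × ℂ => ((p.1 * Ω : ℝ) : ℂ) :=
    ofRealCLM.contDiff.comp (contDiff_fst.mul contDiff_const)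
  exact contDiff_fst.prodMk
    (contDiff_const.add ((contDiff_const.mul h).neg.cexp.mul (contDiff_snd.sub contDiff_const)))

/-- The velocity relative to the frame that rotates around `c` with angular velocity `Ω`. -/
def relativeVelocity (w : ℂ → ℝ) (c : ℂ) (Ω : ℝ) (y : ℂ) : ℂ := biotSavart w y - I * Ω * (y - c)

lemma fderiv_rotatingFrame (w : ℂ → ℝ) (c : ℂ) (Ω : ℝ) (t : ℝ) (y : ℂ) :
    fderiv ℝ (rotatingFrame c Ω) (t, y) (1, relativeVelocity w c Ω y) =
      (1, Complex.exp (I * (t * Ω : ℝ)) * biotSavart w y) := by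
  have hd : DifferentiableAt ℝ (rotatingFrame c Ω) (t, y) :=
    (contDiff_rotatingFrame c Ω (n := 1)).differentiable one_ne_zero _
  -- the derivative along the line through `(t, y)` in the direction in question
  have hline : HasDerivAt (fun s : ℝ => (t + s * 1, y + s • relativeVelocity w c Ω y))
      ((1 : ℝ), relativeVelocity w c Ω y) 0 := by
    have h1 : HasDerivAt (fun s : ℝ => t + s * 1) 1 0 := by
      simpa using ((hasDerivAt_id (0 : ℝ)).mul_const 1).const_add t
    have h2 : HasDerivAt (fun s : ℝ => y + s • relativeVelocity w c Ω y)
        (relativeVelocity w c Ω y) 0 := by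
      simpa using ((hasDerivAt_id (0 : ℝ)).smul_const (relativeVelocity w c Ω y)).const_add y
    exact h1.prodMk h2
  have hpt : (t, y) = (t + (0 : ℝ) * 1, y + (0 : ℝ) • relativeVelocity w c Ω y) := by simp
  rw [hpt] at hd
  have h3 := hd.hasFDerivAt.comp_hasDerivAt (0 : ℝ) hline
  rw [← hpt] at h3
  have h4 : HasDerivAt (fun s : ℝ => (t + s * 1, c + Complex.exp (I * ((t + s * 1) * Ω : ℝ)) *
      (y + s • relativeVelocity w c Ω y - c)))
      ((1 : ℝ), Complex.exp (I * (t * Ω : ℝ)) * biotSavart w y) 0 := by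
    have h1 : HasDerivAt (fun s : ℝ => t + s * 1) 1 0 := by
      simpa using ((hasDerivAt_id (0 : ℝ)).mul_const 1).const_add t
    refine h1.prodMk ?_
    have h5 : HasDerivAt (fun s : ℝ => I * (((t + s * 1) * Ω : ℝ) : ℂ)) (I * Ω) 0 := by
      have := ((h1.mul_const Ω).ofReal_comp).const_mul I
      simpa using this
    have h6 : HasDerivAt (fun s : ℝ => y + s • relativeVelocity w c Ω y - c)
        (relativeVelocity w c Ω y) 0 := by
      simpa using (((hasDerivAt_id (0 : ℝ)).smul_const (relativeVelocity w c Ω y)).const_add y).sub_const c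
    have h7 := (h5.cexp.mul h6).const_add c
    refine h7.congr_deriv ?_
    simp only [relativeVelocity, zero_mul, add_zero, zero_smul]
    ring
  exact h3.unique h4

/-- The weak formulation at time `t`, transported to the rotating frame. -/
lemma integral_rotated_mul_fderiv (w : ℂ → ℝ) (c : ℂ) (Ω : ℝ) {φ : ℝ × ℂ → ℝ}
    (hφ : Differentiable ℝ φ) (t : ℝ) :
    ∫ z, rotated w c Ω t z * fderiv ℝ φ (t, z) ((1 : ℝ), biotSavart (rotated w c Ω t) z) =
      ∫ y, w y * fderiv ℝ (φ ∘ rotatingFrame c Ω) (t, y) ((1 : ℝ), relativeVelocity w c Ω y) := by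
  rw [← integral_comp_rotation c (norm_exp_I_mul_ofReal (t * Ω))]
  congr 1 with y
  rw [biotSavart_rotated]
  have h1 : rotated w c Ω t (c + Complex.exp (I * (t * Ω : ℝ)) * (y - c)) = w y := by
    rw [rotated, add_sub_cancel_left, ← mul_assoc, exp_neg_mul_exp_I]; simp
  rw [h1, fderiv_comp _ (hφ _)
    ((contDiff_rotatingFrame c Ω (n := 1)).differentiable one_ne_zero _),
    ContinuousLinearMap.comp_apply, fderiv_rotatingFrame]
  rfl

section Weak

variable {w : ℂ → ℝ}

lemma hasCompactSupport_slice {ψ : ℝ × ℂ → ℝ} (hs : HasCompactSupport ψ) (t : ℝ) :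
    HasCompactSupport fun y => ψ (t, y) :=
  hs.comp_isClosedEmbedding (g := fun y : ℂ => (t, y))
    (Topology.IsClosedEmbedding.of_continuous_injective_isClosedMap (by fun_prop)
      (fun _ _ h => (Prod.ext_iff.1 h).2) (isClosedMap_prodMk_left t))

/-- Integration by parts in time against a stationary density. -/
lemma integral_Ioi_mul_fderiv_time (hi : Integrable w) {ψ : ℝ × ℂ → ℝ} (hψ : ContDiff ℝ 1 ψ)
    (hs : HasCompactSupport ψ) :
    (∫ t in Ioi (0 : ℝ), ∫ y, w y * fderiv ℝ ψ (t, y) ((1 : ℝ), 0)) = -∫ y, w y * ψ (0, y) ∧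
      Integrable fun t : ℝ => ∫ y, w y * fderiv ℝ ψ (t, y) ((1 : ℝ), 0) := by
  have hc' : Continuous fun p => fderiv ℝ ψ p ((1 : ℝ), (0 : ℂ)) :=
    (hψ.continuous_fderiv one_ne_zero).clm_apply continuous_const
  obtain ⟨C, hC⟩ := hc'.bounded_above_of_compact_support (hs.fderiv_apply ℝ _)
  obtain ⟨C₀, hC₀⟩ := hψ.continuous.bounded_above_of_compact_support hs
  set G : ℝ → ℝ := fun t => ∫ y, w y * ψ (t, y) with hG
  set G' : ℝ → ℝ := fun t => ∫ y, w y * fderiv ℝ ψ (t, y) ((1 : ℝ), 0) with hG'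
  have hd : ∀ t y, HasDerivAt (fun s : ℝ => ψ (s, y)) (fderiv ℝ ψ (t, y) ((1 : ℝ), 0)) t := by
    intro t y
    have h1 : HasDerivAt (fun s : ℝ => (s, y)) ((1 : ℝ), (0 : ℂ)) t :=
      (hasDerivAt_id t).prodMk (hasDerivAt_const t y)
    exact (hψ.differentiable one_ne_zero (t, y)).hasFDerivAt.comp_hasDerivAt t h1
  have hm : ∀ {f : ℝ × ℂ → ℝ}, Continuous f → ∀ t,
      AEStronglyMeasurable (fun y => w y * f (t, y)) volume := fun hf t =>
    hi.aestronglyMeasurable.mul (Continuous.aestronglyMeasurable (by fun_prop))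
  have hderiv : ∀ t, HasDerivAt G (G' t) t := by
    intro t
    refine (hasDerivAt_integral_of_dominated_loc_of_deriv_le (F := fun s y => w y * ψ (s, y))
      (F' := fun s y => w y * fderiv ℝ ψ (s, y) ((1 : ℝ), 0))
      (bound := fun y => ‖w y‖ * C) univ_mem
      (Eventually.of_forall fun s => hm hψ.continuous s) ?_ (hm hc' t) ?_
      (hi.norm.mul_const C) ?_).2
    · exact hi.mul_bdd (c := C₀) (Continuous.aestronglyMeasurable (by fun_prop))
        (Eventually.of_forall fun y => hC₀ _)
    · refine Eventually.of_forall fun y s _ => ?_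
      rw [norm_mul]
      exact mul_le_mul_of_nonneg_left (hC _) (norm_nonneg _)
    · exact Eventually.of_forall fun y s _ => (hd s y).const_mul (w y)
  have hG'c : Continuous G' := by
    refine continuous_of_dominated (bound := fun y => ‖w y‖ * C) (fun t => hm hc' t) ?_
      (hi.norm.mul_const C) ?_
    · intro t
      refine Eventually.of_forall fun y => ?_
      rw [norm_mul]
      exact mul_le_mul_of_nonneg_left (hC _) (norm_nonneg _)
    · refine Eventually.of_forall fun y => ?_
      have : Continuous fun t : ℝ => fderiv ℝ ψ (t, y) ((1 : ℝ), (0 : ℂ)) :=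
        hc'.comp (by fun_prop : Continuous fun t : ℝ => (t, y))
      exact continuous_const.mul this
  have hderiv' : deriv G = G' := funext fun t => (hderiv t).deriv
  have hGs : HasCompactSupport G := by
    refine HasCompactSupport.intro (hs.isCompact.image continuous_fst) fun t ht => ?_
    refine integral_eq_zero_of_ae (Eventually.of_forall fun y => ?_)
    have : ψ (t, y) = 0 := image_eq_zero_of_notMem_tsupport fun h => ht ⟨_, h, rfl⟩
    simp [this]
  have hGc : ContDiff ℝ 1 G := by
    rw [contDiff_one_iff_deriv, hderiv']
    exact ⟨fun t => (hderiv t).differentiableAt, hG'c⟩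
  have hG's : HasCompactSupport G' := hderiv' ▸ hGs.deriv
  refine ⟨?_, hG'c.integrable_of_hasCompactSupport hG's⟩
  have := hGs.integral_Ioi_deriv_eq hGc 0
  rwa [hderiv'] at this

lemma fderiv_apply_one_add {ψ : ℝ × ℂ → ℝ} (hψ : Differentiable ℝ ψ) (t : ℝ) (y u : ℂ) :
    fderiv ℝ ψ (t, y) ((1 : ℝ), u) =
      fderiv ℝ ψ (t, y) ((1 : ℝ), 0) + fderiv ℝ (fun y => ψ (t, y)) y u := by
  have h1 : HasFDerivAt (fun y => ψ (t, y))
      ((fderiv ℝ ψ (t, y)).comp (ContinuousLinearMap.inr ℝ ℝ ℂ)) y :=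
    (hψ (t, y)).hasFDerivAt.comp y (hasFDerivAt_prodMk_right t y)
  rw [h1.fderiv, ContinuousLinearMap.comp_apply, ← map_add]
  simp

lemma integral_mul_fderiv_split (hi : Integrable w) (hv : Continuous (biotSavart w)) (c : ℂ) (Ω : ℝ)
    {ψ : ℝ × ℂ → ℝ} (hψ : ContDiff ℝ 1 ψ) (hs : HasCompactSupport ψ) (t : ℝ) :
    ∫ y, w y * fderiv ℝ ψ (t, y) ((1 : ℝ), relativeVelocity w c Ω y) =
      (∫ y, w y * fderiv ℝ ψ (t, y) ((1 : ℝ), 0)) +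
        ∫ y, w y * fderiv ℝ (fun y => ψ (t, y)) y (relativeVelocity w c Ω y) := by
  have hc' : Continuous fun p => fderiv ℝ ψ p ((1 : ℝ), (0 : ℂ)) :=
    (hψ.continuous_fderiv one_ne_zero).clm_apply continuous_const
  obtain ⟨C, hC⟩ := hc'.bounded_above_of_compact_support (hs.fderiv_apply ℝ _)
  have hψt : ContDiff ℝ 1 fun y => ψ (t, y) := hψ.comp (contDiff_const.prodMk contDiff_id)
  have hu : Continuous (relativeVelocity w c Ω) := by unfold relativeVelocity; fun_prop
  have hc2 : Continuous fun y => fderiv ℝ (fun y => ψ (t, y)) y (relativeVelocity w c Ω y) :=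
    (hψt.continuous_fderiv one_ne_zero).clm_apply hu
  have hs2 : HasCompactSupport fun y => fderiv ℝ (fun y => ψ (t, y)) y (relativeVelocity w c Ω y) := by
    refine ((hasCompactSupport_slice hs t).fderiv ℝ).mono fun y hy => ?_
    intro h0
    exact hy (by simp [h0])
  obtain ⟨C₂, hC₂⟩ := hc2.bounded_above_of_compact_support hs2
  rw [← integral_add]
  · congr 1 with y
    rw [fderiv_apply_one_add (hψ.differentiable one_ne_zero)]; ring
  · exact hi.mul_bdd (c := C) (hc'.comp (by fun_prop : Continuous fun y : ℂ => (t, y))).aestronglyMeasurable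
      (Eventually.of_forall fun y => hC _)
  · exact hi.mul_bdd (c := C₂) hc2.aestronglyMeasurable (Eventually.of_forall fun y => hC₂ _)

/-- A bounded integrable vorticity rotates around `c` with angular velocity `Ω` exactly if it is
stationary under the velocity relative to the rotating frame. -/
lemma rotatesAbout_iff (hm : Measurable w) (hi : Integrable w) {M : ℝ} (hM : ∀ z, |w z| ≤ M)
    (hv : Continuous (biotSavart w)) (c : ℂ) (Ω : ℝ) :
    RotatesAbout w c Ω ↔ ∀ χ : ℂ → ℝ, ContDiff ℝ ((⊤ : ℕ∞) : WithTop ℕ∞) χ → HasCompactSupport χ →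
      ∫ y, w y * fderiv ℝ χ y (relativeVelocity w c Ω y) = 0 := by
  have h1le : (1 : WithTop ℕ∞) ≤ ((⊤ : ℕ∞) : WithTop ℕ∞) := by
    exact_mod_cast (le_top : (1 : ℕ∞) ≤ ⊤)
  have hzero : ∀ ψ : ℝ × ℂ → ℝ, ∀ z, (ψ ∘ rotatingFrame c Ω) (0, z) = ψ (0, z) := by
    intro ψ z
    simp [rotatingFrame_apply]
  constructor
  · intro h χ hχ hχs
    -- test functions that split in the rotating frame, supported in positive times
    set η : ContDiffBump (2 : ℝ) := ⟨1 / 2, 1, by norm_num, by norm_num⟩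
    set ψ : ℝ × ℂ → ℝ := fun p => η p.1 * χ p.2 with hψdef
    have hψ : ContDiff ℝ ((⊤ : ℕ∞) : WithTop ℕ∞) ψ :=
      (η.contDiff.comp contDiff_fst).mul (hχ.comp contDiff_snd)
    have hψs : HasCompactSupport ψ := by
      refine HasCompactSupport.intro (η.hasCompactSupport.isCompact.prod hχs.isCompact)
        fun p hp => ?_
      by_cases h1 : p.1 ∈ tsupport η
      · have h2 : p.2 ∉ tsupport χ := fun h2 => hp ⟨h1, h2⟩
        simp [hψdef, image_eq_zero_of_notMem_tsupport h2]
      · simp [hψdef, image_eq_zero_of_notMem_tsupport h1]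
    have hcomp : (ψ ∘ (rotatingFrame c Ω).symm) ∘ rotatingFrame c Ω = ψ := by
      funext p; simp
    have hφ : ContDiff ℝ ((⊤ : ℕ∞) : WithTop ℕ∞) (ψ ∘ (rotatingFrame c Ω).symm) :=
      hψ.comp (contDiff_rotatingFrame_symm c Ω)
    have hw := h.weak (ψ ∘ (rotatingFrame c Ω).symm) hφ
      (hψs.comp_homeomorph (rotatingFrame c Ω).symm)
    have hη0 : η (0 : ℝ) = 0 := η.zero_of_le_dist (by simp [η, Real.dist_eq])
    have h0 : ∀ z, (ψ ∘ (rotatingFrame c Ω).symm) (0, z) = 0 := by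
      intro z
      rw [← hzero (ψ ∘ (rotatingFrame c Ω).symm), hcomp]
      simp [hψdef, hη0]
    obtain ⟨e1, e2⟩ := integral_Ioi_mul_fderiv_time hi (hψ.of_le h1le) hψs
    have e3 : ∀ t, ∫ y, w y * fderiv ℝ (fun y => ψ (t, y)) y (relativeVelocity w c Ω y) =
        η t * ∫ y, w y * fderiv ℝ χ y (relativeVelocity w c Ω y) := by
      intro t
      rw [← integral_const_mul]
      congr 1 with y
      have : fderiv ℝ (fun y => ψ (t, y)) y = η t • fderiv ℝ χ y := by
        show fderiv ℝ (fun y => η t * χ y) y = _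
        exact fderiv_const_mul (hχ.differentiable (by simp) y) _
      rw [this]
      simp only [smul_apply, smul_eq_mul]
      ring
    simp only [h0, mul_zero, integral_zero, add_zero,
      integral_rotated_mul_fderiv w c Ω (hφ.differentiable (by simp)), hcomp,
      integral_mul_fderiv_split hi hv c Ω (hψ.of_le h1le) hψs, e3] at hw
    have hηi : IntegrableOn (fun t => η t * ∫ y, w y * fderiv ℝ χ y (relativeVelocity w c Ω y))
        (Ioi (0 : ℝ)) := (η.integrable.mul_const _).integrableOn
    rw [integral_add e2.integrableOn hηi, e1] at hw
    have h0' : ∀ z, ψ (0, z) = 0 := fun z => by simp [hψdef, hη0]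
    simp only [h0', mul_zero, integral_zero, neg_zero, zero_add] at hw
    rw [integral_mul_const] at hw
    refine (mul_eq_zero.1 hw).resolve_left (ne_of_gt ?_)
    rw [setIntegral_pos_iff_support_of_nonneg_ae
      (Eventually.of_forall fun t => η.nonneg) η.integrable.integrableOn]
    refine lt_of_lt_of_le (b := volume (Ioo (3 / 2 : ℝ) 2)) (by simp; norm_num) (measure_mono ?_)
    intro t ht
    refine ⟨?_, by simpa using lt_trans (by norm_num) ht.1⟩
    rw [η.support_eq]
    simp only [η, Real.ball_eq_Ioo]
    constructor <;> linarith [ht.1, ht.2]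
  · intro h
    refine ⟨?_, ?_, ⟨max M (∫ z, |w z|), ?_⟩, ?_⟩
    · refine (hm.comp (Continuous.measurable ?_)).aestronglyMeasurable
      fun_prop
    · intro t _
      exact integrable_comp_rotation c (norm_exp_neg_I_mul_ofReal _) hi
    · intro t _
      refine ⟨Eventually.of_forall fun z => (hM _).trans (le_max_left _ _), le_of_eq_of_le ?_
        (le_max_right _ _)⟩
      exact integral_comp_rotation c (norm_exp_neg_I_mul_ofReal _) (fun z => |w z|)
    · intro φ hφ hφs
      have hψ : ContDiff ℝ ((⊤ : ℕ∞) : WithTop ℕ∞) (φ ∘ rotatingFrame c Ω) :=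
        hφ.comp (contDiff_rotatingFrame c Ω)
      have hψs : HasCompactSupport (φ ∘ rotatingFrame c Ω) :=
        hφs.comp_homeomorph (rotatingFrame c Ω)
      obtain ⟨e1, -⟩ := integral_Ioi_mul_fderiv_time hi (hψ.of_le h1le) hψs
      have e3 : ∀ t, ∫ y, w y * fderiv ℝ (fun y => (φ ∘ rotatingFrame c Ω) (t, y)) y
          (relativeVelocity w c Ω y) = 0 := fun t =>
        h _ (hψ.comp (contDiff_const.prodMk contDiff_id)) (hasCompactSupport_slice hψs t)
      simp only [integral_rotated_mul_fderiv w c Ω (hφ.differentiable (by simp)),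
        integral_mul_fderiv_split hi hv c Ω (hψ.of_le h1le) hψs, e3, add_zero]
      rw [e1]
      simp only [hzero]
      ring

end Weak

/-! ### Weakly tangent vector fields -/

/-- The weak form of the two conditions `div u = 0` in `D` and `u · n = 0` on the boundary of `D`. -/
def WeaklyTangent (D : Set ℂ) (u : ℂ → ℂ) : Prop :=
  ∀ χ : ℂ → ℝ, ContDiff ℝ ((⊤ : ℕ∞) : WithTop ℕ∞) χ → HasCompactSupport χ →
    ∫ z in D, fderiv ℝ χ z (u z) = 0

lemma exists_smooth_cutoff {K U : Set ℂ} (hK : IsCompact K) (hU : IsOpen U) (hKU : K ⊆ U) :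
    ∃ ρ : ℂ → ℝ, ContDiff ℝ ((⊤ : ℕ∞) : WithTop ℕ∞) ρ ∧ HasCompactSupport ρ ∧ tsupport ρ ⊆ U ∧
      ∀ᶠ z in 𝓝ˢ K, ρ z = 1 := by
  obtain ⟨T, hT, hKT, hTU⟩ := exists_compact_between hK hU hKU
  obtain ⟨ρ, h1, h0, -⟩ := exists_contMDiffMap_one_nhds_of_subset_interior (n := ⊤)
    (modelWithCornersSelf ℝ ℂ) hK.isClosed hKT
  have hs : tsupport ρ ⊆ T := by
    refine closure_minimal (fun z hz => ?_) hT.isClosed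
    by_contra hzT
    exact hz (h0 z hzT)
  exact ⟨ρ, ρ.contMDiff.contDiff, HasCompactSupport.of_support_subset_isCompact hT
    ((subset_tsupport _).trans hs), hs.trans hTU, h1⟩

lemma contDiff_smul_of_tsupport_subset {F : Type*} [NormedAddCommGroup F] [NormedSpace ℝ F]
    {n : WithTop ℕ∞} {ρ : ℂ → ℝ} {g : ℂ → F} {U : Set ℂ} (hρ : ContDiff ℝ n ρ)
    (hs : tsupport ρ ⊆ U) (hg : ∀ z ∈ U, ContDiffAt ℝ n g z) :
    ContDiff ℝ n fun z => ρ z • g z := by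
  rw [contDiff_iff_contDiffAt]
  intro z
  by_cases hz : z ∈ tsupport ρ
  · exact hρ.contDiffAt.smul (hg z (hs hz))
  · refine (contDiffAt_const (c := (0 : F))).congr_of_eventuallyEq ?_
    filter_upwards [notMem_tsupport_iff_eventuallyEq.1 hz] with y hy
    simp [hy]

lemma hasCompactSupport_fderiv_apply {χ : ℂ → ℝ} (hs : HasCompactSupport χ) (u : ℂ → ℂ) :
    HasCompactSupport fun z => fderiv ℝ χ z (u z) := by
  refine (hs.fderiv ℝ).mono fun z hz h0 => hz ?_
  simp [h0]

lemma integrable_fderiv_apply {χ : ℂ → ℝ} (hχ : ContDiff ℝ 1 χ) (hs : HasCompactSupport χ)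
    {u : ℂ → ℂ} (hu : Continuous u) : Integrable fun z => fderiv ℝ χ z (u z) :=
  ((hχ.continuous_fderiv one_ne_zero).clm_apply hu).integrable_of_hasCompactSupport
    (hasCompactSupport_fderiv_apply hs u)

lemma one_le_smooth : (1 : WithTop ℕ∞) ≤ ((⊤ : ℕ∞) : WithTop ℕ∞) := by
  exact_mod_cast (le_top : (1 : ℕ∞) ≤ ⊤)

lemma WeaklyTangent.congr {D : Set ℂ} {u v : ℂ → ℂ} (h : WeaklyTangent D u) (hD : MeasurableSet D)
    (huv : EqOn u v D) : WeaklyTangent D v := by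
  intro χ hχ hs
  rw [← h χ hχ hs]
  exact setIntegral_congr_fun hD fun z hz => by rw [huv hz]

lemma WeaklyTangent.add {D : Set ℂ} {u v : ℂ → ℂ} (hu : WeaklyTangent D u)
    (hv : WeaklyTangent D v) (huc : Continuous u) (hvc : Continuous v) :
    WeaklyTangent D fun z => u z + v z := by
  intro χ hχ hs
  simp only [map_add]
  rw [integral_add (integrable_fderiv_apply (hχ.of_le one_le_smooth) hs huc).integrableOn
    (integrable_fderiv_apply (hχ.of_le one_le_smooth) hs hvc).integrableOn, hu χ hχ hs, hv χ hχ hs,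
    add_zero]

lemma WeaklyTangent.smul {D : Set ℂ} {u : ℂ → ℂ} (hu : WeaklyTangent D u) (r : ℝ) :
    WeaklyTangent D fun z => r * u z := by
  intro χ hχ hs
  have : ∀ z, fderiv ℝ χ z (r * u z) = r * fderiv ℝ χ z (u z) := fun z => by
    rw [← real_smul, map_smul, smul_eq_mul]
  simp only [this]
  rw [integral_const_mul, hu χ hχ hs, mul_zero]

lemma WeaklyTangent.sub {D : Set ℂ} {u v : ℂ → ℂ} (hu : WeaklyTangent D u)
    (hv : WeaklyTangent D v) (huc : Continuous u) (hvc : Continuous v) :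
    WeaklyTangent D fun z => u z - v z := by
  have := hu.add (hv.smul (-1)) huc (continuous_const.mul hvc)
  simpa [sub_eq_add_neg] using this

/-- For a divergence-free velocity and vorticity of patch type, being stationary splits into one
tangency condition for each patch: test functions may be localized near the inner patch. -/
lemma forall_integral_patchVorticity_eq_zero_iff {D₁ D₂ : Set ℂ} (hD₁ : IsOpen D₁)
    (hb₁ : Bornology.IsBounded D₁) (hD₂ : IsOpen D₂) (hsub : closure D₂ ⊆ D₁) {α : ℝ} (hα : α ≠ 1)
    {u : ℂ → ℂ} (hu : Continuous u) (hdiv : WeaklyTangent univ u) :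
    (∀ χ : ℂ → ℝ, ContDiff ℝ ((⊤ : ℕ∞) : WithTop ℕ∞) χ → HasCompactSupport χ →
      ∫ z, patchVorticity D₁ D₂ α z * fderiv ℝ χ z (u z) = 0) ↔
      WeaklyTangent D₁ u ∧ WeaklyTangent D₂ u := by
  have key : ∀ χ : ℂ → ℝ, ContDiff ℝ ((⊤ : ℕ∞) : WithTop ℕ∞) χ → HasCompactSupport χ →
      ∫ z, patchVorticity D₁ D₂ α z * fderiv ℝ χ z (u z) =
        (∫ z in D₁, fderiv ℝ χ z (u z)) + (α - 1) * ∫ z in D₂, fderiv ℝ χ z (u z) := by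
    intro χ hχ hs
    have hi := integrable_fderiv_apply (hχ.of_le one_le_smooth) hs hu
    rw [← integral_indicator hD₁.measurableSet, ← integral_indicator hD₂.measurableSet,
      ← integral_const_mul, ← integral_add (hi.indicator hD₁.measurableSet)
        ((hi.indicator hD₂.measurableSet).const_mul _)]
    congr 1 with z
    by_cases h1 : z ∈ D₁ <;> by_cases h2 : z ∈ D₂ <;> simp [patchVorticity, h1, h2]
    ring
  constructor
  · intro h
    have h2 : WeaklyTangent D₂ u := by
      intro χ hχ hs
      obtain ⟨ρ, hρ, hρs, hρU, hρ1⟩ := exists_smooth_cutoff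
        ((hb₁.subset (subset_closure.trans hsub)).isCompact_closure) hD₁ hsub
      have hψ : ContDiff ℝ ((⊤ : ℕ∞) : WithTop ℕ∞) (fun z => ρ z * χ z) := hρ.mul hχ
      have hψs : HasCompactSupport fun z => ρ z * χ z := hρs.mul_right
      have e1 : ∫ z in D₁, fderiv ℝ (fun z => ρ z * χ z) z (u z) = 0 := by
        rw [setIntegral_eq_integral_of_forall_compl_eq_zero]
        · simpa using hdiv _ hψ hψs
        · intro z hz
          have : z ∉ tsupport fun z => ρ z * χ z := fun hz' =>
            hz (hρU (closure_mono (Function.support_mul_subset_left ρ χ) hz'))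
          rw [(notMem_tsupport_iff_eventuallyEq.1 this).fderiv_eq]
          simp
      have e2 : ∫ z in D₂, fderiv ℝ (fun z => ρ z * χ z) z (u z) =
          ∫ z in D₂, fderiv ℝ χ z (u z) := by
        refine setIntegral_congr_fun hD₂.measurableSet fun z hz => ?_
        have : (fun z => ρ z * χ z) =ᶠ[𝓝 z] χ := by
          filter_upwards [hρ1.filter_mono (nhds_le_nhdsSet (subset_closure hz))] with y hy
          simp [hy]
        simp only [this.fderiv_eq]
      have e3 := key _ hψ hψs
      rw [h _ hψ hψs, e1, e2, zero_add] at e3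
      exact (mul_eq_zero.1 e3.symm).resolve_left (sub_ne_zero.2 hα)
    refine ⟨fun χ hχ hs => ?_, h2⟩
    have e := key χ hχ hs
    rw [h χ hχ hs, h2 χ hχ hs, mul_zero, add_zero] at e
    exact e.symm
  · rintro ⟨h1, h2⟩ χ hχ hs
    rw [key χ hχ hs, h1 χ hχ hs, h2 χ hχ hs, mul_zero, add_zero]

/-- The function `H` such that `i / 2 * conj H` is the velocity of the patches in the frame rotating
around `c` (`relativeVelocity_patchVorticity`). -/
def conjVelocity (D₁ D₂ : Set ℂ) (α : ℝ) (c : ℂ) (Ω : ℝ) (z : ℂ) : ℂ :=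
  cauchyTransform D₁ z + (α - 1) * cauchyTransform D₂ z - 2 * Ω * conj (z - c)

lemma abs_patchVorticity_le (D₁ D₂ : Set ℂ) (α : ℝ) (z : ℂ) :
    |patchVorticity D₁ D₂ α z| ≤ 1 + |α - 1| := by
  have h0 := abs_nonneg (α - 1)
  have h1 : |D₁.indicator (fun _ => (1 : ℝ)) z| ≤ 1 := by
    by_cases h : z ∈ D₁ <;> simp [h]
  have h2 : |(α - 1) * D₂.indicator (fun _ => (1 : ℝ)) z| ≤ |α - 1| := by
    by_cases h : z ∈ D₂ <;> simp [h]
  exact (abs_add_le _ _).trans (add_le_add h1 h2)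

section

variable {D₁ D₂ : Set ℂ}

lemma measurable_patchVorticity (hm₁ : MeasurableSet D₁) (hm₂ : MeasurableSet D₂) (α : ℝ) :
    Measurable (patchVorticity D₁ D₂ α) :=
  (measurable_const.indicator hm₁).add (measurable_const.mul (measurable_const.indicator hm₂))

lemma integrable_patchVorticity (hm₁ : MeasurableSet D₁) (hb₁ : Bornology.IsBounded D₁)
    (hm₂ : MeasurableSet D₂) (hb₂ : Bornology.IsBounded D₂) (α : ℝ) :
    Integrable (patchVorticity D₁ D₂ α) := by
  refine Integrable.add ?_ (Integrable.const_mul ?_ _)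
  · exact (integrable_indicator_iff hm₁).2 (integrableOn_const hb₁.measure_lt_top.ne)
  · exact (integrable_indicator_iff hm₂).2 (integrableOn_const hb₂.measure_lt_top.ne)

lemma relativeVelocity_patchVorticity (hm₁ : MeasurableSet D₁) (hm₂ : MeasurableSet D₂)
    (hb₁ : Bornology.IsBounded D₁) (hb₂ : Bornology.IsBounded D₂) (α : ℝ) (c : ℂ) (Ω : ℝ) (z : ℂ) :
    relativeVelocity (patchVorticity D₁ D₂ α) c Ω z =
      I / 2 * conj (conjVelocity D₁ D₂ α c Ω z) := by
  rw [relativeVelocity, biotSavart_patchVorticity hm₁ hm₂ hb₁ hb₂, conjVelocity]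
  simp only [map_sub, map_add, map_mul, conj_conj, conj_ofReal, map_ofNat]
  ring

lemma weaklyTangent_univ_conjVelocity (hm₁ : MeasurableSet D₁) (hm₂ : MeasurableSet D₂)
    (hb₁ : Bornology.IsBounded D₁) (hb₂ : Bornology.IsBounded D₂)
    (hf₁ : volume (frontier D₁) = 0) (hf₂ : volume (frontier D₂) = 0) (α : ℝ) (c : ℂ) (Ω : ℝ) :
    WeaklyTangent univ fun z => I / 2 * conj (conjVelocity D₁ D₂ α c Ω z) := by
  have hc₁ := continuous_cauchyTransform hm₁ hb₁ hf₁
  have hc₂ := continuous_cauchyTransform hm₂ hb₂ hf₂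
  have t1 : WeaklyTangent univ fun z => I / 2 * conj (cauchyTransform D₁ z) := fun χ hχ hs => by
    rw [setIntegral_univ, integral_fderiv_velocity hm₁ hb₁ (hχ.of_le one_le_smooth) hs]
  have t2 : WeaklyTangent univ fun z => I / 2 * conj (cauchyTransform D₂ z) := fun χ hχ hs => by
    rw [setIntegral_univ, integral_fderiv_velocity hm₂ hb₂ (hχ.of_le one_le_smooth) hs]
  have t3 : WeaklyTangent univ fun z => I * (z - c) := fun χ hχ hs => by
    rw [setIntegral_univ, integral_fderiv_rotation (hχ.of_le one_le_smooth)]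
  have t4 := (t1.add (t2.smul (α - 1)) (by fun_prop) (by fun_prop)).sub (t3.smul Ω)
    (by fun_prop) (by fun_prop)
  refine t4.congr MeasurableSet.univ fun z _ => ?_
  simp only [conjVelocity, map_sub, map_add, map_mul, conj_conj, conj_ofReal, map_ofNat, map_one,
    ofReal_sub, ofReal_one]
  ring

lemma continuous_conjVelocity (hm₁ : MeasurableSet D₁) (hm₂ : MeasurableSet D₂)
    (hb₁ : Bornology.IsBounded D₁) (hb₂ : Bornology.IsBounded D₂)
    (hf₁ : volume (frontier D₁) = 0) (hf₂ : volume (frontier D₂) = 0) (α : ℝ) (c : ℂ) (Ω : ℝ) :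
    Continuous (conjVelocity D₁ D₂ α c Ω) := by
  have hc₁ := continuous_cauchyTransform hm₁ hb₁ hf₁
  have hc₂ := continuous_cauchyTransform hm₂ hb₂ hf₂
  unfold conjVelocity
  fun_prop

/-- Rotation of a patch inside another one means that the velocity in the rotating frame is tangent
to both boundaries. -/
lemma rotatesAbout_patchVorticity_iff (hD₁ : IsOpen D₁) (hb₁ : Bornology.IsBounded D₁)
    (hf₁ : volume (frontier D₁) = 0) (hD₂ : IsOpen D₂) (hf₂ : volume (frontier D₂) = 0)
    (hsub : closure D₂ ⊆ D₁) {α : ℝ} (hα : α ≠ 1) (c : ℂ) (Ω : ℝ) :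
    RotatesAbout (patchVorticity D₁ D₂ α) c Ω ↔
      WeaklyTangent D₁ (fun z => I / 2 * conj (conjVelocity D₁ D₂ α c Ω z)) ∧
        WeaklyTangent D₂ (fun z => I / 2 * conj (conjVelocity D₁ D₂ α c Ω z)) := by
  have hm₁ := hD₁.measurableSet
  have hm₂ := hD₂.measurableSet
  have hb₂ := hb₁.subset (subset_closure.trans hsub)
  have hv : Continuous (biotSavart (patchVorticity D₁ D₂ α)) := by
    have hc₁ := continuous_cauchyTransform hm₁ hb₁ hf₁
    have hc₂ := continuous_cauchyTransform hm₂ hb₂ hf₂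
    rw [funext (biotSavart_patchVorticity hm₁ hm₂ hb₁ hb₂ α)]
    fun_prop
  rw [rotatesAbout_iff (measurable_patchVorticity hm₁ hm₂ α)
    (integrable_patchVorticity hm₁ hb₁ hm₂ hb₂ α) (abs_patchVorticity_le D₁ D₂ α) hv]
  simp only [relativeVelocity_patchVorticity hm₁ hm₂ hb₁ hb₂]
  have hcont := continuous_conjVelocity hm₁ hm₂ hb₁ hb₂ hf₁ hf₂ α c Ω
  exact forall_integral_patchVorticity_eq_zero_iff hD₁ hb₁ hD₂ hsub hα (by fun_prop)
    (weaklyTangent_univ_conjVelocity hm₁ hm₂ hb₁ hb₂ hf₁ hf₂ α c Ω)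

end

/-- Linear fields which rotate along the ellipses homothetic to a given one. -/
lemma weaklyTangent_solidEllipse (p : ℂ) (R : ℝ) {κ : ℂ} (hκ : ‖κ‖ < 1) (β : ℝ) :
    WeaklyTangent (solidEllipse p R κ) fun z =>
      I / 2 * conj (β * (conj (z - p) - 2 * conj κ / (1 + ‖κ‖ ^ 2) * (z - p))) := by
  have h1 : WeaklyTangent (solidEllipse p R κ) fun z => ellipseMap κ (I * ellipseInv κ (z - p)) :=
    fun χ hχ _ => setIntegral_fderiv_ellipse_rotation (hχ.of_le one_le_smooth) p R hκ
  have hm : MeasurableSet (solidEllipse p R κ) := (isOpen_solidEllipse p R κ).measurableSet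
  refine (h1.smul (β / 2 * ((1 - ‖κ‖ ^ 2) / (1 + ‖κ‖ ^ 2)))).congr hm fun z _ => ?_
  have h2 : (1 - ‖κ‖ ^ 2 : ℂ) ≠ 0 := by exact_mod_cast one_sub_norm_sq_ne_zero hκ
  have h3 : (1 + ‖κ‖ ^ 2 : ℂ) ≠ 0 := by
    exact_mod_cast (by positivity : (1 + ‖κ‖ ^ 2 : ℝ) ≠ 0)
  have h4 : κ * conj κ = ‖κ‖ ^ 2 := by rw [Complex.mul_conj']
  simp only [ellipseMap_apply, ellipseInv_apply, map_mul, map_sub, map_div₀, map_inv₀, map_add, conj_ofReal,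
    conj_conj, conj_I, map_ofNat, map_one, map_pow, ofReal_mul, ofReal_div, ofReal_sub, ofReal_add,
    ofReal_one, ofReal_pow, ofReal_inv, ofReal_ofNat]
  field_simp
  linear_combination (β * (z - p)) * h4

/-! ### Tangency on the inner patch -/

lemma contDiffAt_real_of_differentiableOn {F : ℂ → ℂ} {V : Set ℂ} (hV : IsOpen V)
    (hF : DifferentiableOn ℂ F V) {z : ℂ} (hz : z ∈ V) (n : WithTop ℕ∞) : ContDiffAt ℝ n F z :=
  ((hF.analyticAt (hV.mem_nhds hz)).contDiffAt (n := n)).restrict_scalars ℝ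

/-- If `h` is holomorphic near the closure of a bounded convex domain `D` and `i / 2 * conj h` is
tangent to `D`, then `h = 0`. Indeed the field is half the gradient of the imaginary part of a
primitive of `h`; testing with this imaginary part gives `∫ |h|² = 0`. -/
lemma eq_zero_of_weaklyTangent_conj {D U : Set ℂ} (hD : IsOpen D) (hconv : Convex ℝ D)
    (hb : Bornology.IsBounded D) (hU : IsOpen U) (hDU : closure D ⊆ U) {h : ℂ → ℂ}
    (hh : DifferentiableOn ℂ h U) (ht : WeaklyTangent D fun z => I / 2 * conj (h z)) :
    ∀ z ∈ D, h z = 0 := by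
  have hK : IsCompact (closure D) := hb.isCompact_closure
  obtain ⟨δ, hδ, hδU⟩ := hK.exists_thickening_subset_open hU hDU
  set V := thickening δ (closure D) with hVdef
  have hV : IsOpen V := isOpen_thickening
  have hKV : closure D ⊆ V := self_subset_thickening hδ _
  obtain ⟨F, hF⟩ := (hconv.closure.thickening δ).exists_forall_hasDerivWithinAt (hh.mono hδU)
  replace hF : ∀ z ∈ V, HasDerivAt F (h z) z := fun z hz => (hF z hz).hasDerivAt (hV.mem_nhds hz)
  have hFd : DifferentiableOn ℂ F V := fun z hz => (hF z hz).differentiableAt.differentiableWithinAt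
  obtain ⟨ρ, hρ, hρs, hρV, hρ1⟩ := exists_smooth_cutoff hK hV hKV
  have hχ : ContDiff ℝ ((⊤ : ℕ∞) : WithTop ℕ∞) fun z => ρ z • (F z).im :=
    contDiff_smul_of_tsupport_subset hρ hρV fun z hz =>
      imCLM.contDiff.contDiffAt.comp z (contDiffAt_real_of_differentiableOn hV hFd hz _)
  have hχs : HasCompactSupport fun z => ρ z • (F z).im := hρs.smul_right
  have e := ht _ hχ hχs
  have e2 : ∫ z in D, ‖h z‖ ^ 2 = 0 := by
    rw [← mul_eq_zero_iff_left (a := (1 / 2 : ℝ)) (by norm_num), ← integral_const_mul, ← e]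
    refine setIntegral_congr_fun hD.measurableSet fun z hz => ?_
    have hzV : z ∈ V := hKV (subset_closure hz)
    have h1 : (fun z => ρ z • (F z).im) =ᶠ[𝓝 z] fun z => (F z).im := by
      filter_upwards [hρ1.filter_mono (nhds_le_nhdsSet (subset_closure hz))] with y hy
      simp [hy]
    have h2 : HasFDerivAt (fun z => (F z).im)
        (imCLM.comp ((ContinuousLinearMap.toSpanSingleton ℂ (h z)).restrictScalars ℝ)) z :=
      imCLM.hasFDerivAt.comp z ((hF z hzV).hasFDerivAt.restrictScalars ℝ)
    beta_reduce
    rw [h1.fderiv_eq, h2.fderiv]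
    simp only [ContinuousLinearMap.comp_apply,
      ContinuousLinearMap.coe_restrictScalars', ContinuousLinearMap.toSpanSingleton_apply,
      imCLM_apply, smul_eq_mul]
    rw [show I / 2 * conj (h z) * h z = ((‖h z‖ ^ 2 / 2 : ℝ) : ℂ) * I by
      rw [mul_assoc, mul_comm (conj _), Complex.mul_conj']; push_cast; ring]
    rw [im_ofReal_mul, I_im]; ring
  have hcont : ContinuousOn (fun z => ‖h z‖ ^ 2) (closure D) :=
    ((hh.mono hDU).continuousOn.norm.pow 2)
  have hint : IntegrableOn (fun z => ‖h z‖ ^ 2) D :=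
    (hcont.integrableOn_compact hK).mono_set subset_closure
  have hae := (setIntegral_eq_zero_iff_of_nonneg_ae
    (Eventually.of_forall fun z => by positivity) hint).1 e2
  have heq := Measure.eqOn_open_of_ae_eq hae hD (hcont.mono subset_closure) continuousOn_const
  intro z hz
  simpa using heq hz

lemma conjVelocity_eq_of_mem_solidEllipse {D₁ : Set ℂ} {p : ℂ} {R : ℝ} (hR : 0 < R) {κ : ℂ}
    (hκ : ‖κ‖ < 1) (α : ℝ) (c : ℂ) (Ω : ℝ) {z : ℂ} (hz : z ∈ solidEllipse p R κ) :
    conjVelocity D₁ (solidEllipse p R κ) α c Ω z =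
      cauchyTransform D₁ z - conj (z - p) - 2 * Ω * conj (p - c)
        + (2 * (α - 2 * Ω) / (1 + ‖κ‖ ^ 2) - (α - 1)) * conj κ * (z - p)
        + (α - 2 * Ω) * (conj (z - p) - 2 * conj κ / (1 + ‖κ‖ ^ 2) * (z - p)) := by
  rw [conjVelocity, cauchyTransform_solidEllipse hR hκ (mem_solidEllipse.1 hz).le]
  simp only [map_sub]
  ring

/-- Tangency to an inner ellipse determines the Cauchy transform of the outer domain: it is
affine up to the term `conj z`. -/
lemma cauchyTransform_eq_affine_of_weaklyTangent {D₁ : Set ℂ} (hD₁ : IsOpen D₁)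
    (hc₁ : IsPreconnected D₁) (hb₁ : Bornology.IsBounded D₁) (hf₁ : volume (frontier D₁) = 0)
    {p : ℂ} {R : ℝ} (hR : 0 < R)
    {κ : ℂ} (hκ : ‖κ‖ < 1) (hsub : closure (solidEllipse p R κ) ⊆ D₁) {α : ℝ} {c : ℂ} {Ω : ℝ}
    (ht : WeaklyTangent (solidEllipse p R κ) fun z =>
      I / 2 * conj (conjVelocity D₁ (solidEllipse p R κ) α c Ω z)) :
    ∀ z ∈ D₁, cauchyTransform D₁ z = conj (z - p) + 2 * Ω * conj (p - c)
        - (2 * (α - 2 * Ω) / (1 + ‖κ‖ ^ 2) - (α - 1)) * conj κ * (z - p) := by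
  set E := solidEllipse p R κ with hE
  have hEo : IsOpen E := isOpen_solidEllipse p R κ
  have hEb : Bornology.IsBounded E := isBounded_solidEllipse p R hκ
  set h : ℂ → ℂ := fun z => cauchyTransform D₁ z - conj (z - p) - 2 * Ω * conj (p - c)
        + (2 * (α - 2 * Ω) / (1 + ‖κ‖ ^ 2) - (α - 1)) * conj κ * (z - p) with hh
  have hd : DifferentiableOn ℂ h D₁ := by
    intro z hz
    have h1 := differentiableAt_cauchyTransform_sub_conj hD₁ hb₁ hz
    have h2 : h = fun z => (cauchyTransform D₁ z - conj z) + conj p - 2 * Ω * conj (p - c)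
        + (2 * (α - 2 * Ω) / (1 + ‖κ‖ ^ 2) - (α - 1)) * conj κ * (z - p) := by
      funext z
      simp only [hh, map_sub]
      ring
    rw [h2]
    exact (((h1.add_const _).sub_const _).add (by fun_prop)).differentiableWithinAt
  have hcH := continuous_conjVelocity hD₁.measurableSet hEo.measurableSet hb₁ hEb hf₁
    (volume_frontier_solidEllipse p R κ) α c Ω
  have h0 : ∀ z ∈ E, h z = 0 := by
    refine eq_zero_of_weaklyTangent_conj hEo (convex_solidEllipse p R κ) hEb hD₁ hsub hd ?_
    refine (ht.sub (weaklyTangent_solidEllipse p R hκ (α - 2 * Ω)) (by fun_prop)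
      (by fun_prop)).congr hEo.measurableSet fun z hz => ?_
    beta_reduce
    rw [conjVelocity_eq_of_mem_solidEllipse hR hκ α c Ω hz, ← mul_sub, ← map_sub]
    congr 2
    simp only [hh]
    push_cast
    ring
  have hp : p ∈ E := by rw [mem_solidEllipse]; simpa using hR
  have hp1 : p ∈ D₁ := hsub (subset_closure hp)
  have h1 : EqOn h 0 D₁ := (hd.analyticOnNhd hD₁).eqOn_zero_of_preconnected_of_eventuallyEq_zero
    hc₁ hp1 (by filter_upwards [hEo.mem_nhds hp] with z hz using h0 z hz)
  intro z hz
  have := h1 hz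
  simp only [hh, Pi.zero_apply] at this
  linear_combination this

/-! ### Tangency on the outer ellipse -/

/-- The trace of a weakly tangent field on the boundary of an ellipse: if the field is
`i / 2 * conj G` with `G` holomorphic near the boundary, its normal component vanishes there. -/
lemma im_eq_zero_of_weaklyTangent {p : ℂ} {R : ℝ} (hR : 0 < R) {κ : ℂ} (hκ : ‖κ‖ < 1) {V : Set ℂ}
    (hV : IsOpen V) (hEV : frontier (solidEllipse p R κ) ⊆ V) {G u : ℂ → ℂ}
    (hG : DifferentiableOn ℂ G V)
    (hu : ∀ z ∈ solidEllipse p R κ, z ∈ V → u z = I / 2 * conj (G z))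
    (ht : WeaklyTangent (solidEllipse p R κ) u) {w : ℂ} (hw : ‖w‖ = 1) :
    ((w - κ * conj w) * G (p + ellipseMap κ (R * w))).im = 0 := by
  set E := solidEllipse p R κ with hE
  have hEb : Bornology.IsBounded E := isBounded_solidEllipse p R hκ
  have hK : IsCompact (frontier E) :=
    hEb.isCompact_closure.of_isClosed_subset isClosed_frontier frontier_subset_closure
  obtain ⟨ρ, hρ, hρs, hρV, hρ1⟩ := exists_smooth_cutoff hK hV hEV
  have hGs : ∀ z ∈ V, ContDiffAt ℝ ((⊤ : ℕ∞) : WithTop ℕ∞) G z := fun z hz =>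
    contDiffAt_real_of_differentiableOn hV hG hz _
  -- the test function extends the normal component of the field
  set L : ℂ → ℂ := fun z => (R : ℂ)⁻¹ * (ellipseInv κ (z - p) - κ * conj (ellipseInv κ (z - p)))
    with hL
  have hLs : ContDiff ℝ ((⊤ : ℕ∞) : WithTop ℕ∞) L := by
    have h1 : ContDiff ℝ ((⊤ : ℕ∞) : WithTop ℕ∞) fun z => ellipseInv κ (z - p) :=
      (ellipseInv κ).contDiff.comp (contDiff_id.sub contDiff_const)
    have h2 : ContDiff ℝ ((⊤ : ℕ∞) : WithTop ℕ∞) fun z => conj (ellipseInv κ (z - p)) :=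
      conjCLE.contDiff.comp h1
    exact contDiff_const.mul (h1.sub (contDiff_const.mul h2))
  set χ : ℂ → ℝ := fun z => ρ z • (L z * G z).im with hχdef
  have hχ : ContDiff ℝ ((⊤ : ℕ∞) : WithTop ℕ∞) χ :=
    contDiff_smul_of_tsupport_subset hρ hρV fun z hz =>
      imCLM.contDiff.contDiffAt.comp z (hLs.contDiffAt.mul (hGs z hz))
  have hχs : HasCompactSupport χ := hρs.smul_right
  have hχV : tsupport χ ⊆ V := (closure_mono (Function.support_smul_subset_left _ _)).trans hρV
  set Y : ℂ → ℂ := fun z => χ z • G z with hYdef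
  have hY : ContDiff ℝ 1 Y :=
    (contDiff_smul_of_tsupport_subset hχ hχV hGs).of_le one_le_smooth
  have hdY : Continuous fun z => fderiv ℝ Y z 1 + I * fderiv ℝ Y z I :=
    (((hY.continuous_fderiv one_ne_zero).clm_apply continuous_const).add
      (continuous_const.mul ((hY.continuous_fderiv one_ne_zero).clm_apply continuous_const)))
  have hpt : ∀ z ∈ E, fderiv ℝ χ z (u z) =
      2⁻¹ * (fderiv ℝ Y z 1 + I * fderiv ℝ Y z I).im := by
    intro z hz
    by_cases hzχ : z ∈ tsupport χ
    · have hzV := hχV hzχ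
      have hGd : HasFDerivAt G
          ((ContinuousLinearMap.toSpanSingleton ℂ (deriv G z)).restrictScalars ℝ) z :=
        (hG.differentiableAt (hV.mem_nhds hzV)).hasDerivAt.hasFDerivAt.restrictScalars ℝ
      have hχd : HasFDerivAt χ (fderiv ℝ χ z) z :=
        (hχ.differentiable (by simp) z).hasFDerivAt
      have hYd := (hχd.smul hGd).fderiv
      rw [show (χ • G) = Y from rfl] at hYd
      rw [hYd, hu z hz hzV]
      have hlin : fderiv ℝ χ z (I / 2 * conj (G z)) =
          (G z).im / 2 * fderiv ℝ χ z 1 + (G z).re / 2 * fderiv ℝ χ z I := by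
        rw [← smul_eq_mul (a := (G z).im / 2), ← smul_eq_mul (a := (G z).re / 2), ← map_smul,
          ← map_smul, ← map_add]
        congr 1
        apply Complex.ext <;> simp <;> ring
      rw [hlin]
      simp
      ring
    · have h1 := notMem_tsupport_iff_eventuallyEq.1 hzχ
      have h2 : Y =ᶠ[𝓝 z] 0 := by
        filter_upwards [h1] with y hy
        simp [hYdef, hy]
      rw [h1.fderiv_eq, h2.fderiv_eq]
      simp
  have e1 := ht χ hχ hχs
  rw [setIntegral_congr_fun (isOpen_solidEllipse p R κ).measurableSet hpt, integral_const_mul] at e1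
  have hi : IntegrableOn (fun z => fderiv ℝ Y z 1 + I * fderiv ℝ Y z I) E :=
    (hdY.continuousOn.integrableOn_compact hEb.isCompact_closure).mono_set subset_closure
  have e2 : (∫ z in E, (fderiv ℝ Y z 1 + I * fderiv ℝ Y z I)).im = 0 := by
    have := imCLM.integral_comp_comm hi
    simp only [imCLM_apply] at this
    rw [← this]
    exact (mul_eq_zero.1 e1).resolve_left (by norm_num)
  rw [setIntegral_solidEllipse_dbar hY p hR hκ] at e2
  set z : ℝ → ℂ := fun θ => p + ellipseMap κ (circleMap 0 R θ) with hz
  have hcirc : ∀ θ, circleMap 0 R θ = R * circleMap 0 1 θ := fun θ => by simp [circleMap]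
  have hzf : ∀ θ, z θ ∈ frontier E := fun θ => by
    rw [hE, frontier_solidEllipse p hR hκ]
    simp only [hz, mem_ofPred_eq, add_sub_cancel_left, ellipseInv_ellipseMap hκ]
    simp [abs_of_pos hR]
  have hLz : ∀ θ, L (z θ) = circleMap 0 1 θ - κ * conj (circleMap 0 1 θ) := fun θ => by
    simp only [hL, hz, add_sub_cancel_left, ellipseInv_ellipseMap hκ, hcirc, map_mul, conj_ofReal]
    have : (R : ℂ) ≠ 0 := by exact_mod_cast hR.ne'
    field_simp
  have hcz : Continuous z := by
    have := continuous_circleMap 0 R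
    fun_prop
  set f : ℝ → ℝ := fun θ => (L (z θ) * G (z θ)).im with hf
  have hfc : Continuous f := by
    have h1 : Continuous fun θ => G (z θ) :=
      continuous_iff_continuousAt.2 fun θ =>
        ContinuousAt.comp (g := G) (hGs _ (hEV (hzf θ))).continuousAt hcz.continuousAt
    exact continuous_im.comp ((hLs.continuous.comp hcz).mul h1)
  have hint : ∀ θ, ((R : ℂ) * (circleMap 0 1 θ - κ * conj (circleMap 0 1 θ)) * Y (z θ)).im =
      R * f θ ^ 2 := by
    intro θ
    have h1 : ρ (z θ) = 1 := hρ1.self_of_nhdsSet _ (hzf θ)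
    rw [← hLz]
    have h2 : Y (z θ) = ((f θ : ℝ) : ℂ) * G (z θ) := by
      simp [hYdef, hχdef, h1, hf]
    rw [h2, show (R : ℂ) * L (z θ) * (f θ * G (z θ)) = ((R * f θ : ℝ) : ℂ) * (L (z θ) * G (z θ)) by
      push_cast; ring, im_ofReal_mul]
    simp only [hf]; ring
  have hYc : Continuous fun θ => (R : ℂ) * (circleMap 0 1 θ - κ * conj (circleMap 0 1 θ)) *
      Y (z θ) := by
    have h1 := continuous_circleMap 0 1
    have h2 := hY.continuous
    fun_prop
  have e3 : ∫ θ in -Real.pi..Real.pi, R * f θ ^ 2 = 0 := by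
    rw [← e2, ← imCLM_apply, ← ContinuousLinearMap.intervalIntegral_comp_comm _
      (hYc.intervalIntegrable _ _)]
    simp only [imCLM_apply, hz] at hint ⊢
    simp only [hint]
  have hwθ : circleMap 0 1 (arg w) = w := by
    simpa [circleMap, hw] using norm_mul_exp_arg_mul_I w
  by_contra hne
  have hpos := intervalIntegral.integral_pos (f := fun θ => R * f θ ^ 2)
    (by linarith [Real.pi_pos] : -Real.pi < Real.pi) (by fun_prop) (fun θ _ => by positivity)
    ⟨arg w, ⟨(neg_pi_lt_arg w).le, arg_le_pi w⟩, by
      have h1 : f (arg w) = ((w - κ * conj w) * G (p + ellipseMap κ (R * w))).im := by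
        simp only [hf]
        rw [hLz, hwθ]
        simp only [hz, hcirc, hwθ]
      rw [h1]
      positivity⟩
  exact hpos.ne' e3

/-- A holomorphic function on the disc with real boundary values is constant. -/
lemma exists_eq_ofReal_of_im_eq_zero_on_sphere {W : ℂ → ℂ} (hW : DiffContOnCl ℂ W (ball 0 1))
    (h : ∀ η, ‖η‖ = 1 → (W η).im = 0) : ∃ r : ℝ, ∀ η, ‖η‖ ≤ 1 → W η = r := by
  -- the maximum principle for `exp (± i W)`
  have hle : ∀ s : ℝ, ∀ η ∈ closedBall (0 : ℂ) 1, s * (W η).im ≤ 0 := by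
    intro s η hη
    have h1 : DiffContOnCl ℂ (fun η => Complex.exp (-(s * I * W η))) (ball 0 1) :=
      differentiable_exp.comp_diffContOnCl (hW.const_smul (s * I)).neg
    have h2 : ∀ z, ‖Complex.exp (-(s * I * W z))‖ = Real.exp (s * (W z).im) := fun z => by
      rw [Complex.norm_exp]; simp
    have h3 := norm_le_of_forall_mem_frontier_norm_le (C := 1) isBounded_ball h1
      (fun z hz => by
        rw [frontier_ball _ one_ne_zero, mem_sphere_zero_iff_norm] at hz
        rw [h2, h z hz]; simp) (by rwa [closure_ball _ one_ne_zero])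
    rw [h2] at h3
    simpa using h3
  have him : ∀ η ∈ closedBall (0 : ℂ) 1, (W η).im = 0 := fun η hη =>
    le_antisymm (by simpa using hle 1 η hη) (by simpa using hle (-1) η hη)
  have hconst : ∃ w, ∀ z ∈ ball (0 : ℂ) 1, W z = w := by
    refine ((hW.differentiableOn.analyticOnNhd isOpen_ball).is_constant_or_isOpen
      (convex_ball 0 1).isPreconnected).resolve_right fun hopen => ?_
    -- an open subset of the real line of `ℂ` is empty
    have h1 := (hopen _ subset_rfl isOpen_ball).mem_nhds (mem_image_of_mem W (mem_ball_self one_pos))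
    obtain ⟨ε, hε, hsub⟩ := Metric.mem_nhds_iff.1 h1
    obtain ⟨z, hz, hzW⟩ := hsub (show W 0 + (ε / 2 : ℝ) * I ∈ ball (W 0) ε by
      simp [abs_of_pos hε, hε])
    have h2 := him z (ball_subset_closedBall hz)
    rw [hzW] at h2
    simp [him 0 (by simp)] at h2
    exact hε.ne' h2
  obtain ⟨w, hw⟩ := hconst
  have h0 : W 0 = w := hw 0 (mem_ball_self one_pos)
  refine ⟨w.re, fun η hη => ?_⟩
  have hcl : EqOn W (fun _ => w) (closure (ball 0 1)) := by
    refine EqOn.of_subset_closure (t := closure (ball 0 1)) (fun z hz => hw z hz) hW.continuousOn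
      continuousOn_const subset_closure subset_rfl
  rw [hcl (by rw [closure_ball _ one_ne_zero]; simpa using hη)]
  apply Complex.ext
  · simp
  · rw [← h0, him 0 (by simp)]; simp

/-- The normal component of the velocity on the outer ellipse, in terms of the exterior conformal
map: its vanishing determines the exterior Cauchy transform of the inner patch. -/
lemma exists_exteriorCauchy_eq_of_weaklyTangent {p₁ p : ℂ} {R₁ R : ℝ} (hR₁ : 0 < R₁)
    {κ₁ κ : ℂ} (hκ₁ : ‖κ₁‖ < 1) (hκ : ‖κ‖ < 1)
    (hsub : closure (solidEllipse p R κ) ⊆ solidEllipse p₁ R₁ κ₁) {α : ℝ} {c : ℂ} {Ω : ℝ}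
    (ht : WeaklyTangent (solidEllipse p₁ R₁ κ₁) fun z =>
      I / 2 * conj (conjVelocity (solidEllipse p₁ R₁ κ₁) (solidEllipse p R κ) α c Ω z)) :
    ∃ c₀ : ℝ, ∀ η, ‖η‖ ≤ 1 →
      (α - 1) * (1 - κ₁ * η ^ 2) * exteriorCauchy (solidEllipse p R κ) p₁ R₁ κ₁ η =
        η * (c₀ - 2 * Ω * (p₁ - c + conj (p₁ - c) * κ₁) * η
          + R₁ * κ₁ * (1 - 4 * Ω - ‖κ₁‖ ^ 2) * η ^ 2) := by
  set E := solidEllipse p R κ with hE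
  set E₁ := solidEllipse p₁ R₁ κ₁ with hE₁
  have hEo : IsOpen E := isOpen_solidEllipse p R κ
  have hE₁o : IsOpen E₁ := isOpen_solidEllipse p₁ R₁ κ₁
  have hEb : Bornology.IsBounded E := isBounded_solidEllipse p R hκ
  have hE₁b : Bornology.IsBounded E₁ := isBounded_solidEllipse p₁ R₁ hκ₁
  have hEf := volume_frontier_solidEllipse p R κ
  have hsq : (1 + ‖κ₁‖ ^ 2 : ℂ) ≠ 0 := by
    exact_mod_cast (by positivity : (1 + ‖κ₁‖ ^ 2 : ℝ) ≠ 0)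
  have hcc : κ₁ * conj κ₁ = ‖κ₁‖ ^ 2 := Complex.mul_conj' κ₁
  set n : ℂ := 2 * (1 - 2 * Ω) / (1 + ‖κ₁‖ ^ 2) - 1 with hn
  have hconjn : conj n = n := by
    simp only [hn, map_sub, map_div₀, map_mul, map_add, map_one, map_pow, conj_ofReal, map_ofNat]
  set b : ℂ := -2 * Ω * conj (p₁ - c) with hb
  set G : ℂ → ℂ := fun z => (α - 1) * cauchyTransform E z + n * conj κ₁ * (z - p₁) + b with hG
  -- remove a tangential linear field, which leaves a field with holomorphic conjugate
  have hcH := continuous_conjVelocity hE₁o.measurableSet hEo.measurableSet hE₁b hEb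
    (volume_frontier_solidEllipse p₁ R₁ κ₁) hEf α c Ω
  have ht' := ht.sub (weaklyTangent_solidEllipse p₁ R₁ hκ₁ (1 - 2 * Ω)) (by fun_prop)
      (by fun_prop)
  have htr : ∀ w : ℂ, ‖w‖ = 1 →
      ((w - κ₁ * conj w) * G (p₁ + ellipseMap κ₁ (R₁ * w))).im = 0 := by
    intro w hw
    refine im_eq_zero_of_weaklyTangent hR₁ hκ₁ (V := (closure E)ᶜ) isClosed_closure.isOpen_compl
      ?_ ?_ ?_ ht' hw
    · intro z hz hzE
      rw [hE₁o.frontier_eq] at hz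
      exact hz.2 (hsub hzE)
    · intro z hz
      exact (((differentiableAt_cauchyTransform hEo.measurableSet hEb hz).const_mul _).add
        (by fun_prop)).add_const _ |>.differentiableWithinAt
    · intro z hz _
      rw [← mul_sub, ← map_sub, conjVelocity,
        cauchyTransform_solidEllipse hR₁ hκ₁ (mem_solidEllipse.1 hz).le]
      congr 2
      simp only [hG, hn, hb, map_sub]
      push_cast
      ring
  set P := exteriorCauchy E p₁ R₁ κ₁ with hP
  have hPd : DiffContOnCl ℂ P (ball 0 1) :=
    diffContOnCl_exteriorCauchy hEo.measurableSet hEb hEf hR₁ hκ₁ (subset_closure.trans hsub)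
  have hball : ball (0 : ℂ) 1 ∈ 𝓝 0 := ball_mem_nhds _ one_pos
  set S := dslope P 0 with hS
  have hSP : ∀ η, P η = η * S η := fun η => by
    have := sub_smul_dslope P 0 η
    simp only [sub_zero, smul_eq_mul, hP, exteriorCauchy_zero] at this
    exact this.symm
  have hSd : DiffContOnCl ℂ S (ball 0 1) := by
    refine ⟨(differentiableOn_dslope hball).2 hPd.differentiableOn, ?_⟩
    exact (continuousOn_dslope (mem_of_superset hball subset_closure)).2
      ⟨hPd.continuousOn, hPd.differentiableOn.differentiableAt hball⟩
  -- reflecting the negative powers of `η` on the circle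
  set W : ℂ → ℂ := fun η => (α - 1) * (1 - κ₁ * η ^ 2) * S η
    - R₁ * κ₁ * (1 - 4 * Ω - ‖κ₁‖ ^ 2) * η ^ 2 - (conj b + b * κ₁) * η with hW
  have hWd : DiffContOnCl ℂ W (ball 0 1) := by
    have h1 : DiffContOnCl ℂ (fun η : ℂ => (α - 1) * (1 - κ₁ * η ^ 2)) (ball 0 1) :=
      Differentiable.diffContOnCl (by fun_prop)
    have h2 : DiffContOnCl ℂ (fun η : ℂ => R₁ * κ₁ * (1 - 4 * Ω - ‖κ₁‖ ^ 2) * η ^ 2) (ball 0 1) :=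
      Differentiable.diffContOnCl (by fun_prop)
    have h3 : DiffContOnCl ℂ (fun η : ℂ => (conj b + b * κ₁) * η) (ball 0 1) :=
      Differentiable.diffContOnCl (by fun_prop)
    exact ((h1.smul hSd).sub h2).sub h3
  obtain ⟨c₀, hc₀⟩ := exists_eq_ofReal_of_im_eq_zero_on_sphere hWd fun η hη => by
    have h0 : η ≠ 0 := fun h => by simp [h] at hη
    have hηc : conj η = η⁻¹ := by rw [Complex.inv_def, normSq_eq_norm_sq, hη]; simp
    have e := htr η⁻¹ (by simp [hη])
    have hPη : P η = cauchyTransform E (p₁ + R₁ * (η⁻¹ + κ₁ * η)) := exteriorCauchy_of_ne h0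
    have harg : p₁ + ellipseMap κ₁ (R₁ * η⁻¹) = p₁ + R₁ * (η⁻¹ + κ₁ * η) := by
      simp only [ellipseMap_apply, map_mul, conj_ofReal, map_inv₀, hηc, inv_inv]; ring
    rw [harg] at e
    simp only [hG, ← hPη, hSP, map_inv₀, hηc, inv_inv, add_sub_cancel_left] at e
    set X : ℂ := R₁ * n * conj κ₁ * η⁻¹ ^ 2 + b * η⁻¹ with hX
    have hXc : conj X = R₁ * n * κ₁ * η ^ 2 + conj b * η := by
      simp only [hX, map_add, map_mul, map_pow, map_inv₀, hηc, inv_inv, conj_ofReal, hconjn,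
        conj_conj]
    have hsum : (η⁻¹ - κ₁ * η) * ((α - 1) * (η * S η) + n * conj κ₁ * (R₁ * (η⁻¹ + κ₁ * η)) + b) =
        W η + (X + conj X) := by
      rw [hXc]
      simp only [hX, hW]
      have hn' : n * (1 + ‖κ₁‖ ^ 2) = 1 - 4 * Ω - ‖κ₁‖ ^ 2 := by
        simp only [hn]; field_simp; ring
      rw [← hn', ← hcc]
      field_simp
      ring
    rw [hsum, add_im, Complex.add_conj] at e
    simpa using e
  refine ⟨c₀, fun η hη => ?_⟩
  have e := hc₀ η hη
  simp only [hW] at e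
  have hbb : conj b + b * κ₁ = -(2 * Ω * (p₁ - c + conj (p₁ - c) * κ₁)) := by
    simp only [hb, map_mul, map_neg, conj_ofReal, conj_conj, map_ofNat]; ring
  rw [hbb] at e
  rw [hSP]
  linear_combination η * e

/-! ### Comparison with the exterior Cauchy transform of the inner ellipse -/

/-- The exterior of an ellipse is covered by the Joukowski map. -/
lemma exists_joukowski_eq {κ ζ : ℂ} (hκ : ‖κ‖ < 1) (hζ : 1 ≤ ‖ellipseInv κ ζ‖) :
    ∃ η : ℂ, η ≠ 0 ∧ ‖η‖ ≤ 1 ∧ ζ = η⁻¹ + κ * η := by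
  obtain ⟨s, hs⟩ := IsAlgClosed.exists_pow_nat_eq (ζ ^ 2 - 4 * κ) (n := 2) (by norm_num)
  set x := (ζ + s) / 2 with hx
  set y := (ζ - s) / 2 with hy
  have hsum : ζ = x + y := by rw [hx, hy]; ring
  have hprod : κ = x * y := by rw [hx, hy]; linear_combination hs / 4
  have key : ∀ u v : ℂ, ζ = u + v → κ = u * v → 1 ≤ ‖u‖ →
      ∃ η : ℂ, η ≠ 0 ∧ ‖η‖ ≤ 1 ∧ ζ = η⁻¹ + κ * η := by
    intro u v h1 h2 hu
    have hu0 : u ≠ 0 := fun h => by simp [h] at hu; linarith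
    refine ⟨u⁻¹, inv_ne_zero hu0, by rw [norm_inv]; exact inv_le_one_of_one_le₀ hu, ?_⟩
    rw [h1, h2]; field_simp
  by_cases hx1 : 1 ≤ ‖x‖
  · exact key x y hsum hprod hx1
  by_cases hy1 : 1 ≤ ‖y‖
  · exact key y x (by rw [hsum]; ring) (by rw [hprod]; ring) hy1
  -- two roots in the unit disc would put `ζ` inside the ellipse
  exfalso
  push Not at hx1 hy1
  have hxy : ‖κ‖ = ‖x‖ * ‖y‖ := by rw [hprod, norm_mul]
  have hpos := one_sub_norm_sq_pos hκ
  have e : ζ - κ * conj ζ = ((1 - ‖y‖ ^ 2 : ℝ) : ℂ) * x + ((1 - ‖x‖ ^ 2 : ℝ) : ℂ) * y := by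
    have h1 : x * conj x = ‖x‖ ^ 2 := Complex.mul_conj' x
    have h2 : y * conj y = ‖y‖ ^ 2 := Complex.mul_conj' y
    rw [hsum, hprod, map_add]
    push_cast
    linear_combination -x * h2 - y * h1
  have hx0 := norm_nonneg x
  have hy0 := norm_nonneg y
  have hle : ‖ζ - κ * conj ζ‖ ≤ (1 - ‖y‖ ^ 2) * ‖x‖ + (1 - ‖x‖ ^ 2) * ‖y‖ := by
    rw [e]
    refine (norm_add_le _ _).trans_eq ?_
    rw [norm_mul, norm_mul, norm_real, norm_real, Real.norm_of_nonneg (by nlinarith),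
      Real.norm_of_nonneg (by nlinarith)]
  rw [ellipseInv_apply, norm_mul, norm_real, Real.norm_of_nonneg (inv_nonneg.2 hpos.le),
    ← div_eq_inv_mul, le_div_iff₀ hpos, one_mul, hxy] at hζ
  have h1 : 0 < (1 - ‖x‖ * ‖y‖) * ((1 - ‖x‖) * (1 - ‖y‖)) := by
    have : ‖x‖ * ‖y‖ < 1 := hxy ▸ hκ
    exact mul_pos (by linarith) (mul_pos (by linarith) (by linarith))
  nlinarith

lemma exists_joukowski_eq_add {p z : ℂ} {R : ℝ} (hR : 0 < R) {κ : ℂ} (hκ : ‖κ‖ < 1)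
    (hz : z ∉ solidEllipse p R κ) : ∃ η : ℂ, η ≠ 0 ∧ ‖η‖ ≤ 1 ∧ z = p + R * (η⁻¹ + κ * η) := by
  rw [mem_solidEllipse, not_lt] at hz
  have hRc : (R : ℂ) ≠ 0 := by exact_mod_cast hR.ne'
  obtain ⟨η, h0, h1, h2⟩ := exists_joukowski_eq (ζ := (R⁻¹ : ℝ) • (z - p)) hκ (by
    rw [map_smul, norm_smul, Real.norm_of_nonneg (inv_nonneg.2 hR.le), ← div_eq_inv_mul,
      le_div_iff₀ hR, one_mul]
    exact hz)
  refine ⟨η, h0, h1, ?_⟩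
  rw [← h2, real_smul, ofReal_inv]
  field_simp
  ring

/-- Outside the ellipse, its Cauchy transform is an algebraic function of degree two. -/
lemma sub_mul_cauchyTransform_solidEllipse {p z : ℂ} {R : ℝ} (hR : 0 < R) {κ : ℂ} (hκ : ‖κ‖ < 1)
    (hz : z ∉ solidEllipse p R κ) :
    (z - p) * cauchyTransform (solidEllipse p R κ) z = R ^ 2 * (1 - ‖κ‖ ^ 2) +
      κ / (1 - ‖κ‖ ^ 2) * cauchyTransform (solidEllipse p R κ) z ^ 2 := by
  have h2 : (1 - ‖κ‖ ^ 2 : ℂ) ≠ 0 := by exact_mod_cast one_sub_norm_sq_ne_zero hκ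
  obtain ⟨η, h0, h1, rfl⟩ := exists_joukowski_eq_add hR hκ hz
  rw [← exteriorCauchy_of_ne h0, exteriorCauchy_solidEllipse p hR hκ h1]
  field_simp
  ring

lemma eq_zero_of_eventually_sum_mul_pow_eq_zero {n : ℕ} (a : Fin n → ℂ)
    (h : ∀ᶠ η in 𝓝[≠] (0 : ℂ), ∑ i, a i * η ^ (i : ℕ) = 0) (i : Fin n) : a i = 0 := by
  set q : Polynomial ℂ := ∑ i : Fin n, Polynomial.monomial i (a i) with hq
  have hinf : {η | q.IsRoot η}.Infinite := by
    refine fun hfin => infinite_of_mem_nhds (0 : ℂ) ?_ (hfin.insert 0)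
    filter_upwards [eventually_nhdsWithin_iff.1 h] with η hη
    by_cases h0 : η = 0
    · exact Or.inl h0
    · refine Or.inr ?_
      show q.eval η = 0
      simp [hq, Polynomial.eval_finsetSum, hη h0]
  have h0 := Polynomial.eq_zero_of_infinite_isRoot q hinf
  have h1 : q.coeff i = a i := by
    simp [hq, Polynomial.coeff_monomial, Fin.val_inj]
  rw [← h1, h0, Polynomial.coeff_zero]

/-- The coefficient equations of the comparison of two representations of the Cauchy transform of an
ellipse have only the confocal solution. -/
lemma confocal_of_coeff_eq {r μ k d q₀ q₁ q₂ : ℂ} (hr : r ≠ 0) (hq₀ : q₀ ≠ 0)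
    (h1 : r * q₁ + d * q₀ = 0)
    (h2 : r * q₂ + d * q₁ = -2 * (r * q₀) * k + μ * q₀ ^ 2)
    (h3 : d * q₂ - d * k * q₀ = 2 * μ * q₀ * q₁)
    (h4 : -d * k * q₁ - r * k ^ 2 * q₀ = r * q₀ * k ^ 2 + μ * (q₁ ^ 2 + 2 * q₀ * q₂))
    (h6 : -r * k ^ 2 * q₂ = μ * q₂ ^ 2) :
    d = 0 ∧ q₁ = 0 ∧ r * k = μ * q₀ ∧ q₂ = -k * q₀ := by
  have hd : d = -r * q₁ / q₀ := by field_simp; linear_combination h1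
  by_cases hq₁ : q₁ = 0
  · have hd0 : d = 0 := by rw [hd, hq₁]; simp
    subst hq₁ hd0
    have h7 : r * k = μ * q₀ := by
      have : q₀ * (r * k - μ * q₀) ^ 2 = 0 := by linear_combination -(r / 2) * h4 - μ * q₀ * h2
      have := pow_eq_zero_iff (two_ne_zero) |>.1 ((mul_eq_zero.1 this).resolve_left hq₀)
      linear_combination this
    refine ⟨rfl, rfl, h7, mul_left_cancel₀ hr ?_⟩
    linear_combination h2 - q₀ * h7
  · exfalso
    -- with `t = μ q₀ / r` one finds `q₂ = (k - 2 t) q₀`, `q₁² = 3 (k - t) q₀²`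
    have e3 : r * (q₂ - k * q₀) = -2 * μ * q₀ ^ 2 := by
      refine mul_left_cancel₀ hq₁ (mul_left_cancel₀ (inv_ne_zero hq₀) ?_)
      rw [hd] at h3
      field_simp at h3 ⊢
      linear_combination -h3
    obtain ⟨t, hμ⟩ : ∃ t, μ = t * r / q₀ := ⟨μ * q₀ / r, by field_simp⟩
    have f2 : q₂ = (k - 2 * t) * q₀ := by
      rw [hμ] at e3
      field_simp at e3
      linear_combination e3
    have f1 : q₁ ^ 2 = 3 * (k - t) * q₀ ^ 2 := by
      rw [hd, hμ, f2] at h2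
      field_simp at h2
      linear_combination -h2
    have f4 : (k - t) * (k - 7 * t) = 0 := by
      rw [hd, hμ, f2] at h4
      field_simp at h4
      refine (mul_eq_zero.1 (?_ : q₀ ^ 2 * _ = 0)).resolve_left (pow_ne_zero 2 hq₀)
      linear_combination h4 + (t - k) * f1
    have hkt : k - t ≠ 0 := fun h => hq₁ (by simpa [h] using f1)
    have f5 : k = 7 * t := by linear_combination (mul_eq_zero.1 f4).resolve_left hkt
    rw [hμ, f2, f5] at h6
    field_simp at h6
    have ht3 : t ^ 3 = 0 := by linear_combination -h6 / 54
    have ht0 : t = 0 := pow_eq_zero_iff (three_ne_zero) |>.1 ht3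
    exact hkt (by rw [f5, ht0]; ring)

/-- Tangency on the outer ellipse forces the two ellipses to be confocal and relates the angular
velocity to the geometry. -/
lemma confocal_of_weaklyTangent {p₁ p : ℂ} {R₁ R : ℝ} (hR₁ : 0 < R₁) (hR : 0 < R)
    {κ₁ κ : ℂ} (hκ₁ : ‖κ₁‖ < 1) (hκ : ‖κ‖ < 1)
    (hsub : closure (solidEllipse p R κ) ⊆ solidEllipse p₁ R₁ κ₁) {α : ℝ} (hα : α ≠ 1) {c : ℂ}
    {Ω : ℝ}
    (ht : WeaklyTangent (solidEllipse p₁ R₁ κ₁) fun z =>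
      I / 2 * conj (conjVelocity (solidEllipse p₁ R₁ κ₁) (solidEllipse p R κ) α c Ω z)) :
    p₁ = p ∧ R₁ ^ 2 * κ₁ = R ^ 2 * κ ∧ Ω * (p₁ - c) = 0 ∧
      κ₁ * (R₁ ^ 2 * (1 - 4 * Ω - ‖κ₁‖ ^ 2)) = κ₁ * (-(α - 1) * (R ^ 2 * (1 - ‖κ‖ ^ 2))) := by
  obtain ⟨c₀, hc₀⟩ := exists_exteriorCauchy_eq_of_weaklyTangent hR₁ hκ₁ hκ hsub ht
  have hRc : (R : ℂ) ≠ 0 := by exact_mod_cast hR.ne'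
  have hR₁c : (R₁ : ℂ) ≠ 0 := by exact_mod_cast hR₁.ne'
  have hαc : (α - 1 : ℂ) ≠ 0 := by exact_mod_cast sub_ne_zero.2 hα
  have hκc : (1 - ‖κ‖ ^ 2 : ℂ) ≠ 0 := by exact_mod_cast one_sub_norm_sq_ne_zero hκ
  set m : ℂ := R ^ 2 * (1 - ‖κ‖ ^ 2) with hm
  set μ : ℂ := κ / (1 - ‖κ‖ ^ 2) with hμ
  set d := p₁ - p with hd
  set q₀ : ℂ := c₀ / (α - 1) with hq₀
  set q₁ : ℂ := -2 * Ω * (p₁ - c + conj (p₁ - c) * κ₁) / (α - 1) with hq₁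
  set q₂ : ℂ := R₁ * κ₁ * (1 - 4 * Ω - ‖κ₁‖ ^ 2) / (α - 1) with hq₂
  set P := exteriorCauchy (solidEllipse p R κ) p₁ R₁ κ₁ with hP
  have hPq : ∀ η, ‖η‖ ≤ 1 → (1 - κ₁ * η ^ 2) * P η = η * (q₀ + q₁ * η + q₂ * η ^ 2) := by
    intro η hη
    have := hc₀ η hη
    simp only [hq₀, hq₁, hq₂]
    field_simp
    linear_combination this
  -- coefficients of the quadratic equation for the Cauchy transform, after clearing denominators
  set a : Fin 7 → ℂ := ![R₁ * q₀ - m, R₁ * q₁ + d * q₀,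
    R₁ * q₂ + d * q₁ + 2 * m * κ₁ - μ * q₀ ^ 2, d * q₂ - d * κ₁ * q₀ - 2 * μ * q₀ * q₁,
    -d * κ₁ * q₁ - R₁ * κ₁ ^ 2 * q₀ - m * κ₁ ^ 2 - μ * (q₁ ^ 2 + 2 * q₀ * q₂),
    -d * κ₁ * q₂ - R₁ * κ₁ ^ 2 * q₁ - 2 * μ * q₁ * q₂, -R₁ * κ₁ ^ 2 * q₂ - μ * q₂ ^ 2] with ha
  have hev : ∀ᶠ η in 𝓝[≠] (0 : ℂ), ∑ i, a i * η ^ (i : ℕ) = 0 := by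
    filter_upwards [self_mem_nhdsWithin,
      nhdsWithin_le_nhds (ball_mem_nhds (0 : ℂ) one_pos)] with η h0 hη
    have h0' : η ≠ 0 := h0
    rw [mem_ball_zero_iff] at hη
    have hPη : P η = cauchyTransform (solidEllipse p R κ) (p₁ + R₁ * (η⁻¹ + κ₁ * η)) :=
      exteriorCauchy_of_ne h0'
    have e := sub_mul_cauchyTransform_solidEllipse (p := p) (z := p₁ + R₁ * (η⁻¹ + κ₁ * η)) hR hκ
      fun hz => joukowski_notMem_closure hR₁ hκ₁ h0' hη (subset_closure (hsub (subset_closure hz)))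
    rw [← hPη] at e
    have hz : p₁ + R₁ * (η⁻¹ + κ₁ * η) - p = (d * η + R₁ * (1 + κ₁ * η ^ 2)) / η := by
      rw [hd]; field_simp; ring
    have e2 := hPq η hη.le
    rw [hz, div_mul_eq_mul_div, div_eq_iff h0'] at e
    rw [ha]
    simp only [Fin.sum_univ_succ, Matrix.cons_val_zero, Matrix.cons_val_succ, Fin.val_zero,
      Fin.val_succ, Finset.univ_eq_empty, Finset.sum_empty]
    refine mul_left_cancel₀ h0' ?_
    linear_combination (1 - κ₁ * η ^ 2) ^ 2 * e
      - (1 - κ₁ * η ^ 2) * (d * η + R₁ * (1 + κ₁ * η ^ 2)) * e2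
      + μ * η * ((1 - κ₁ * η ^ 2) * P η + η * (q₀ + q₁ * η + q₂ * η ^ 2)) * e2
  have hcoef := eq_zero_of_eventually_sum_mul_pow_eq_zero a hev
  have a0 : R₁ * q₀ - m = 0 := hcoef 0
  have a1 : R₁ * q₁ + d * q₀ = 0 := hcoef 1
  have a2 : R₁ * q₂ + d * q₁ + 2 * m * κ₁ - μ * q₀ ^ 2 = 0 := hcoef 2
  have a3 : d * q₂ - d * κ₁ * q₀ - 2 * μ * q₀ * q₁ = 0 := hcoef 3
  have a4 : -d * κ₁ * q₁ - R₁ * κ₁ ^ 2 * q₀ - m * κ₁ ^ 2 - μ * (q₁ ^ 2 + 2 * q₀ * q₂) = 0 :=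
    hcoef 4
  have a6 : -R₁ * κ₁ ^ 2 * q₂ - μ * q₂ ^ 2 = 0 := hcoef 6
  have hm' : m = R₁ * q₀ := by linear_combination -a0
  have hm0 : m ≠ 0 := mul_ne_zero (pow_ne_zero 2 hRc) hκc
  have hq0 : q₀ ≠ 0 := fun h => hm0 (by rw [hm', h, mul_zero])
  obtain ⟨r1, r2, r3, r4⟩ := confocal_of_coeff_eq (μ := μ) (k := κ₁) (q₂ := q₂) hR₁c hq0 a1
    (by linear_combination a2 - 2 * κ₁ * hm') (by linear_combination a3)
    (by linear_combination a4 + κ₁ ^ 2 * hm') (by linear_combination a6)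
  refine ⟨sub_eq_zero.1 r1, ?_, ?_, ?_⟩
  · have : μ * m = R ^ 2 * κ := by rw [hμ, hm]; field_simp
    linear_combination R₁ * r3 + this - μ * hm'
  · rw [hq₁, div_eq_zero_iff, or_iff_left hαc] at r2
    by_cases hΩ : Ω = 0
    · simp [hΩ]
    have hΩc : (-2 * Ω : ℂ) ≠ 0 := by simp [hΩ]
    have hx := (mul_eq_zero.1 r2).resolve_left hΩc
    have hn : ‖p₁ - c‖ = ‖p₁ - c‖ * ‖κ₁‖ := by
      nth_rewrite 1 [eq_neg_of_add_eq_zero_left hx]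
      rw [norm_neg, norm_mul, Complex.norm_conj]
    have : ‖p₁ - c‖ = 0 := by
      by_contra hne
      have hpos := lt_of_le_of_ne (norm_nonneg (p₁ - c)) (Ne.symm hne)
      nlinarith
    rw [norm_eq_zero.1 this, mul_zero]
  · rw [hq₂, div_eq_iff hαc] at r4
    linear_combination R₁ * r4 + (α - 1) * κ₁ * hm'

/-! ### The parameters of a rotating configuration -/

lemma volume_real_solidEllipse (p : ℂ) {R : ℝ} (hR : 0 ≤ R) {κ : ℂ} (hκ : ‖κ‖ < 1) :
    volume.real (solidEllipse p R κ) = Real.pi * R ^ 2 * (1 - ‖κ‖ ^ 2) := by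
  have h := integral_image_ellipseMap p hκ (measurableSet_ball (x := (0 : ℂ)) (ε := R))
    (fun _ => (1 : ℝ))
  rw [← solidEllipse_eq_image p R hκ] at h
  simp only [setIntegral_const, smul_eq_mul, mul_one] at h
  rw [h]
  simp [Measure.real, Complex.volume_ball, hR]
  ring

lemma not_closure_solidEllipse_subset_self (p : ℂ) {R : ℝ} (hR : 0 < R) {κ : ℂ} (hκ : ‖κ‖ < 1) :
    ¬ closure (solidEllipse p R κ) ⊆ solidEllipse p R κ := by
  intro h
  have h1 := ellipse_curve_mem_frontier p hR hκ 1
  rw [(isOpen_solidEllipse p R κ).frontier_eq] at h1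
  exact h1.2 (h h1.1)

lemma exists_sub_mul_conj_eq {κ : ℂ} (hκ : ‖κ‖ < 1) (y : ℂ) : ∃ x, x - κ * conj x = y := by
  have h := one_sub_norm_sq_ne_zero hκ
  have hc : (1 - ‖κ‖ ^ 2 : ℂ) ≠ 0 := by exact_mod_cast h
  have h2 : κ * conj κ = ‖κ‖ ^ 2 := Complex.mul_conj' κ
  refine ⟨((1 - ‖κ‖ ^ 2 : ℝ)⁻¹ : ℝ) * (y + κ * conj y), ?_⟩
  simp only [map_mul, map_add, conj_conj, conj_ofReal]
  push_cast
  field_simp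
  linear_combination -y * h2

/-- If the inner patch is an ellipse, then in a rotating configuration the outer boundary is a
confocal ellipse, and the parameters are determined. -/
lemma exists_of_rotatesAbout {D₁ : Set ℂ} (hD₁ : IsOpen D₁) (hc₁ : IsPreconnected D₁)
    (hb₁ : Bornology.IsBounded D₁) (hΓ₁ : IsC1JordanCurve (frontier D₁)) {p : ℂ} {R : ℝ}
    (hR : 0 < R) {κ : ℂ} (hκ : ‖κ‖ < 1) (hκ0 : κ ≠ 0) (hsub : closure (solidEllipse p R κ) ⊆ D₁)
    {α : ℝ} (hα : α ≠ 1) {c : ℂ} {Ω : ℝ}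
    (h : RotatesAbout (patchVorticity D₁ (solidEllipse p R κ) α) c Ω) :
    ∃ R₁ l : ℝ, 0 < R₁ ∧ 0 < l ∧ l < 1 ∧ R₁ ^ 2 * l = R ^ 2 ∧ D₁ = solidEllipse p R₁ (l * κ) ∧
      l * ‖κ‖ ^ 2 = ‖κ‖ ^ 2 + α * (1 - ‖κ‖ ^ 2) ∧ 4 * Ω * ‖κ‖ ^ 2 = α * (‖κ‖ ^ 2 - 1) ∧ c = p := by
  have hf₁ := volume_eq_zero_of_isC1JordanCurve hΓ₁
  obtain ⟨ht₁, ht₂⟩ := (rotatesAbout_patchVorticity_iff hD₁ hb₁ hf₁ (isOpen_solidEllipse p R κ)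
    (volume_frontier_solidEllipse p R κ) hsub hα c Ω).1 h
  have hC := cauchyTransform_eq_affine_of_weaklyTangent hD₁ hc₁ hb₁ hf₁ hR hκ hsub ht₂
  set l : ℝ := 2 * (α - 2 * Ω) / (1 + ‖κ‖ ^ 2) - (α - 1) with hl
  have hlc : (2 * (α - 2 * Ω) / (1 + ‖κ‖ ^ 2) - (α - 1) : ℂ) = l := by rw [hl]; push_cast; rfl
  rw [hlc] at hC
  have hp : p ∈ solidEllipse p R κ := by rw [mem_solidEllipse]; simpa using hR
  have hne : D₁.Nonempty := ⟨p, hsub (subset_closure hp)⟩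
  set κ₁ : ℂ := l * κ with hκ₁def
  have hκ₁ : ‖κ₁‖ < 1 := by
    have := norm_lt_one_of_cauchyTransform_affine hD₁ hne hb₁ hf₁ (A := -(l * conj κ))
      (B := -conj p + 2 * Ω * conj (p - c) + l * conj κ * p) fun z hz => by
        rw [hC z hz, map_sub]; ring
    simpa [hκ₁def] using this
  -- the center of the outer ellipse is the zero of the affine function
  set y : ℂ := -2 * Ω * (p - c) with hy
  obtain ⟨x, hx⟩ := exists_sub_mul_conj_eq hκ₁ y
  obtain ⟨p₁, rfl⟩ : ∃ p₁, x = p₁ - p := ⟨x + p, by ring⟩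
  have hC' : ∀ z ∈ D₁, cauchyTransform D₁ z = conj (z - p₁) - conj κ₁ * (z - p₁) := by
    intro z hz
    have hx' := congrArg conj hx
    simp only [map_sub, map_mul, conj_conj, hy, map_neg, conj_ofReal, map_ofNat] at hx'
    rw [hC z hz]
    simp only [hκ₁def, map_sub, map_mul, conj_ofReal] at hx' ⊢
    linear_combination hx'
  obtain ⟨R₁, hR₁, hD₁s, hvol⟩ := exists_solidEllipse_of_cauchyTransform_affine hD₁ hne hb₁ hf₁
    hκ₁ hC'
  have hDE := eq_solidEllipse_of_volume_diff_eq_zero hD₁ hΓ₁ hR₁ hκ₁ hD₁s hvol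
  rw [hDE] at hsub ht₁
  obtain ⟨r1, r2, r3, r4⟩ := confocal_of_weaklyTangent hR₁ hR hκ₁ hκ hsub hα ht₁
  have hRl : R₁ ^ 2 * l = R ^ 2 := by
    rw [hκ₁def, ← mul_assoc] at r2
    exact_mod_cast mul_right_cancel₀ hκ0 r2
  have hl0 : 0 < l := pos_of_mul_pos_right (by rw [hRl]; positivity) (by positivity : 0 ≤ R₁ ^ 2)
  have hκ₁0 : κ₁ ≠ 0 := mul_ne_zero (by exact_mod_cast hl0.ne') hκ0
  have r5 : R₁ ^ 2 * (1 - 4 * Ω - ‖κ₁‖ ^ 2) = -(α - 1) * (R ^ 2 * (1 - ‖κ‖ ^ 2)) := by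
    exact_mod_cast mul_left_cancel₀ hκ₁0 r4
  have hnκ₁ : ‖κ₁‖ ^ 2 = l ^ 2 * ‖κ‖ ^ 2 := by
    rw [hκ₁def, norm_mul, norm_real, Real.norm_of_nonneg hl0.le, mul_pow]
  have hR₁2 : 0 < R₁ ^ 2 := by positivity
  have hκpos : 0 < ‖κ‖ ^ 2 := by have := norm_pos_iff.2 hκ0; positivity
  have hκlt := one_sub_norm_sq_pos hκ
  -- the two expressions for the angular velocity
  have r6 : 1 - 4 * Ω - l ^ 2 * ‖κ‖ ^ 2 = -(α - 1) * (l * (1 - ‖κ‖ ^ 2)) := by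
    rw [hnκ₁, ← hRl] at r5
    refine mul_left_cancel₀ hR₁2.ne' ?_
    linear_combination r5
  have r7 : 4 * Ω = 2 * α - (l + α - 1) * (1 + ‖κ‖ ^ 2) := by
    have : (1 + ‖κ‖ ^ 2) ≠ 0 := by positivity
    rw [hl]; field_simp; ring
  have r8 : (l - 1) * (l * ‖κ‖ ^ 2 - (‖κ‖ ^ 2 + α * (1 - ‖κ‖ ^ 2))) = 0 := by
    linear_combination -r6 - r7
  have hl1 : l ≠ 1 := by
    intro h1
    have hRR : R₁ = R := by
      rw [h1, mul_one] at hRl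
      exact (pow_left_inj₀ hR₁.le hR.le two_ne_zero).1 hRl
    rw [r1, hRR, hκ₁def, h1, ofReal_one, one_mul] at hsub
    exact not_closure_solidEllipse_subset_self p hR hκ hsub
  have hle : l ≤ 1 := by
    have h1 : volume.real (solidEllipse p R κ) ≤ volume.real (solidEllipse p₁ R₁ κ₁) :=
      measureReal_mono (subset_closure.trans hsub)
        (isBounded_solidEllipse p₁ R₁ hκ₁).measure_lt_top.ne
    rw [volume_real_solidEllipse p hR.le hκ, volume_real_solidEllipse p₁ hR₁.le hκ₁, hnκ₁, ← hRl]
      at h1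
    have h2 : 0 ≤ (Real.pi * R₁ ^ 2) * ((1 - l) * (1 + l * ‖κ‖ ^ 2)) := by linarith
    have h3 : 0 ≤ (1 - l) * (1 + l * ‖κ‖ ^ 2) := by
      refine nonneg_of_mul_nonneg_right h2 (by have := Real.pi_pos; positivity)
    linarith [nonneg_of_mul_nonneg_left h3 (by positivity : 0 < 1 + l * ‖κ‖ ^ 2)]
  have hlt : l < 1 := lt_of_le_of_ne hle hl1
  have r9 : l * ‖κ‖ ^ 2 = ‖κ‖ ^ 2 + α * (1 - ‖κ‖ ^ 2) := by
    linarith [(mul_eq_zero.1 r8).resolve_left (sub_ne_zero.2 hl1)]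
  have r10 : 4 * Ω * ‖κ‖ ^ 2 = α * (‖κ‖ ^ 2 - 1) := by
    linear_combination ‖κ‖ ^ 2 * r7 - (1 + ‖κ‖ ^ 2) * r9
  have hΩ : Ω ≠ 0 := by
    rintro rfl
    have : α = 0 := by
      rw [mul_zero, zero_mul] at r10
      exact (mul_eq_zero.1 r10.symm).resolve_right (by linarith)
    rw [this, zero_mul, add_zero] at r9
    exact hl1 (mul_right_cancel₀ hκpos.ne' (by rw [r9, one_mul]))
  refine ⟨R₁, l, hR₁, hl0, hlt, hRl, r1 ▸ hDE, r9, r10, ?_⟩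
  have := (mul_eq_zero.1 r3).resolve_left (by exact_mod_cast hΩ)
  rw [← r1]
  exact (sub_eq_zero.1 this).symm

/-! ### Confocal ellipses rotate -/

/-- Outside the larger of two confocal ellipses, their Cauchy transforms are proportional. -/
lemma cauchyTransform_confocal {p z : ℂ} {R R₁ l : ℝ} (hR : 0 < R) (hR₁ : 0 < R₁) {κ : ℂ}
    (hκ : ‖κ‖ < 1) (hκ₁ : ‖l * κ‖ < 1) (hl1 : l ≤ 1) (hRl : R₁ ^ 2 * l = R ^ 2)
    (hz : z ∉ solidEllipse p R₁ (l * κ)) :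
    cauchyTransform (solidEllipse p R κ) z = ((l * (1 - ‖κ‖ ^ 2) / (1 - ‖l * κ‖ ^ 2) : ℝ) : ℂ) *
      cauchyTransform (solidEllipse p R₁ (l * κ)) z := by
  have hRc : (R : ℂ) ≠ 0 := by exact_mod_cast hR.ne'
  have hR₁c : (R₁ : ℂ) ≠ 0 := by exact_mod_cast hR₁.ne'
  have hκ₁c : (1 - ‖l * κ‖ ^ 2 : ℂ) ≠ 0 := by exact_mod_cast one_sub_norm_sq_ne_zero hκ₁
  have hRlc : (R₁ ^ 2 * l : ℂ) = R ^ 2 := by exact_mod_cast hRl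
  obtain ⟨η, h0, h1, rfl⟩ := exists_joukowski_eq_add hR₁ hκ₁ hz
  have hRR : R / R₁ ≤ 1 := by
    rw [div_le_one hR₁]
    refine le_of_sq_le_sq ?_ hR₁.le
    rw [← hRl]
    nlinarith [pow_pos hR₁ 2]
  set η' : ℂ := (R / R₁ : ℝ) * η with hη'
  have h0' : η' ≠ 0 := mul_ne_zero (by exact_mod_cast (div_pos hR hR₁).ne') h0
  have h1' : ‖η'‖ ≤ 1 := by
    rw [hη', norm_mul, norm_real, Real.norm_of_nonneg (div_pos hR hR₁).le]
    exact mul_le_one₀ hRR (norm_nonneg _) h1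
  -- the two exterior conformal maps agree up to a dilation of the disc
  have harg : p + R₁ * (η⁻¹ + l * κ * η) = p + R * (η'⁻¹ + κ * η') := by
    rw [hη']
    push_cast
    field_simp
    linear_combination κ * η ^ 2 * hRlc
  rw [← exteriorCauchy_of_ne h0 (D := solidEllipse p R₁ (l * κ)),
    exteriorCauchy_solidEllipse p hR₁ hκ₁ h1, harg, ← exteriorCauchy_of_ne h0', exteriorCauchy_solidEllipse p hR hκ h1', hη']
  push_cast at hκ₁c ⊢
  field_simp
  linear_combination -(1 - ‖κ‖ ^ 2) * hRlc

/-- Confocal ellipses with the right parameters rotate: on the outer one, the field of the inner one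
may be replaced by a multiple of its own field, and then all fields involved are linear. -/
lemma rotatesAbout_confocal {p : ℂ} {R R₁ l : ℝ} (hR : 0 < R) (hR₁ : 0 < R₁) {κ : ℂ} (hκ0 : κ ≠ 0)
    (hκ : ‖κ‖ < 1) (hl0 : 0 < l) (hl1 : l < 1) (hRl : R₁ ^ 2 * l = R ^ 2) {α Ω : ℝ} (hα : α ≠ 1)
    (hlα : l * ‖κ‖ ^ 2 = ‖κ‖ ^ 2 + α * (1 - ‖κ‖ ^ 2))
    (hΩ : 4 * Ω * ‖κ‖ ^ 2 = α * (‖κ‖ ^ 2 - 1))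
    (hsub : closure (solidEllipse p R κ) ⊆ solidEllipse p R₁ (l * κ)) :
    RotatesAbout (patchVorticity (solidEllipse p R₁ (l * κ)) (solidEllipse p R κ) α) p Ω := by
  have hnκ₁ : ‖l * κ‖ = l * ‖κ‖ := by rw [norm_mul, norm_real, Real.norm_of_nonneg hl0.le]
  have hκ₁ : ‖l * κ‖ < 1 := by rw [hnκ₁]; nlinarith [norm_nonneg κ]
  have hq : 0 < ‖κ‖ ^ 2 := by have := norm_pos_iff.2 hκ0; positivity
  set E := solidEllipse p R κ with hE
  set E₁ := solidEllipse p R₁ (l * κ) with hE₁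
  have hEo : IsOpen E := isOpen_solidEllipse p R κ
  have hE₁o : IsOpen E₁ := isOpen_solidEllipse p R₁ (l * κ)
  have hEb : Bornology.IsBounded E := isBounded_solidEllipse p R hκ
  have hE₁b : Bornology.IsBounded E₁ := isBounded_solidEllipse p R₁ hκ₁
  have hEf := volume_frontier_solidEllipse p R κ
  have hE₁f := volume_frontier_solidEllipse p R₁ (l * κ)
  have hc : Continuous (cauchyTransform E) :=
    continuous_cauchyTransform hEo.measurableSet hEb hEf
  have hc₁ : Continuous (cauchyTransform E₁) :=
    continuous_cauchyTransform hE₁o.measurableSet hE₁b hE₁f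
  refine (rotatesAbout_patchVorticity_iff hE₁o hE₁b hE₁f hEo hEf hsub hα p Ω).2 ⟨?_, ?_⟩
  · set s : ℝ := l * (1 - ‖κ‖ ^ 2) / (1 - ‖l * κ‖ ^ 2) with hs
    set A : ℝ := 1 + (α - 1) * s with hA
    have hsq : (1 - l ^ 2 * ‖κ‖ ^ 2) ≠ 0 := by
      have := (one_sub_norm_sq_pos hκ₁).ne'
      rwa [hnκ₁, mul_pow] at this
    have hAΩ : A * (1 - l ^ 2 * ‖κ‖ ^ 2) = 4 * Ω := by
      have hs' : s * (1 - l ^ 2 * ‖κ‖ ^ 2) = l * (1 - ‖κ‖ ^ 2) := by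
        rw [hs, hnκ₁, mul_pow]
        exact div_mul_cancel₀ _ hsq
      refine mul_right_cancel₀ hq.ne' ?_
      rw [hA]
      linear_combination (α - 1) * ‖κ‖ ^ 2 * hs' - hΩ - (1 + l * ‖κ‖ ^ 2) * hlα
    -- the difference of the two velocities vanishes outside the outer ellipse
    have hu : WeaklyTangent E₁ fun z =>
        I / 2 * conj (cauchyTransform E z) - s * (I / 2 * conj (cauchyTransform E₁ z)) := by
      intro χ hχ hχs
      have t1 : WeaklyTangent univ fun z => I / 2 * conj (cauchyTransform E₁ z) :=
        fun χ hχ hs => by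
          rw [setIntegral_univ, integral_fderiv_velocity hE₁o.measurableSet hE₁b
            (hχ.of_le one_le_smooth) hs]
      have t2 : WeaklyTangent univ fun z => I / 2 * conj (cauchyTransform E z) :=
        fun χ hχ hs => by
          rw [setIntegral_univ, integral_fderiv_velocity hEo.measurableSet hEb
            (hχ.of_le one_le_smooth) hs]
      have t3 := t2.sub (t1.smul s) (by fun_prop) (by fun_prop) χ hχ hχs
      rw [setIntegral_univ] at t3
      rw [← t3]
      refine setIntegral_eq_integral_of_forall_compl_eq_zero fun z hz => ?_
      beta_reduce
      rw [hE, cauchyTransform_confocal hR hR₁ hκ hκ₁ hl1.le hRl hz, map_mul, conj_ofReal]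
      rw [show ∀ a b : ℂ, I / 2 * (a * b) - a * (I / 2 * b) = 0 from fun a b => by ring, map_zero]
    have hlin := weaklyTangent_solidEllipse p R₁ hκ₁ (A - 2 * Ω)
    refine ((hu.smul (α - 1)).add hlin (by fun_prop) (by fun_prop)).congr hE₁o.measurableSet
      fun z hz => ?_
    beta_reduce
    rw [conjVelocity, hE₁, cauchyTransform_solidEllipse hR₁ hκ₁ (mem_solidEllipse.1 hz).le]
    have e1 : ((A - 2 * Ω : ℝ) : ℂ) * (2 * conj (l * κ) / (1 + ‖l * κ‖ ^ 2)) = A * conj (l * κ) := by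
      have h1 : (A - 2 * Ω) * 2 = A * (1 + l ^ 2 * ‖κ‖ ^ 2) := by linarith
      have h2 : (1 + l ^ 2 * ‖κ‖ ^ 2 : ℂ) ≠ 0 := by
        exact_mod_cast (by positivity : (1 + l ^ 2 * ‖κ‖ ^ 2 : ℝ) ≠ 0)
      have h3 : ((A - 2 * Ω : ℝ) : ℂ) * 2 = A * (1 + l ^ 2 * ‖κ‖ ^ 2) := by exact_mod_cast h1
      rw [hnκ₁, ofReal_mul, mul_pow, mul_div_assoc', div_eq_iff h2]
      linear_combination conj (l * κ) * h3
    have e2 : ((A - 2 * Ω : ℝ) : ℂ) *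
        (conj (z - p) - 2 * conj (l * κ) / (1 + ‖l * κ‖ ^ 2) * (z - p)) =
        A * (conj (z - p) - conj (l * κ) * (z - p)) - 2 * Ω * conj (z - p) := by
      rw [mul_sub, ← mul_assoc, e1]
      push_cast
      ring
    rw [e2, hA]
    simp only [map_add, map_sub, map_mul, conj_conj, conj_ofReal, map_ofNat, map_one]
    push_cast
    ring
  · refine (weaklyTangent_solidEllipse p R hκ (α - 2 * Ω)).congr hEo.measurableSet fun z hz => ?_
    beta_reduce
    rw [conjVelocity_eq_of_mem_solidEllipse hR hκ α p Ω hz,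
      cauchyTransform_solidEllipse hR₁ hκ₁ (mem_solidEllipse.1 (hsub (subset_closure hz))).le]
    have h1 : l = 2 * (α - 2 * Ω) / (1 + ‖κ‖ ^ 2) - (α - 1) := by
      have : (1 + ‖κ‖ ^ 2) ≠ 0 := by positivity
      field_simp
      refine mul_right_cancel₀ hq.ne' ?_
      linear_combination (1 + ‖κ‖ ^ 2) * hlα + hΩ
    have h2 : (2 * (α - 2 * Ω) / (1 + ‖κ‖ ^ 2) - (α - 1) : ℂ) = l := by rw [h1]; push_cast; rfl
    rw [h2]
    congr 2
    simp only [map_mul, conj_ofReal, sub_self, map_zero]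
    push_cast
    ring

/-! ### Total mass and center of mass -/

lemma totalMass_patchVorticity {D₁ D₂ : Set ℂ} (hm₁ : MeasurableSet D₁)
    (hb₁ : Bornology.IsBounded D₁) (hm₂ : MeasurableSet D₂) (hb₂ : Bornology.IsBounded D₂) (α : ℝ) :
    totalMass (patchVorticity D₁ D₂ α) = volume.real D₁ + (α - 1) * volume.real D₂ := by
  have h1 : Integrable (D₁.indicator fun _ => (1 : ℝ)) :=
    (integrable_indicator_iff hm₁).2 (integrableOn_const hb₁.measure_lt_top.ne)
  have h2 : Integrable (D₂.indicator fun _ => (1 : ℝ)) :=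
    (integrable_indicator_iff hm₂).2 (integrableOn_const hb₂.measure_lt_top.ne)
  simp only [totalMass, patchVorticity]
  rw [integral_add h1 (h2.const_mul _), integral_const_mul, integral_indicator hm₁,
    integral_indicator hm₂]
  simp

/-- The center of mass of a centrally symmetric vorticity. -/
lemma centerOfMass_eq_of_symm {w : ℂ → ℝ} {p : ℂ} (hw : Integrable w)
    (hzw : Integrable fun z => z * (w z : ℂ)) (hsymm : ∀ z, w (2 * p - z) = w z)
    (hM : totalMass w ≠ 0) : centerOfMass w = p := by
  have h1 := integral_sub_left_eq_self (fun z => z * (w z : ℂ)) volume (2 * p)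
  have hwc : Integrable fun z => (w z : ℂ) := hw.ofReal
  have h2 : ∫ z, (2 * p - z) * (w (2 * p - z) : ℂ) =
      2 * p * (totalMass w : ℂ) - ∫ z, z * (w z : ℂ) := by
    rw [totalMass, ← integral_complex_ofReal, ← integral_const_mul, ← integral_sub (hwc.const_mul _) hzw]
    congr 1 with z
    rw [hsymm]; ring
  rw [h2] at h1
  rw [centerOfMass, div_eq_iff (by exact_mod_cast hM)]
  linear_combination -h1 / 2

lemma two_mul_sub_mem_solidEllipse {p z : ℂ} {R : ℝ} {κ : ℂ} :
    2 * p - z ∈ solidEllipse p R κ ↔ z ∈ solidEllipse p R κ := by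
  rw [mem_solidEllipse, mem_solidEllipse, show 2 * p - z - p = -(z - p) by ring, map_neg, norm_neg]

lemma integrable_mul_patchVorticity {D₁ D₂ : Set ℂ} (hm₁ : MeasurableSet D₁)
    (hb₁ : Bornology.IsBounded D₁) (hm₂ : MeasurableSet D₂) (hb₂ : Bornology.IsBounded D₂) (α : ℝ) :
    Integrable fun z => z * (patchVorticity D₁ D₂ α z : ℂ) := by
  have key : ∀ {D : Set ℂ}, MeasurableSet D → Bornology.IsBounded D →
      Integrable fun z : ℂ => D.indicator (fun z => z) z := fun hm hb =>
    (integrable_indicator_iff hm).2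
      ((continuousOn_id.integrableOn_compact hb.isCompact_closure).mono_set subset_closure)
  refine ((key hm₁ hb₁).add ((key hm₂ hb₂).const_mul ((α : ℂ) - 1))).congr
    (Eventually.of_forall fun z => ?_)
  by_cases h1 : z ∈ D₁ <;> by_cases h2 : z ∈ D₂ <;> simp [patchVorticity, h1, h2] <;> ring

/-- A rotating pair of confocal ellipses rotates around its center of mass. -/
lemma rotatesUniformly_confocal {p : ℂ} {R R₁ l : ℝ} (hR : 0 < R) (hR₁ : 0 < R₁) {κ : ℂ}
    (hκ0 : κ ≠ 0) (hκ : ‖κ‖ < 1) (hl0 : 0 < l) (hl1 : l < 1) (hRl : R₁ ^ 2 * l = R ^ 2) {α Ω : ℝ}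
    (hα : α ≠ 1) (hlα : l * ‖κ‖ ^ 2 = ‖κ‖ ^ 2 + α * (1 - ‖κ‖ ^ 2))
    (hΩ : 4 * Ω * ‖κ‖ ^ 2 = α * (‖κ‖ ^ 2 - 1))
    (hsub : closure (solidEllipse p R κ) ⊆ solidEllipse p R₁ (l * κ)) :
    RotatesUniformly (patchVorticity (solidEllipse p R₁ (l * κ)) (solidEllipse p R κ) α) Ω := by
  have hnκ₁ : ‖l * κ‖ = l * ‖κ‖ := by rw [norm_mul, norm_real, Real.norm_of_nonneg hl0.le]
  have hκ₁ : ‖l * κ‖ < 1 := by rw [hnκ₁]; nlinarith [norm_nonneg κ]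
  have hq : 0 < ‖κ‖ ^ 2 := by have := norm_pos_iff.2 hκ0; positivity
  have hm := measurableSet_solidEllipse p R κ
  have hm₁ := measurableSet_solidEllipse p R₁ (l * κ)
  have hb := isBounded_solidEllipse p R hκ
  have hb₁ := isBounded_solidEllipse p R₁ hκ₁
  have hM : totalMass (patchVorticity (solidEllipse p R₁ (l * κ)) (solidEllipse p R κ) α) ≠ 0 := by
    rw [totalMass_patchVorticity hm₁ hb₁ hm hb, volume_real_solidEllipse p hR.le hκ,
      volume_real_solidEllipse p hR₁.le hκ₁, hnκ₁, ← hRl]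
    -- the mass is a multiple of `1 - l`
    have e : (Real.pi * R₁ ^ 2 * (1 - (l * ‖κ‖) ^ 2) +
        (α - 1) * (Real.pi * (R₁ ^ 2 * l) * (1 - ‖κ‖ ^ 2))) * ‖κ‖ ^ 2 =
        Real.pi * R₁ ^ 2 * ((1 - l) * ‖κ‖ ^ 2) := by
      linear_combination (Real.pi * R₁ ^ 2) * (-l * ‖κ‖ ^ 2) * hlα
    intro h0
    rw [h0, zero_mul] at e
    have := Real.pi_pos
    have h2 : 0 < Real.pi * R₁ ^ 2 * ((1 - l) * ‖κ‖ ^ 2) := by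
      have : 0 < 1 - l := by linarith
      positivity
    exact h2.ne e
  refine ⟨hM, ?_⟩
  rw [centerOfMass_eq_of_symm (p := p) (integrable_patchVorticity hm₁ hb₁ hm hb α)
    (integrable_mul_patchVorticity hm₁ hb₁ hm hb α) (fun z => ?_) hM]
  · exact rotatesAbout_confocal hR hR₁ hκ0 hκ hl0 hl1 hRl hα hlα hΩ hsub
  · have key : ∀ (R : ℝ) (κ : ℂ), (solidEllipse p R κ).indicator (fun _ => (1 : ℝ)) (2 * p - z) =
        (solidEllipse p R κ).indicator (fun _ => (1 : ℝ)) z := by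
      intro R κ
      by_cases h : z ∈ solidEllipse p R κ
      · rw [indicator_of_mem h, indicator_of_mem (two_mul_sub_mem_solidEllipse.2 h)]
      · rw [indicator_of_notMem h,
          indicator_of_notMem fun h' => h (two_mul_sub_mem_solidEllipse.1 h')]
    rw [patchVorticity, patchVorticity, key, key]

/-! ### Semi-axes and foci -/

lemma ellipseQ_nonneg {a b : ℝ} (hb : 0 < b) (hab : b ≤ a) : 0 ≤ ellipseQ a b :=
  div_nonneg (by linarith) (by linarith)

lemma ellipseQ_lt_one {a b : ℝ} (hb : 0 < b) (hab : b ≤ a) : ellipseQ a b < 1 := by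
  rw [ellipseQ, div_lt_one (by linarith)]; linarith

lemma norm_ellipseQ_mul_exp {a b : ℝ} (hb : 0 < b) (hab : b ≤ a) (θ : ℝ) :
    ‖(ellipseQ a b : ℂ) * Complex.exp (I * θ) ^ 2‖ = ellipseQ a b := by
  rw [norm_mul, norm_pow, norm_exp_I_mul_ofReal, one_pow, mul_one, norm_real,
    Real.norm_of_nonneg (ellipseQ_nonneg hb hab)]

/-- An ellipse given by its semi-axes, in terms of the inverse of `w ↦ w + κ * conj w`. -/
lemma ellipse_eq {p : ℂ} {θ a b : ℝ} (hb : 0 < b) (hab : b ≤ a) :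
    ellipse p θ a b =
      {z | ‖ellipseInv (ellipseQ a b * Complex.exp (I * θ) ^ 2) (z - p)‖ = (a + b) / 2} := by
  ext z
  have ha : 0 < a := hb.trans_le hab
  have hs : 0 < a + b := by linarith
  set e := Complex.exp (I * θ) with he
  have hen : ‖e‖ = 1 := norm_exp_I_mul_ofReal θ
  have hec : e * conj e = 1 := by rw [Complex.mul_conj', hen]; simp
  have hinv : Complex.exp (-(I * θ)) * e = 1 := exp_neg_mul_exp_I θ
  set u := Complex.exp (-(I * θ)) * (z - p) with hu
  have hzu : z - p = e * u := by rw [hu]; linear_combination -(z - p) * hinv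
  set Q := ellipseQ a b with hQ
  have hQ1 : 1 + Q = 2 * a / (a + b) := by rw [hQ, ellipseQ]; field_simp; ring
  have hQ2 : 1 - Q = 2 * b / (a + b) := by rw [hQ, ellipseQ]; field_simp; ring
  have hκn : ‖(Q : ℂ) * e ^ 2‖ = Q := norm_ellipseQ_mul_exp hb hab θ
  have hprod : 1 - Q ^ 2 = 4 * a * b / (a + b) ^ 2 := by
    rw [show 1 - Q ^ 2 = (1 + Q) * (1 - Q) by ring, hQ1, hQ2]; field_simp; ring
  have hpos : 0 < 1 - Q ^ 2 := by rw [hprod]; positivity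
  have h1 : ellipseInv (Q * e ^ 2) (z - p) = ((1 - Q ^ 2)⁻¹ : ℝ) * (e * (u - Q * conj u)) := by
    rw [ellipseInv_apply, hκn, hzu, map_mul]
    congr 1
    linear_combination -Q * e * conj u * hec
  have h2 : ‖u - Q * conj u‖ ^ 2 = ((1 - Q) * u.re) ^ 2 + ((1 + Q) * u.im) ^ 2 := by
    rw [← normSq_eq_norm_sq, normSq_apply]
    simp
    ring
  have h3 : ‖ellipseInv (Q * e ^ 2) (z - p)‖ = (1 - Q ^ 2)⁻¹ * ‖u - Q * conj u‖ := by
    rw [h1, norm_mul, norm_mul, hen, one_mul, norm_real, Real.norm_of_nonneg (by positivity)]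
  show (u.re / a) ^ 2 + (u.im / b) ^ 2 = 1 ↔ ‖ellipseInv (Q * e ^ 2) (z - p)‖ = (a + b) / 2
  rw [← pow_left_inj₀ (norm_nonneg _) (by positivity) two_ne_zero, h3, mul_pow, h2, hQ1, hQ2, hprod]
  have h4 : ((4 * a * b / (a + b) ^ 2)⁻¹) ^ 2 *
      ((2 * b / (a + b) * u.re) ^ 2 + (2 * a / (a + b) * u.im) ^ 2) =
      ((u.re / a) ^ 2 + (u.im / b) ^ 2) * ((a + b) / 2) ^ 2 := by
    field_simp
    ring
  rw [h4]
  constructor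
  · intro h; rw [h, one_mul]
  · intro h
    exact mul_right_cancel₀ (pow_ne_zero 2 (by positivity : (a + b) / 2 ≠ 0)) (by rw [h, one_mul])

/-- Two ellipses are confocal exactly if they have the same center and `R ^ 2 * κ` agrees. -/
lemma ellipseFoci_eq_iff {p₁ p₂ : ℂ} {θ₁ θ₂ a₁ b₁ a₂ b₂ : ℝ} (hb₁ : 0 < b₁) (hab₁ : b₁ ≤ a₁)
    (hb₂ : 0 < b₂) (hab₂ : b₂ ≤ a₂) :
    ellipseFoci p₁ θ₁ a₁ b₁ = ellipseFoci p₂ θ₂ a₂ b₂ ↔ p₁ = p₂ ∧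
      (((a₁ + b₁) / 2 : ℝ) : ℂ) ^ 2 * (ellipseQ a₁ b₁ * Complex.exp (I * θ₁) ^ 2) =
        (((a₂ + b₂) / 2 : ℝ) : ℂ) ^ 2 * (ellipseQ a₂ b₂ * Complex.exp (I * θ₂) ^ 2) := by
  have key : ∀ {a b : ℝ} (θ : ℝ), 0 < b → b ≤ a →
      (Real.sqrt (a ^ 2 - b ^ 2) * Complex.exp (I * θ)) ^ 2 =
        4 * ((((a + b) / 2 : ℝ) : ℂ) ^ 2 * (ellipseQ a b * Complex.exp (I * θ) ^ 2)) := by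
    intro a b θ hb hab
    have h1 : (Real.sqrt (a ^ 2 - b ^ 2)) ^ 2 = 4 * (((a + b) / 2) ^ 2 * ellipseQ a b) := by
      rw [Real.sq_sqrt (by nlinarith), ellipseQ]
      have : a + b ≠ 0 := by linarith
      field_simp
      ring
    have h2 : (Real.sqrt (a ^ 2 - b ^ 2) : ℂ) ^ 2 =
        4 * ((((a + b) / 2 : ℝ) : ℂ) ^ 2 * ellipseQ a b) := by exact_mod_cast h1
    linear_combination Complex.exp (I * θ) ^ 2 * h2
  have k₁ := key θ₁ hb₁ hab₁
  have k₂ := key θ₂ hb₂ hab₂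
  rw [ellipseFoci, ellipseFoci]
  set f₁ := Real.sqrt (a₁ ^ 2 - b₁ ^ 2) * Complex.exp (I * θ₁)
  set f₂ := Real.sqrt (a₂ ^ 2 - b₂ ^ 2) * Complex.exp (I * θ₂)
  rw [pair_eq_pair_iff]
  constructor
  · rintro (⟨h1, h2⟩ | ⟨h1, h2⟩)
    · have hp : p₁ = p₂ := by linear_combination (h1 + h2) / 2
      have hf : f₁ = f₂ := by linear_combination (h1 - h2) / 2
      exact ⟨hp, by rw [hf] at k₁; linear_combination (k₂ - k₁) / 4⟩
    · have hp : p₁ = p₂ := by linear_combination (h1 + h2) / 2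
      have hf : f₁ = -f₂ := by linear_combination (h1 - h2) / 2
      exact ⟨hp, by rw [hf, neg_sq] at k₁; linear_combination (k₂ - k₁) / 4⟩
  · rintro ⟨rfl, h⟩
    have hf : f₁ ^ 2 = f₂ ^ 2 := by rw [k₁, k₂, h]
    rcases sq_eq_sq_iff_eq_or_eq_neg.1 hf with hf | hf
    · exact Or.inl (by rw [hf]; simp)
    · exact Or.inr (by rw [hf]; constructor <;> ring)

lemma eq_solidEllipse_of_frontier_eq_ellipse {D : Set ℂ} (hD : IsBddSimplyConnectedDomain D)
    {p : ℂ} {θ a b : ℝ} (hb : 0 < b) (hab : b ≤ a) (hf : frontier D = ellipse p θ a b) :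
    D = solidEllipse p ((a + b) / 2) (ellipseQ a b * Complex.exp (I * θ) ^ 2) := by
  refine eq_solidEllipse_of_frontier_eq hD.isOpen ?_ hD.isBounded (by linarith)
    (hf.trans (ellipse_eq hb hab))
  exact hD.isSimplyConnected.nonempty

end

theorem theorem2
    (D₁ D₂ : Set ℂ) (hD₁ : IsBddSimplyConnectedDomain D₁) (hD₂ : IsBddSimplyConnectedDomain D₂)
    (hsub : closure D₂ ⊆ D₁) (hΓ₁ : IsC1JordanCurve (frontier D₁))
    (p₂ : ℂ) (θ₂ a₂ b₂ : ℝ) (hb₂ : 0 < b₂) (hab₂ : b₂ < a₂)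
    (hΓ₂ : frontier D₂ = ellipse p₂ θ₂ a₂ b₂)
    (α : ℝ) (hα : α ≠ 1) (Ω : ℝ) :
    (RotatesUniformly (patchVorticity D₁ D₂ α) Ω ↔
      ∃ (p₁ : ℂ) (θ₁ a₁ b₁ : ℝ), 0 < b₁ ∧ b₁ ≤ a₁ ∧
        frontier D₁ = ellipse p₁ θ₁ a₁ b₁ ∧
        ellipseFoci p₁ θ₁ a₁ b₁ = ellipseFoci p₂ θ₂ a₂ b₂ ∧
        Ω = α * ((ellipseQ a₂ b₂ ^ 2 - 1) / (4 * ellipseQ a₂ b₂ ^ 2)) ∧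
        ellipseQ a₁ b₁ = ellipseQ a₂ b₂ * (α / ellipseQ a₂ b₂ ^ 2 + 1 - α) ∧
        ellipseQ a₂ b₂ ^ 2 / (ellipseQ a₂ b₂ ^ 2 - 1) < α ∧ α < 0) ∧
    ((∃ c : ℂ, RotatesAbout (patchVorticity D₁ D₂ α) c Ω) →
      RotatesUniformly (patchVorticity D₁ D₂ α) Ω) ∧
    (α = 0 → ¬ ∃ c : ℂ, RotatesAbout (patchVorticity D₁ D₂ α) c Ω) := by
  have hE₂ := eq_solidEllipse_of_frontier_eq_ellipse hD₂ hb₂ hab₂.le hΓ₂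
  have hκn := norm_ellipseQ_mul_exp hb₂ hab₂.le θ₂
  set Q := ellipseQ a₂ b₂ with hQ
  set κ : ℂ := Q * Complex.exp (Complex.I * θ₂) ^ 2 with hκdef
  set R := (a₂ + b₂) / 2 with hRdef
  have hR : 0 < R := by rw [hRdef]; linarith
  have hQ0 : 0 < Q := div_pos (by linarith) (by linarith)
  have hQ1 : Q < 1 := ellipseQ_lt_one hb₂ hab₂.le
  have hκ : ‖κ‖ < 1 := hκn ▸ hQ1
  have hκ0 : κ ≠ 0 := norm_pos_iff.1 (hκn ▸ hQ0)
  have hq : 0 < 1 - Q ^ 2 := by nlinarith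
  have hΩiff : Ω = α * ((Q ^ 2 - 1) / (4 * Q ^ 2)) ↔ 4 * Ω * ‖κ‖ ^ 2 = α * (‖κ‖ ^ 2 - 1) := by
    rw [hκn, mul_div_assoc', eq_div_iff (by positivity)]
    constructor <;> intro h <;> linear_combination h
  subst hE₂
  have key : ∀ c, RotatesAbout (patchVorticity D₁ (solidEllipse p₂ R κ) α) c Ω → _ := fun c h =>
    exists_of_rotatesAbout hD₁.isOpen hD₁.isSimplyConnected.isPathConnected.isConnected.isPreconnected
      hD₁.isBounded hΓ₁ hR hκ hκ0 hsub hα h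
  refine ⟨⟨?_, ?_⟩, ?_, ?_⟩
  · rintro ⟨-, h⟩
    obtain ⟨R₁, l, hR₁, hl0, hl1, hRl, hD, hlα, hΩ, -⟩ := key _ h
    rw [hκn] at hlα
    have hlQ0 : 0 < l * Q := mul_pos hl0 hQ0
    have hlQ1 : l * Q < 1 := by nlinarith
    have hb₁ : 0 < R₁ * (1 - l * Q) := mul_pos hR₁ (by linarith)
    have hab₁ : R₁ * (1 - l * Q) ≤ R₁ * (1 + l * Q) :=
      mul_le_mul_of_nonneg_left (by linarith) hR₁.le
    have hsum : (R₁ * (1 + l * Q) + R₁ * (1 - l * Q)) / 2 = R₁ := by ring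
    have hQ₁ : ellipseQ (R₁ * (1 + l * Q)) (R₁ * (1 - l * Q)) = l * Q := by
      rw [ellipseQ]; field_simp; ring
    have hκ₁ : ((l * Q : ℝ) : ℂ) * Complex.exp (Complex.I * θ₂) ^ 2 = l * κ := by
      rw [hκdef]; push_cast; ring
    refine ⟨p₂, θ₂, R₁ * (1 + l * Q), R₁ * (1 - l * Q), hb₁, hab₁, ?_, ?_, hΩiff.2 hΩ, ?_, ?_, ?_⟩
    · have hlκ : ‖l * κ‖ < 1 := by
        rw [norm_mul, Complex.norm_real, Real.norm_of_nonneg hl0.le, hκn]; exact hlQ1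
      rw [hD, frontier_solidEllipse p₂ hR₁ hlκ, ellipse_eq hb₁ hab₁, hQ₁, hsum, hκ₁]
    · rw [ellipseFoci_eq_iff hb₁ hab₁ hb₂ hab₂.le, hQ₁, hsum, hκ₁]
      refine ⟨rfl, ?_⟩
      have hRlc : (R₁ ^ 2 * l : ℂ) = R ^ 2 := by exact_mod_cast hRl
      linear_combination κ * hRlc
    · rw [hQ₁]
      field_simp
      linear_combination hlα
    · rw [div_lt_iff_of_neg (by linarith)]
      have : 0 < l * Q ^ 2 := by positivity
      linarith
    · have : α * (1 - Q ^ 2) < 0 := by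
        have : l * Q ^ 2 < Q ^ 2 := by nlinarith [pow_pos hQ0 2]
        linarith
      exact neg_of_mul_neg_left this hq.le
  · rintro ⟨p₁, θ₁, a₁, b₁, hb₁, hab₁, hΓ, hfoci, hΩ, hQQ, hα1, hα2⟩
    have hD := eq_solidEllipse_of_frontier_eq_ellipse hD₁ hb₁ hab₁ hΓ
    obtain ⟨rfl, hfoc⟩ := (ellipseFoci_eq_iff hb₁ hab₁ hb₂ hab₂.le).1 hfoci
    set R₁ := (a₁ + b₁) / 2 with hR₁def
    have hR₁ : 0 < R₁ := by rw [hR₁def]; linarith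
    obtain ⟨l, hl⟩ : ∃ l, l = α / Q ^ 2 + 1 - α := ⟨_, rfl⟩
    have hlα : l * Q ^ 2 = Q ^ 2 + α * (1 - Q ^ 2) := by rw [hl]; field_simp; ring
    rw [← hl] at hQQ
    rw [div_lt_iff_of_neg (by linarith)] at hα1
    have hl0 : 0 < l := by
      refine pos_of_mul_pos_left (b := Q ^ 2) ?_ (by positivity)
      linarith
    have hl1 : l < 1 := by
      refine lt_of_mul_lt_mul_right (a := Q ^ 2) ?_ (by positivity)
      nlinarith
    have hRl : R₁ ^ 2 * l = R ^ 2 := by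
      have h1 : ‖(R₁ : ℂ) ^ 2 * (ellipseQ a₁ b₁ * Complex.exp (Complex.I * θ₁) ^ 2)‖ =
          ‖(R : ℂ) ^ 2 * κ‖ := congrArg norm hfoc
      rw [norm_mul ((R₁ : ℂ) ^ 2), norm_mul ((R : ℂ) ^ 2), norm_ellipseQ_mul_exp hb₁ hab₁, hκn,
        hQQ] at h1
      simp only [norm_pow, Complex.norm_real, Real.norm_of_nonneg hR.le, Real.norm_of_nonneg hR₁.le] at h1
      refine mul_right_cancel₀ hQ0.ne' ?_
      linear_combination h1
    have hκ₁ : (ellipseQ a₁ b₁ : ℂ) * Complex.exp (Complex.I * θ₁) ^ 2 = l * κ := by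
      have hRlc : (R₁ ^ 2 * l : ℂ) = R ^ 2 := by exact_mod_cast hRl
      have hR₁c : (R₁ : ℂ) ≠ 0 := by exact_mod_cast hR₁.ne'
      refine mul_left_cancel₀ (pow_ne_zero 2 hR₁c) ?_
      rw [hfoc]
      linear_combination -κ * hRlc
    rw [hκ₁] at hD
    subst hD
    exact rotatesUniformly_confocal hR hR₁ hκ0 hκ hl0 hl1 hRl hα (by rw [hκn]; exact hlα)
      (hΩiff.1 hΩ) hsub
  · rintro ⟨c, h⟩
    obtain ⟨R₁, l, hR₁, hl0, hl1, hRl, hD, hlα, hΩ, -⟩ := key _ h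
    subst hD
    exact rotatesUniformly_confocal hR hR₁ hκ0 hκ hl0 hl1 hRl hα hlα hΩ hsub
  · rintro rfl ⟨c, h⟩
    obtain ⟨R₁, l, -, -, hl1, -, -, hlα, -⟩ := key _ h
    rw [zero_mul, add_zero] at hlα
    have : 0 < ‖κ‖ ^ 2 := by rw [hκn]; positivity
    exact hl1.ne (mul_right_cancel₀ this.ne' (by rw [hlα, one_mul]))
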